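/- **Conventions.** For $N\ge 0$ let $D_N=\{x\in\mathbb Z^N: x_1+\dots+x_N\in 2\mathbb Z\}$ with the standard scalar product $(\cdot,\cdot)_N$, and let $D_N(2)$ be the same group with the form $2(\cdot,\cdot)_N$. Write $L\otimes\mathbb C=\mathbb C^N$ with coordinates $z_1,\dots,z_N$, so $z_j=(\mathfrak z,\varepsilon_j)_N$, and $q=e^{2\pi i\tau}$. Let $L$ be a positive definite even lattice with form $(\cdot,\cdot)$, $k\in\frac12\mathbb Z$, $t\in\mathbb Q_{\ge0}$, and let $v$ be a character (for half-integral $k$: a multiplier system) of $\mathrm{SL}(2,\mathbb Z)$. A *holomorphic Jacobi form* of weight $k$ and index $t$ for $L$ with character $v$ (notation $\varphi\in J_{k,L;t}(v)$, and $J_{k,L;t}$ if $v=1$) is a holomorphic function $\varphi:\mathbb H\times(L\otimes\mathbb C)\to\mathbb C$ such that $$(c\tau+d)^{-k}e^{-\pi i t\frac{c(\mathfrak z,\mathfrak z)}{c\tau+d}}\varphi\Big(\frac{a\tau+b}{c\tau+d},\frac{\mathfrak z}{c\tau+d}\Big)=v(A)\,\varphi(\tau,\mathfrak z)\quad\text{for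 all }A=\begin{pmatrix}a&b\\c&d\end{pmatrix}\in\mathrm{SL}(2,\mathbb Z),$$ $$e^{2\pi i t(\frac12(x,x)\tau+(x,\mathfrak z)+\frac12(x,y)+r)}\varphi(\tau,\mathfrak z+x\tau+y)=\varphi(\tau,\mathfrak z)\quad\text{for all }x,y\in L,\ r\in\tfrac12\mathbb Z,\ r+\tfrac12(x,y)\in\mathbb Z,$$ and such that $\varphi(\tau,\mathfrak z)=\sum f(n,l)e^{2\pi i(n\tau+(l,\mathfrak z))}$, where, for some $D\in\mathbb N$, the sum is over $n\in\frac D{24}+\mathbb Z$ and $l\in\frac12L^\vee$, and $f(n,l)\ne0$ implies $n\ge0$ and $2nt-(l,l)\ge0$. It is a *cusp form* if moreover $f(n,l)\neq0$ implies $2nt-(l,l)>0$. Half-integral powers of $c\tau+d$ are principal. Let $\eta$ be Dedekind's eta function, and let $v_\eta$ be its multiplier system: $\eta(A\tau)=v_\eta(A)(c\tau+d)^{1/2}\eta(\tau)$. Put $\vartheta(\tau,z)=\sum_{n\in\mathbb Z}\left(\frac{-4}n\right)q^{n^2/8}e^{\pi i nz}$ and $\vartheta_{D_N}(\tau,\mathfrak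 z)=\prod_{j=1}^N\vartheta(\tau,z_j)$. Let $$\phi_{0,1}=\frac{e_4^2\,e_{4,1}-e_6\,e_{6,1}}{\frac1{12}(e_4^3-e_6^2)},$$ where $e_k(\tau)=1-\frac{2k}{B_k}\sum_{n\ge1}\sigma_{k-1}(n)q^n$ and $$e_{k,1}(\tau,z)=\frac12\sum_{\substack{c,d\in\mathbb Z\\ \gcd(c,d)=1}}\sum_{\lambda\in\mathbb Z}(c\tau+d)^{-k}\exp\Big(2\pi i\Big(\lambda^2\frac{a\tau+b}{c\tau+d}+\frac{2\lambda z}{c\tau+d}-\frac{cz^2}{c\tau+d}\Big)\Big)$$ is the Jacobi–Eisenstein series ($a,b$ being any integers with $ad-bc=1$). For functions $\varphi$ on $\mathbb H\times\mathbb C^{N+1}$ and $\psi$ on $\mathbb H\times\mathbb C^{N}$ write $\varphi\to\psi$ if $\psi(\tau,z_1,\dots,z_N)=\alpha\,\varphi(\tau,z_1,\dots,z_N,0)$ for some constant $\alpha\in\mathbb C^\times$. **Theorem.** (a) For all $N\ge1$ we have $\vartheta_{D_N}\in J_{N/2,D_N;1}(v_\eta^{3N})$. Put $\psi_{12-N,D_N}(\tau,\mathfrak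 z)=\eta(\tau)^{24-3N}\vartheta_{D_N}(\tau,\mathfrak z)$ for $0\le N\le 8$ (so that $\psi_{12,D_0}=\eta^{24}$). For $1\le N\le 8$ we have $\psi_{12-N,D_N}\in J_{12-N,D_N;1}$, and this is a cusp form if and only if $N<8$. Moreover $\psi_{4,D_8}=\vartheta_{D_8}$, and for $1\le N\le8$ $$\left.\frac{\partial\psi_{12-N,D_N}}{\partial z_N}\right|_{z_N=0}=2\pi i\,\psi_{13-N,D_{N-1}}.$$ (b) For $1\le N\le8$ and even $k$ with $24-2N\le k\le22$ define $\phi_{k,D_N(2)}:\mathbb H\times\mathbb C^N\to\mathbb C$ recursively by $$\phi_{24-2N,D_N(2)}=\psi_{12-N,D_N}^2,\qquad \phi_{k,D_N(2)}(\tau,\mathfrak z)=\phi_{0,1}(\tau,z_N)\,\phi_{k,D_{N-1}(2)}(\tau,z_1,\dots,z_{N-1})\quad(k\ge26-2N).$$ Then $\phi_{k,D_N(2)}\in J_{k,D_N(2);1}$ for all these $N$ and $k$, and it is a cusp form if and only if $N<8$. For $2\le N\le 8$ and even $k$ with $26-2N\le k\le22$ we have $\phi_{k,D_N(2)}\to\phi_{k,D_{N-1}(2)}$.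 -/

import Mathlib

open Complex
open UpperHalfPlane hiding I
open scoped Real MatrixGroups

namespace LatticeJacobi

noncomputable section

/-- The scalar product `s · ∑ x_j y_j` of scale `s`, over any commutative ring of coordinates. -/
def form {R : Type*} [CommRing R] {N : ℕ} (s : ℕ) (x y : Fin N → R) : R :=
  (s : R) * ∑ j, x j * y j

/-- A positive definite even lattice of rank `N`: a subgroup of `ℤ^N` of full rank, with the
bilinear form `s · (x, y)_N`. As the rank is full, `L ⊗ ℂ` is `ℂ^N`, with coordinates
`z_j = (z, ε_j)_N`. -/
structure EvenLattice (N : ℕ) where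
  carrier : AddSubgroup (Fin N → ℤ)
  scale : ℕ
  scale_pos : 0 < scale
  even : ∀ x ∈ carrier, Even (form scale x x)
  full_rank : ∃ m : ℕ, 0 < m ∧ ∀ x : Fin N → ℤ, m • x ∈ carrier

/-- The lattice `L(m)`: the same group, with the bilinear form multiplied by `m > 0`. -/
def EvenLattice.rescale {N : ℕ} (L : EvenLattice N) (m : ℕ) (hm : 0 < m) : EvenLattice N where
  carrier := L.carrier
  scale := m * L.scale
  scale_pos := Nat.mul_pos hm L.scale_pos
  even := fun x hx => by
    have h : form (m * L.scale) x x = (m : ℤ) * form L.scale x x := by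
      simp only [form]; push_cast; ring
    rw [h]
    exact (L.even x hx).mul_left _
  full_rank := L.full_rank

/-- `D_N = {x ∈ ℤ^N : x_1 + ⋯ + x_N even}` with the standard scalar product. -/
def latticeD (N : ℕ) : EvenLattice N where
  carrier :=
    { carrier := {x | Even (∑ j, x j)}
      zero_mem' := by simp
      add_mem' := fun {x y} hx hy => by
        simp only [Set.mem_ofPred_eq, Pi.add_apply, Finset.sum_add_distrib] at *
        exact hx.add hy
      neg_mem' := fun {x} hx => by
        simpa [Finset.sum_neg_distrib] using hx }
  scale := 1
  scale_pos := one_pos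
  even := fun x hx => by
    have hx' : Even (∑ j, x j) := hx
    have h : Even (∑ j, (x j * x j - x j)) := by
      refine Finset.even_sum _ fun j _ => ?_
      have := Int.even_mul_pred_self (x j)
      rwa [mul_sub, mul_one] at this
    rw [Finset.sum_sub_distrib] at h
    have := h.add hx'
    simpa [form] using this
  full_rank := ⟨2, two_pos, fun x => by
    change Even (∑ j, (2 • x) j)
    simp only [Pi.smul_apply, nsmul_eq_mul, ← Finset.mul_sum]
    exact even_two_mul _⟩

/-- `D_N(2)`. -/
def latticeD2 (N : ℕ) : EvenLattice N := (latticeD N).rescale 2 two_pos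

/-- Membership of a rational vector in the dual lattice `L^∨`. -/
def EvenLattice.InDual {N : ℕ} (L : EvenLattice N) (l : Fin N → ℚ) : Prop :=
  ∀ x ∈ L.carrier, ∃ m : ℤ, form L.scale l (fun j => (x j : ℚ)) = m

/-- Elements `[x, y : r]` of the integral Heisenberg group `H(L)`. (Since `(x, y)` is an integer,
the condition forces `r ∈ ½ℤ`.) -/
structure Heisenberg {N : ℕ} (L : EvenLattice N) where
  x : Fin N → ℤ
  y : Fin N → ℤ
  r : ℚ
  x_mem : x ∈ L.carrier
  y_mem : y ∈ L.carrier
  integral : ∃ m : ℤ, r + ((form L.scale x y : ℤ) : ℚ) / 2 = m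

/-- The function `φ|_{k,t} A` for `A ∈ SL(2, ℤ)`; for half-integral `k` the power of `cτ + d` is
the principal branch. -/
def slashSL {N : ℕ} (L : EvenLattice N) (k t : ℚ) (φ : ℍ → (Fin N → ℂ) → ℂ) (A : SL(2, ℤ))
    (τ : ℍ) (z : Fin N → ℂ) : ℂ :=
  let j : ℂ := (A 1 0 : ℂ) * (τ : ℂ) + (A 1 1 : ℂ)
  j ^ (-(k : ℂ)) * cexp (-(π * I * t * ((A 1 0 : ℂ) * form L.scale z z / j))) *
    φ (A • τ) (fun i => z i / j)

/-- The function `φ|_{k,t} [x, y : r]` (it does not depend on `k`). -/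
def slashHeisenberg {N : ℕ} (L : EvenLattice N) (t : ℚ) (φ : ℍ → (Fin N → ℂ) → ℂ)
    (h : Heisenberg L) (τ : ℍ) (z : Fin N → ℂ) : ℂ :=
  cexp (2 * π * I * t * (((form L.scale h.x h.x : ℤ) : ℂ) / 2 * (τ : ℂ) +
      form L.scale (fun i => (h.x i : ℂ)) z + ((form L.scale h.x h.y : ℤ) : ℂ) / 2 + (h.r : ℂ))) *
    φ τ (fun i => z i + (h.x i : ℂ) * (τ : ℂ) + (h.y i : ℂ))

/-- Joint holomorphy on `ℍ × ℂ^N`. -/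
def IsHolomorphic {N : ℕ} (φ : ℍ → (Fin N → ℂ) → ℂ) : Prop :=
  DifferentiableOn ℂ (fun p : ℂ × (Fin N → ℂ) => φ (ofComplex p.1) p.2) {p | 0 < p.1.im}

/-- `φ` is holomorphic and satisfies `φ|g = χ(g) φ` for all `g` in the Jacobi group
`SL(2, ℤ) ⋉ H(L)`, where `χ = v · ν`. Since every `g` is a product of an element of `SL(2, ℤ)`
and an element of `H(L)`, invariance is demanded on these two subgroups. For half-integral `k`
the function `v` is a multiplier system (with respect to the principal branch). -/
structure Transforms {N : ℕ} (L : EvenLattice N) (k t : ℚ) (v : SL(2, ℤ) → ℂ)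
    (ν : Heisenberg L → ℂ) (φ : ℍ → (Fin N → ℂ) → ℂ) : Prop where
  holomorphic : IsHolomorphic φ
  modular : ∀ A τ z, slashSL L k t φ A τ z = v A * φ τ z
  elliptic : ∀ h τ z, slashHeisenberg L t φ h τ z = ν h * φ τ z

/-- `φ(τ, z) = ∑ f(n, l) exp (2πi (nτ + (l, z)))`, where the sum ranges over `n ∈ ℚ`,
`n ≡ D/24 mod ℤ`, and `l ∈ ½L^∨`, and `f(n, l) ≠ 0` implies `P n (l, l)`. -/
def HasFourierExpansion {N : ℕ} (L : EvenLattice N) (φ : ℍ → (Fin N → ℂ) → ℂ)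
    (P : ℚ → ℚ → Prop) : Prop :=
  ∃ (D : ℕ) (f : ℚ × (Fin N → ℚ) → ℂ),
    (∀ n l, f (n, l) ≠ 0 →
      (∃ m : ℤ, n = (D : ℚ) / 24 + m) ∧ L.InDual (2 • l) ∧ P n (form L.scale l l)) ∧
    ∀ (τ : ℍ) (z : Fin N → ℂ),
      HasSum (fun p : ℚ × (Fin N → ℚ) =>
        f p * cexp (2 * π * I * ((p.1 : ℂ) * (τ : ℂ) + form L.scale (fun i => (p.2 i : ℂ)) z)))
        (φ τ z)

/-- Weak Jacobi forms of weight `k` and index `t` for `L` with character `v · ν`. -/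
def IsWeakJacobiForm {N : ℕ} (L : EvenLattice N) (k t : ℚ) (v : SL(2, ℤ) → ℂ)
    (ν : Heisenberg L → ℂ) (φ : ℍ → (Fin N → ℂ) → ℂ) : Prop :=
  Transforms L k t v ν φ ∧ HasFourierExpansion L φ (fun n _ => 0 ≤ n)

/-- Holomorphic Jacobi forms, the space `J_{k,L;t}(v · ν)`. -/
def IsJacobiForm {N : ℕ} (L : EvenLattice N) (k t : ℚ) (v : SL(2, ℤ) → ℂ)
    (ν : Heisenberg L → ℂ) (φ : ℍ → (Fin N → ℂ) → ℂ) : Prop :=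
  Transforms L k t v ν φ ∧ HasFourierExpansion L φ (fun n ll => 0 ≤ n ∧ 0 ≤ 2 * n * t - ll)

/-- Jacobi cusp forms. -/
def IsJacobiCuspForm {N : ℕ} (L : EvenLattice N) (k t : ℚ) (v : SL(2, ℤ) → ℂ)
    (ν : Heisenberg L → ℂ) (φ : ℍ → (Fin N → ℂ) → ℂ) : Prop :=
  Transforms L k t v ν φ ∧ HasFourierExpansion L φ (fun n ll => 0 ≤ n ∧ 0 < 2 * n * t - ll)

/-- The multiplier system of `η`, given by `η(Aτ) = v_η(A) (cτ + d)^{1/2} η(τ)` with the principal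
branch of the root. The quotient does not depend on `τ`; it is evaluated at `τ = i`. -/
def vEta (A : SL(2, ℤ)) : ℂ :=
  ModularForm.eta (↑(A • UpperHalfPlane.I) : ℂ) /
    (((A 1 0 : ℂ) * I + (A 1 1 : ℂ)) ^ (1 / 2 : ℂ) * ModularForm.eta I)

/-- The Jacobi theta series `ϑ(τ, z) = ∑_n (-4/n) q^{n²/8} r^{n/2}`; `(-4/n)` is the nontrivial
character mod 4. -/
def theta (τ : ℍ) (z : ℂ) : ℂ :=
  ∑' n : ℤ, ((ZMod.χ₄ (n : ZMod 4) : ℤ) : ℂ) *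
    cexp (π * I * (n : ℂ) ^ 2 * (τ : ℂ) / 4 + π * I * n * z)

/-- `ϑ_L(τ, z) = ∏_j ϑ(τ, z_j)` on `ℍ × ℂ^N`. -/
def thetaD (N : ℕ) (τ : ℍ) (z : Fin N → ℂ) : ℂ := ∏ j, theta τ (z j)

/-- `ψ_{12-N, D_N} = η^{24-3N} ϑ_{D_N}`; for `N = 0` this is `Δ_12 = η^24`. -/
def psi (N : ℕ) (τ : ℍ) (z : Fin N → ℂ) : ℂ :=
  ModularForm.eta (τ : ℂ) ^ (24 - 3 * (N : ℤ)) * thetaD N τ z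

/-- The Jacobi–Eisenstein series `e_{k,1}` for `A_1`:
`½ ∑_{gcd(c,d)=1} ∑_λ (cτ+d)^{-k} exp (2πi (λ² (aτ+b)/(cτ+d) + 2λz/(cτ+d) - cz²/(cτ+d)))`,
where `a, b` are any integers with `ad - bc = 1` (here those of the extended Euclidean
algorithm). -/
def jacobiEisenstein (k : ℕ) (τ : ℍ) (z : ℂ) : ℂ :=
  1 / 2 * ∑' p : {p : ℤ × ℤ // Int.gcd p.1 p.2 = 1} × ℤ,
    let c : ℤ := p.1.1.1
    let d : ℤ := p.1.1.2
    let a : ℤ := Int.gcdB c d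
    let b : ℤ := -Int.gcdA c d
    let l : ℤ := p.2
    let j : ℂ := (c : ℂ) * (τ : ℂ) + (d : ℂ)
    (j ^ k)⁻¹ * cexp (2 * π * I *
      ((l : ℂ) ^ 2 * (((a : ℂ) * (τ : ℂ) + (b : ℂ)) / j) + 2 * (l : ℂ) * z / j
        - (c : ℂ) * z ^ 2 / j))

/-- The weak Jacobi form `φ_{0,1}` for `A_1`,
`φ_{0,1} = (e_4² e_{4,1} - e_6 e_{6,1}) / ((e_4³ - e_6²) / 12)`, where `e_4` and `e_6` are the
classical Eisenstein series, normalized by the constant term `1`. -/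
def phi01 (τ : ℍ) (z : ℂ) : ℂ :=
  (ModularForm.E₄ τ ^ 2 * jacobiEisenstein 4 τ z - ModularForm.E₆ τ * jacobiEisenstein 6 τ z) /
    (1 / 12 * (ModularForm.E₄ τ ^ 3 - ModularForm.E₆ τ ^ 2))

/-- The pullback from `ℂ^{N+1}` to `ℂ^N`, that is, to `z_{N+1} = 0`. -/
def pullback {N : ℕ} (φ : ℍ → (Fin (N + 1) → ℂ) → ℂ) (τ : ℍ) (z : Fin N → ℂ) : ℂ :=
  φ τ (Fin.snoc z 0)

/-- `φ → ψ`: the form `ψ` is a nonzero multiple of the pullback of `φ`. -/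
def PullsBackTo {N : ℕ} (φ : ℍ → (Fin (N + 1) → ℂ) → ℂ) (ψ : ℍ → (Fin N → ℂ) → ℂ) : Prop :=
  ∃ α : ℂ, α ≠ 0 ∧ ∀ τ z, ψ τ z = α * pullback φ τ z

/-- Multiplication by `φ_{0,1}(τ, z_{N+1})`. -/
def timesPhi01 {N : ℕ} (φ : ℍ → (Fin N → ℂ) → ℂ) (τ : ℍ) (z : Fin (N + 1) → ℂ) : ℂ :=
  phi01 τ (z (Fin.last N)) * φ τ (Fin.init z)

/-- The tower `φ_{k, D_N(2)}`, for even `k` with `24 - 2N ≤ k`: it starts on the line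
`k = 24 - 2N` with `ψ_{12-N, D_N}²`, and `φ_{k, D_{N+1}(2)} = φ_{0,1}(τ, z_{N+1}) φ_{k, D_N(2)}`
beyond it. (The value at `N = 0` is used only for `k = 24`.) -/
def phiD (k : ℕ) : (N : ℕ) → ℍ → (Fin N → ℂ) → ℂ
  | 0 => fun τ z => psi 0 τ z ^ 2
  | N + 1 =>
    if k + 2 * (N + 1) = 24 then fun τ z => psi (N + 1) τ z ^ 2
    else timesPhi01 (phiD k N)

end

end LatticeJacobi

/-! Everything reduces to two one-variable functions, `theta` and `phi01`: their transformation
laws, and the exponents in their expansions at the cusp.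

For `theta`, the functional equation of `jacobiTheta₂` gives the behaviour under S and T, and
`thetaDeriv_eq`, ∂ϑ/∂z(τ, 0) = 2πi η³, identifies the multiplier. Indeed ϑ/η³ then has weight -1,
index 1/2 and no multiplier at all, so it can be checked on generators (`theta_smul`). The same
identity gives the quasi-pullbacks. It is proved by a principle used throughout
(`exists_eq_mul_eta_pow`): the eighth power is a cusp form of weight 12, hence a multiple of η²⁴,
and a continuous function on the connected ℍ with constant eighth power is constant.

For `phi01`, the Jacobi–Eisenstein series is absolutely convergent and is a sum of slash translates
of `th0`. Each translate lies in the two-dimensional span of `th0` and `th1`; hence so does φ_{0,1}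
(`phi01_decomp`), whose coefficients are power series in q, up to a factor q^{-1/4} at `th1`. So its
exponents satisfy 2n - u²/2 ≥ -1/2. Moreover φ_{0,1}(τ, 0) = 12, which gives the arrows of the
tower. The term of norm -1/2 really occurs: otherwise φ_{0,1}(τ, 1/2)² would be a modular function
of level two tending to 144 at one cusp and to 0 at the other (`eq_zero_of_tendsto_level_two`,
`tendsto_phi01_half_ne`).

The norm 2n - (l, l) is then bounded below factor by factor: terms of ϑ have norm 0, η^m contributes
at least m/12, and φ_{0,1} at least -1/2. This gives 2 - N/4 for ψ and 4 - N/2 for every form in the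
tower of rank N, positive exactly for N < 8. For N = 8 a cusp form would satisfy q^{(l, l)/2} φ(τ,
lτ) → 0 at i∞ for every rational l (`IsJacobiCuspForm.tendsto_zero`); at l = (-1/2, …, -1/2) the
limit is nonzero. -/

namespace LatticeJacobi

noncomputable section

/-! ### Generators of SL(2, ℤ), the automorphy factor and the Jacobi slash operator -/

open ModularGroup Filter Topology
open scoped ModularForm Manifold

/-- Induction on `SL(2, ℤ)`, which is generated by `S` and `T` as a monoid. -/
theorem SL2Z_induction {P : SL(2, ℤ) → Prop} (hS : P S) (hT : P T)
    (hmul : ∀ A B, P A → P B → P (A * B)) (A : SL(2, ℤ)) : P A := by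
  -- S has order four and (ST)³ = S², so both inverses are products of S and T.
  have hS' : P S⁻¹ := by
    have : (S⁻¹ : SL(2, ℤ)) = S * (S * S) := by decide
    rw [this]; exact hmul _ _ hS (hmul _ _ hS hS)
  have hT' : P T⁻¹ := by
    have : (T⁻¹ : SL(2, ℤ)) = S * (T * (S * (T * S⁻¹))) := by decide
    rw [this]; exact hmul _ _ hS (hmul _ _ hT (hmul _ _ hS (hmul _ _ hT hS')))
  have h1 : P 1 := by simpa using hmul _ _ hS hS'
  have key : A ∈ Subgroup.closure ({S, T} : Set SL(2, ℤ)) := by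
    rw [SpecialLinearGroup.SL2Z_generators]; trivial
  have : P A ∧ P A⁻¹ := by
    induction key using Subgroup.closure_induction with
    | mem x hx => rcases hx with rfl | rfl <;> exact ⟨‹_›, ‹_›⟩
    | one => simpa using h1
    | mul x y _ _ hx hy => exact ⟨hmul _ _ hx.1 hy.1, by simpa using hmul _ _ hy.2 hx.2⟩
    | inv x _ hx => simpa using hx.symm
  exact this.1

/-- The automorphy factor `cτ + d`. -/
def jac (A : SL(2, ℤ)) (τ : ℍ) : ℂ := (A 1 0 : ℂ) * τ + (A 1 1 : ℂ)

theorem jac_eq_denom (A : SL(2, ℤ)) (τ : ℍ) : jac A τ = denom A τ := by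
  simp [jac, denom]

theorem jac_ne_zero (A : SL(2, ℤ)) (τ : ℍ) : jac A τ ≠ 0 := by
  rw [jac_eq_denom]; exact denom_ne_zero _ _

theorem coe_SL_smul (A : SL(2, ℤ)) (τ : ℍ) :
    ((A • τ : ℍ) : ℂ) = ((A 0 0 : ℂ) * τ + (A 0 1 : ℂ)) / jac A τ := by
  rw [UpperHalfPlane.coe_specialLinearGroup_apply]
  simp [jac]

theorem det_SL (A : SL(2, ℤ)) : (A 0 0 : ℂ) * A 1 1 - A 0 1 * A 1 0 = 1 := by
  have := A.det_coe
  rw [Matrix.det_fin_two] at this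
  exact_mod_cast this

theorem jac_mul (A B : SL(2, ℤ)) (τ : ℍ) : jac (A * B) τ = jac A (B • τ) * jac B τ := by
  have hB := jac_ne_zero B τ
  rw [jac, jac, coe_SL_smul]
  field_simp
  simp only [Matrix.SpecialLinearGroup.coe_mul, Matrix.mul_apply, Fin.sum_univ_two, jac]
  push_cast
  ring

@[simp] theorem jac_S (τ : ℍ) : jac S τ = τ := by simp [jac, S]
@[simp] theorem jac_T (τ : ℍ) : jac T τ = 1 := by simp [jac, T]

theorem coe_S_smul (τ : ℍ) : ((S • τ : ℍ) : ℂ) = -1 / τ := by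
  rw [coe_SL_smul, jac_S]; simp [S]

theorem coe_T_smul (τ : ℍ) : ((T • τ : ℍ) : ℂ) = τ + 1 := by
  rw [coe_SL_smul, jac_T]; simp [T]

theorem S_smul_S_smul (τ : ℍ) : S • S • τ = τ := by
  ext
  rw [coe_S_smul, coe_S_smul]
  field_simp [τ.ne_zero]

/-- The one-variable Jacobi slash operator of weight `k` and index `m`. -/
def jslash (k : ℤ) (m : ℂ) (A : SL(2, ℤ)) (φ : ℍ → ℂ → ℂ) (τ : ℍ) (z : ℂ) : ℂ :=
  jac A τ ^ (-k) * cexp (-(2 * π * I * m * (A 1 0 : ℂ) * z ^ 2 / jac A τ)) *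
    φ (A • τ) (z / jac A τ)

theorem jslash_mul (k : ℤ) (m : ℂ) (A B : SL(2, ℤ)) (φ : ℍ → ℂ → ℂ) :
    jslash k m (A * B) φ = jslash k m B (jslash k m A φ) := by
  funext τ z
  have hA := jac_ne_zero A (B • τ)
  have hB := jac_ne_zero B τ
  simp only [jslash, jac_mul, mul_zpow, mul_smul]
  rw [div_div, mul_comm (jac B τ) (jac A _)]
  have h : cexp (-(2 * π * I * m * ((A * B) 1 0 : ℂ) * z ^ 2 / (jac A (B • τ) * jac B τ))) =
      cexp (-(2 * π * I * m * (B 1 0 : ℂ) * z ^ 2 / jac B τ)) *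
      cexp (-(2 * π * I * m * (A 1 0 : ℂ) * (z / jac B τ) ^ 2 / jac A (B • τ))) := by
    rw [← Complex.exp_add]
    congr 1
    -- The cocycle identity behind the exponential factors; it uses that B has determinant one.
    have e : jac A (B • τ) * (B 1 0 : ℂ) + (A 1 0 : ℂ) / jac B τ = ((A * B) 1 0 : ℂ) := by
      have hd := det_SL B
      rw [jac, coe_SL_smul]
      field_simp
      simp only [Matrix.SpecialLinearGroup.coe_mul, Matrix.mul_apply, Fin.sum_univ_two, jac]
      push_cast
      linear_combination (-(A 1 0 : ℂ)) * hd
    rw [← e]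
    field_simp
    ring
  rw [h]
  ring

theorem jslash_eq_of_generators {k : ℤ} {m : ℂ} {φ : ℍ → ℂ → ℂ} (hS : jslash k m S φ = φ)
    (hT : jslash k m T φ = φ) (A : SL(2, ℤ)) : jslash k m A φ = φ := by
  induction A using SL2Z_induction with
  | hS => exact hS
  | hT => exact hT
  | hmul A B hA hB => rw [jslash_mul, hA, hB]

/-! ### Modular forms of level one and their q-expansions -/

theorem slash_eq_of_generators {k : ℤ} {f : ℍ → ℂ} (hS : ∀ τ, f (S • τ) = (τ : ℂ) ^ k * f τ)
    (hT : ∀ τ, f (T • τ) = f τ) (γ : SL(2, ℤ)) : f ∣[k] γ = f := by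
  refine SlashInvariantForm.slash_action_generators_SL2Z ?_ ?_ γ
  · ext τ
    rw [ModularForm.SL_slash_apply, ← jac_eq_denom, jac_S, hS, mul_comm, ← mul_assoc,
      ← zpow_add₀ τ.ne_zero]
    simp
  · ext τ
    rw [ModularForm.SL_slash_apply, ← jac_eq_denom, jac_T, hT]
    simp

/-- The modular form of level one determined by a function with the right behaviour under the
generators. -/
def levelOneForm (k : ℤ) (f : ℍ → ℂ) (hS : ∀ τ, f (S • τ) = (τ : ℂ) ^ k * f τ)
    (hT : ∀ τ, f (T • τ) = f τ) (hol : MDiff f) (bdd : IsBoundedAtImInfty f) :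
    ModularForm 𝒮ℒ k where
  toFun := f
  slash_action_eq' A hA := by
    obtain ⟨A, rfl⟩ := hA
    exact slash_eq_of_generators hS hT A
  holo' := hol
  bdd_at_cusps' hc := by
    rw [Subgroup.IsArithmetic.isCusp_iff_isCusp_SL2Z] at hc
    rw [OnePoint.isBoundedAt_iff_forall_SL2Z hc]
    intro γ _
    rw [slash_eq_of_generators hS hT γ]
    exact bdd

/-- The cusp form of level one determined by a function with the right behaviour under the
generators. -/
def levelOneCuspForm (k : ℤ) (f : ℍ → ℂ) (hS : ∀ τ, f (S • τ) = (τ : ℂ) ^ k * f τ)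
    (hT : ∀ τ, f (T • τ) = f τ) (hol : MDiff f) (h0 : IsZeroAtImInfty f) :
    CuspForm 𝒮ℒ k where
  toFun := f
  slash_action_eq' A hA := by
    obtain ⟨A, rfl⟩ := hA
    exact slash_eq_of_generators hS hT A
  holo' := hol
  zero_at_cusps' hc := by
    rw [Subgroup.IsArithmetic.isCusp_iff_isCusp_SL2Z] at hc
    rw [OnePoint.isZeroAt_iff_forall_SL2Z hc]
    intro γ _
    rw [slash_eq_of_generators hS hT γ]
    exact h0

section levelOne

variable {f : ℍ → ℂ}

theorem periodic_of_T_invariant (hT : ∀ τ, f (T • τ) = f τ) :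
    Function.Periodic (f ∘ ofComplex) (1 : ℝ) := by
  intro w
  by_cases! hw : 0 < w.im
  · have hw' : 0 < (w + (1 : ℝ)).im := by simpa using hw
    simp only [Function.comp_apply, ofComplex_apply_of_im_pos hw, ofComplex_apply_of_im_pos hw']
    rw [← hT ⟨w, hw⟩]
    congr 1
    ext
    rw [coe_T_smul]
    simp
  -- Outside the upper half-plane `ofComplex` takes a constant junk value, so periodicity is trivial
  -- there.
  · have hw' : (w + (1 : ℝ)).im ≤ 0 := by simpa using hw
    simp only [Function.comp_apply, ofComplex_apply_of_im_nonpos hw,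
      ofComplex_apply_of_im_nonpos hw']

theorem tendsto_qExpansion_coeff_zero (hT : ∀ τ, f (T • τ) = f τ) (hol : MDiff f)
    (bdd : IsBoundedAtImInfty f) : Tendsto f atImInfty (𝓝 ((qExpansion 1 f).coeff 0)) := by
  have hper := periodic_of_T_invariant hT
  have han := analyticAt_cuspFunction_zero one_pos hper hol bdd
  have h := han.continuousAt.tendsto.comp (qParam_tendsto_atImInfty one_pos)
  have h2 : (qExpansion 1 f).coeff 0 = cuspFunction 1 f 0 := by
    simp [qExpansion_coeff]
  rw [h2]
  exact h.congr fun τ => eq_cuspFunction τ one_ne_zero hper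

theorem apply_T_smul {k : ℤ} (F : ModularForm 𝒮ℒ k) (τ : ℍ) : F (T • τ) = F τ := by
  have h := F.slash_action_eq' T ⟨T, rfl⟩
  have h' : (⇑F ∣[k] T) = F := h
  have := congrFun h' τ
  rw [ModularForm.SL_slash_apply, ← jac_eq_denom, jac_T] at this
  simpa using this

theorem exists_qExpansion (hT : ∀ τ, f (T • τ) = f τ) (hol : MDiff f)
    (bdd : IsBoundedAtImInfty f) :
    ∃ a : ℕ → ℂ, (∀ τ : ℍ, HasSum (fun m => a m * cexp (2 * π * I * m * τ)) (f τ)) ∧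
      Tendsto f atImInfty (𝓝 (a 0)) := by
  have hper := periodic_of_T_invariant hT
  refine ⟨fun m => (qExpansion 1 f).coeff m, fun τ => ?_, ?_⟩
  · have := hasSum_qExpansion one_pos hper hol bdd τ
    convert! this using 2 with m
    rw [smul_eq_mul, Function.Periodic.qParam, ← Complex.exp_nat_mul]
    congr 2
    push_cast
    ring
  · exact tendsto_qExpansion_coeff_zero hT hol bdd

theorem levelOne_weight_zero (hS : ∀ τ, f (S • τ) = f τ) (hT : ∀ τ, f (T • τ) = f τ)
    (hol : MDiff f) (bdd : IsBoundedAtImInfty f) : ∃ c, ∀ τ, f τ = c := by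
  obtain ⟨c, hc⟩ := ModularFormClass.levelOne_weight_zero_const
    (levelOneForm 0 f (by simpa using hS) hT hol bdd)
  exact ⟨c, fun τ => congrFun hc τ⟩

theorem levelOne_weight_twelve (hS : ∀ τ, f (S • τ) = (τ : ℂ) ^ 12 * f τ)
    (hT : ∀ τ, f (T • τ) = f τ) (hol : MDiff f) (h0 : IsZeroAtImInfty f) :
    ∃ c, ∀ τ, f τ = c * ModularForm.eta τ ^ 24 := by
  obtain ⟨c, hc⟩ := CuspForm.exists_smul_discriminant_of_weight_eq_twelve
    (levelOneCuspForm 12 f (by exact_mod_cast hS) hT hol h0)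
  exact ⟨c, fun τ => (DFunLike.congr_fun hc τ).symm⟩

/-- In a one-dimensional space the form is a multiple of the Eisenstein series, and the limit at i∞
fixes the scalar. -/
theorem levelOne_of_rank_one {k : ℕ} (hk : 3 ≤ k) (hk2 : Even k)
    (hr : Module.rank ℂ (ModularForm 𝒮ℒ k) = 1)
    (hS : ∀ τ, f (S • τ) = (τ : ℂ) ^ k * f τ) (hT : ∀ τ, f (T • τ) = f τ) (hol : MDiff f)
    (h1 : Tendsto f atImInfty (𝓝 1)) (τ : ℍ) : f τ = ModularForm.E hk τ := by
  have bdd : IsBoundedAtImInfty f := h1.isBigO_one ℝ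
  obtain ⟨c, hc⟩ := (finrank_eq_one_iff_of_nonzero' _ (EisensteinSeries.E_ne_zero hk hk2)).mp
    (Module.rank_eq_one_iff_finrank_eq_one.mp hr)
    (levelOneForm k f (by exact_mod_cast hS) hT hol bdd)
  have hc' : ∀ τ, f τ = c * ModularForm.E hk τ := fun τ => (DFunLike.congr_fun hc τ).symm
  have hE : Tendsto (ModularForm.E hk) atImInfty (𝓝 1) := by
    rw [← EisensteinSeries.E_qExpansion_coeff_zero hk hk2]
    exact tendsto_qExpansion_coeff_zero (apply_T_smul _) (ModularFormClass.holo _)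
      (ModularFormClass.bdd_at_infty _)
  have : c = 1 := by
    refine tendsto_nhds_unique ?_ h1
    rw [funext hc']
    simpa using hE.const_mul c
  rw [hc', this, one_mul]

end levelOne

/-- A continuous function on `ℍ` with a constant power is constant. -/
theorem eq_of_pow_eq_const {g : ℍ → ℂ} (hg : Continuous g) {n : ℕ} (hn : 0 < n) {c : ℂ}
    (h : ∀ τ, g τ ^ n = c) (τ τ' : ℍ) : g τ = g τ' := by
  have hfin : {w : ℂ | w ^ n = c}.Finite := by
    have := (Polynomial.nthRoots n c).toFinset.finite_toSet
    refine this.subset fun w hw => ?_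
    simpa [Polynomial.mem_nthRoots hn] using hw
  exact isPreconnected_univ.constant_of_mapsTo hfin.isDiscrete hg.continuousOn (fun τ _ => h τ)
    (Set.mem_univ τ) (Set.mem_univ τ')

/-! ### Series in powers of `q` -/

theorem norm_cexp_two_pi_mul (e : ℝ) (τ : ℂ) :
    ‖cexp (2 * π * I * e * τ)‖ = Real.exp (-2 * π * e * τ.im) := by
  rw [Complex.norm_exp]
  congr 1
  have : (2 * π * I * e * τ : ℂ) = ((2 * π * e : ℝ) : ℂ) * (I * τ) := by push_cast; ring
  rw [this, Complex.re_ofReal_mul, Complex.I_mul_re]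
  ring

/-- Termwise limit at `i∞` of a series in nonnegative powers of `q`. -/
theorem tendsto_tsum_atImInfty {ι : Type*} (c : ι → ℂ) (e : ι → ℝ) (he : ∀ i, c i ≠ 0 → 0 ≤ e i)
    (hs : Summable fun i => ‖c i‖ * Real.exp (-2 * π * e i)) :
    Tendsto (fun τ : ℍ => ∑' i, c i * cexp (2 * π * I * e i * τ)) atImInfty
      (𝓝 (∑' i, if e i = 0 then c i else 0)) := by
  refine tendsto_tsum_of_dominated_convergence hs (fun i => ?_) ?_
  · by_cases hc : c i = 0
    · simp [hc]
    by_cases h0 : e i = 0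
    · simp [h0]
    have hpos : 0 < e i := lt_of_le_of_ne (he i hc) (Ne.symm h0)
    rw [if_neg h0, tendsto_zero_iff_norm_tendsto_zero]
    simp only [norm_mul (c i), norm_cexp_two_pi_mul]
    rw [show (0 : ℝ) = ‖c i‖ * 0 by ring]
    refine Tendsto.const_mul _ (Real.tendsto_exp_atBot.comp ?_)
    have : Tendsto (fun τ : ℍ => (τ : ℂ).im) atImInfty atTop := tendsto_comap
    exact this.const_mul_atTop_of_neg (by nlinarith [Real.pi_pos])
  · have : ∀ᶠ τ : ℍ in atImInfty, 1 ≤ τ.im := tendsto_comap.eventually_ge_atTop 1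
    filter_upwards [this] with τ hτ i
    by_cases hc : c i = 0
    · simp [hc]
    rw [norm_mul, norm_cexp_two_pi_mul]
    have h1 := he i hc
    have h2 : 0 ≤ 2 * π * e i := by positivity
    refine mul_le_mul_of_nonneg_left (Real.exp_le_exp.mpr ?_) (norm_nonneg _)
    change _ * τ.im ≤ _
    nlinarith

/-! ### The two-variable theta function -/

/-- The factor exp(πi n²) equals exp(πi n), since n² and n have the same parity. -/
theorem jacobiTheta₂_add_one_right (z τ : ℂ) :
    jacobiTheta₂ z (τ + 1) = jacobiTheta₂ (z + 1 / 2) τ := by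
  refine tsum_congr fun n => ?_
  simp only [jacobiTheta₂_term]
  obtain ⟨k, hk⟩ := Int.even_mul_pred_self n
  have hk' : (n : ℂ) ^ 2 = n + 2 * k := by
    have : n ^ 2 = n + 2 * k := by linarith [hk, sq n, mul_sub n n 1]
    exact_mod_cast this
  rw [Complex.exp_eq_exp_iff_exists_int]
  refine ⟨k, ?_⟩
  linear_combination (π * I) * hk'

theorem jacobiTheta₂_add_int_left (z τ : ℂ) (y : ℤ) :
    jacobiTheta₂ (z + y) τ = jacobiTheta₂ z τ := by
  refine tsum_congr fun n => ?_
  simp only [jacobiTheta₂_term]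
  rw [Complex.exp_eq_exp_iff_exists_int]
  exact ⟨n * y, by push_cast; ring⟩

theorem jacobiTheta₂_add_int_mul_left (z τ : ℂ) (x : ℤ) :
    jacobiTheta₂ (z + x * τ) τ =
      cexp (-(π * I * (x ^ 2 * τ + 2 * x * z))) * jacobiTheta₂ z τ := by
  conv_rhs => rw [jacobiTheta₂, ← tsum_mul_left, ← (Equiv.addRight x).tsum_eq]
  refine tsum_congr fun n => ?_
  simp_rw [jacobiTheta₂_term, ← Complex.exp_add, Equiv.coe_addRight, Int.cast_add]
  ring_nf

/-- The square root `(-iτ)^{1/2}` in the functional equation of the theta function. -/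
def rootS (τ : ℂ) : ℂ := (-I * τ) ^ (1 / 2 : ℂ)

theorem rootS_ne_zero {τ : ℂ} (hτ : τ ≠ 0) : rootS τ ≠ 0 := by
  simp [rootS, Complex.cpow_eq_zero_iff, hτ]

theorem rootS_pow_eight (τ : ℂ) : rootS τ ^ 8 = τ ^ 4 := by
  rw [rootS, ← Complex.cpow_nat_mul, show ((8 : ℕ) : ℂ) * (1 / 2) = (4 : ℕ) by norm_num,
    Complex.cpow_natCast, mul_pow]
  have : (-I) ^ 4 = 1 := by rw [neg_pow, I_pow_four]; norm_num
  rw [this, one_mul]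

theorem jacobiTheta₂_div_S (w : ℂ) {τ : ℂ} (hτ : τ ≠ 0) :
    jacobiTheta₂ (w / τ) (-1 / τ) = rootS τ * cexp (π * I * w ^ 2 / τ) * jacobiTheta₂ w τ := by
  have h := jacobiTheta₂_functional_equation w τ
  have hr := rootS_ne_zero hτ
  rw [h, ← rootS, show (-π * I * w ^ 2 / τ : ℂ) = -(π * I * w ^ 2 / τ) by ring, Complex.exp_neg]
  field_simp

/-- On the line z = aτ + b the n-th term is a root-of-unity-like phase times q^{na + n²/2}: `hb`
makes the phase unimodular, and `ha` excludes negative exponents, so only the terms with exponent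
zero survive. -/
theorem tendsto_jacobiTheta₂ {b : ℂ} {a : ℝ} (hb : b.im = 0)
    (ha : ∀ n : ℤ, 0 ≤ (n : ℝ) * a + (n : ℝ) ^ 2 / 2) :
    Tendsto (fun τ : ℍ => jacobiTheta₂ (a * τ + b) τ) atImInfty
      (𝓝 (∑' n : ℤ, if (n : ℝ) * a + (n : ℝ) ^ 2 / 2 = 0 then cexp (2 * π * I * n * b) else 0)) := by
  have h := tendsto_tsum_atImInfty (fun n : ℤ => cexp (2 * π * I * n * b))
    (fun n => (n : ℝ) * a + (n : ℝ) ^ 2 / 2) (fun n _ => ha n) ?_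
  · refine h.congr fun τ => tsum_congr fun n => ?_
    rw [← Complex.exp_add, jacobiTheta₂_term]
    congr 1
    push_cast
    ring
  · have := ((summable_jacobiTheta₂_term_iff (a * I + b) I).mpr (by simp)).norm
    refine this.congr fun n => ?_
    rw [norm_jacobiTheta₂_term, Complex.norm_exp, ← Real.exp_add]
    congr 1
    have : (2 * π * I * n * b : ℂ) = ((2 * π * n : ℝ) : ℂ) * (I * b) := by push_cast; ring
    rw [this, Complex.re_ofReal_mul, Complex.I_mul_re]
    simp [hb]
    ring

/-! ### The Jacobi theta series -/

theorem chi_four_odd (m : ℤ) : ((ZMod.χ₄ ((2 * m + 1 : ℤ) : ZMod 4) : ℤ) : ℂ) = cexp (π * I * m) := by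
  rcases Int.even_or_odd' m with ⟨k, rfl | rfl⟩
  · have : ((2 * (2 * k) + 1 : ℤ) : ZMod 4) = 1 := by
      push_cast; ring_nf
      rw [show (4 : ZMod 4) = 0 by decide]; ring
    rw [this, show (π * I * ((2 * k : ℤ) : ℂ) : ℂ) = k * (2 * π * I) by push_cast; ring,
      Complex.exp_int_mul_two_pi_mul_I]
    simp
  · have : ((2 * (2 * k + 1) + 1 : ℤ) : ZMod 4) = 3 := by
      push_cast; ring_nf
      rw [show (4 : ZMod 4) = 0 by decide]; ring
    rw [this, show (π * I * ((2 * k + 1 : ℤ) : ℂ) : ℂ) = k * (2 * π * I) + π * I by push_cast; ring,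
      Complex.exp_add, Complex.exp_int_mul_two_pi_mul_I, Complex.exp_pi_mul_I]
    have : ZMod.χ₄ 3 = -1 := by decide
    simp [this]

theorem chi_four_even (m : ℤ) : ZMod.χ₄ ((2 * m : ℤ) : ZMod 4) = 0 := by
  rw [ZMod.χ₄_int_eq_if_mod_four]
  simp

theorem hasSum_theta_odd (τ : ℍ) (z : ℂ) :
    HasSum (fun m : ℤ => cexp (π * I * m) *
      cexp (2 * π * I * ((2 * m + 1) ^ 2 / 8 * τ + (2 * m + 1) / 2 * z)))
      (cexp (π * I * (τ / 4 + z)) * jacobiTheta₂ (z + τ / 2 + 1 / 2) τ) := by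
  refine ((hasSum_jacobiTheta₂_term (z + τ / 2 + 1 / 2) τ.im_pos).mul_left
    (cexp (π * I * (τ / 4 + z)))).congr_fun fun m => ?_
  rw [jacobiTheta₂_term, ← Complex.exp_add, ← Complex.exp_add]
  congr 1
  ring

/-- The character kills even n; for n = 2m + 1 it equals exp(πi m), which accounts for the shift by
1/2, while completing the square accounts for the shift by τ/2. -/
theorem theta_eq (τ : ℍ) (z : ℂ) :
    theta τ z = cexp (π * I * (τ / 4 + z)) * jacobiTheta₂ (z + τ / 2 + 1 / 2) τ := by
  have hinj : Function.Injective (fun m : ℤ => 2 * m + 1) := fun a b h => by simpa using h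
  rw [theta, ← (hasSum_theta_odd τ z).tsum_eq, ← hinj.tsum_eq]
  · refine tsum_congr fun m => ?_
    rw [chi_four_odd]
    congr 2
    push_cast
    ring
  · intro n hn
    rcases Int.even_or_odd' n with ⟨k, rfl | rfl⟩
    · exact absurd (by dsimp only; rw [chi_four_even]; simp) hn
    · exact ⟨k, rfl⟩

theorem hasSum_theta (τ : ℍ) (z : ℂ) :
    HasSum (fun m : ℤ => cexp (π * I * m) *
      cexp (2 * π * I * ((2 * m + 1) ^ 2 / 8 * τ + (2 * m + 1) / 2 * z))) (theta τ z) := by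
  rw [theta_eq]; exact hasSum_theta_odd τ z

theorem theta_T_smul (τ : ℍ) (z : ℂ) : theta (T • τ) z = cexp (π * I / 4) * theta τ z := by
  rw [theta_eq, theta_eq, coe_T_smul, jacobiTheta₂_add_one_right,
    show z + ((τ : ℂ) + 1) / 2 + 1 / 2 + 1 / 2 = (z + τ / 2 + 1 / 2) + 1 by ring,
    jacobiTheta₂_add_left, ← mul_assoc, ← Complex.exp_add]
  congr 2
  ring

theorem theta_S_smul (τ : ℍ) (z : ℂ) :
    theta (S • τ) (z / τ) = -I * rootS τ * cexp (π * I * z ^ 2 / τ) * theta τ z := by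
  have h0 := τ.ne_zero
  rw [theta_eq, theta_eq, coe_S_smul]
  have h := jacobiTheta₂_div_S (z - 1 / 2 + τ / 2) h0
  rw [show (z / τ + -1 / τ / 2 + 1 / 2 : ℂ) = (z - 1 / 2 + τ / 2) / τ by field_simp; ring, h,
    ← jacobiTheta₂_add_left, show (z - 1 / 2 + τ / 2 + 1 : ℂ) = z + τ / 2 + 1 / 2 by ring]
  -- The factor -i is exp(-πi/2), from the cross term of -1/2 and τ/2 in the square.
  have e : cexp (π * I * (-1 / τ / 4 + z / τ)) * cexp (π * I * (z - 1 / 2 + τ / 2) ^ 2 / τ) =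
      -I * cexp (π * I * z ^ 2 / τ) * cexp (π * I * (τ / 4 + z)) := by
    have hI : cexp (-(π / 2 * I)) = -I := by
      rw [Complex.exp_neg, Complex.exp_pi_div_two_mul_I]; simp
    rw [← hI, ← Complex.exp_add, ← Complex.exp_add, ← Complex.exp_add]
    congr 1
    field_simp
    ring
  linear_combination (rootS τ * jacobiTheta₂ (z + τ / 2 + 1 / 2) τ) * e

theorem theta_add_lattice (τ : ℍ) (z : ℂ) (x y : ℤ) :
    theta τ (z + x * τ + y) =
      cexp (π * I * (x + y : ℤ)) * cexp (-(π * I * (x ^ 2 * τ + 2 * x * z))) * theta τ z := by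
  rw [theta_eq, theta_eq, show (z + x * τ + y + τ / 2 + 1 / 2 : ℂ) =
    (z + τ / 2 + 1 / 2 + x * τ) + y by ring, jacobiTheta₂_add_int_left,
    jacobiTheta₂_add_int_mul_left, ← mul_assoc, ← mul_assoc, ← Complex.exp_add, ← Complex.exp_add,
    ← Complex.exp_add]
  congr 1
  rw [Complex.exp_eq_exp_iff_exists_int]
  exact ⟨-x, by push_cast; ring⟩

/-- Evenness of `jacobiTheta₂` sends w = z + τ/2 + 1/2 to -w; returning to -z + τ/2 + 1/2 is a
translation by τ + 1, whose factor contains exp(πi) = -1. -/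
theorem theta_neg (τ : ℍ) (z : ℂ) : theta τ (-z) = -theta τ z := by
  have h := jacobiTheta₂_neg_left (z + τ / 2 + 1 / 2) τ
  rw [theta_eq, theta_eq, ← h]
  have h2 := jacobiTheta₂_add_int_mul_left (-(z + τ / 2 + 1 / 2)) τ 1
  have h3 := jacobiTheta₂_add_int_left (-(z + τ / 2 + 1 / 2) + (1 : ℤ) * τ) τ 1
  rw [h2] at h3
  rw [show (-z + τ / 2 + 1 / 2 : ℂ) = -(z + τ / 2 + 1 / 2) + (1 : ℤ) * τ + (1 : ℤ) by
    push_cast; ring, h3, ← mul_assoc, ← Complex.exp_add]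
  have e : cexp (π * I * (τ / 4 + -z) +
      -(π * I * (((1 : ℤ) : ℂ) ^ 2 * τ + 2 * ((1 : ℤ) : ℂ) * -(z + τ / 2 + 1 / 2)))) =
      -cexp (π * I * (τ / 4 + z)) := by
    rw [show (π * I * (τ / 4 + -z) +
      -(π * I * (((1 : ℤ) : ℂ) ^ 2 * τ + 2 * ((1 : ℤ) : ℂ) * -(z + τ / 2 + 1 / 2))) : ℂ) =
      π * I * (τ / 4 + z) + π * I by push_cast; ring, Complex.exp_add, Complex.exp_pi_mul_I]
    ring
  rw [e]
  ring

theorem theta_zero (τ : ℍ) : theta τ 0 = 0 := by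
  have := theta_neg τ 0
  rw [neg_zero] at this
  exact self_eq_neg.mp this

theorem theta_neg_half (τ : ℍ) : theta τ (-τ / 2) = cexp (-(π * I * τ / 4)) * jacobiTheta₂ (1 / 2) τ := by
  rw [theta_eq]
  congr 2 <;> ring

theorem differentiableOn_theta :
    DifferentiableOn ℂ (fun p : ℂ × ℂ => theta (ofComplex p.1) p.2) {p | 0 < p.1.im} := by
  intro p hp
  have hp' : 0 < p.1.im := hp
  have h1 : DifferentiableAt ℂ (fun p : ℂ × ℂ => cexp (π * I * (p.1 / 4 + p.2)) *
      jacobiTheta₂ (p.2 + p.1 / 2 + 1 / 2) p.1) p := by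
    refine DifferentiableAt.mul (by fun_prop) ?_
    exact (hasFDerivAt_jacobiTheta₂ (p.2 + p.1 / 2 + 1 / 2) hp').differentiableAt.comp
      (f := fun p : ℂ × ℂ => (p.2 + p.1 / 2 + 1 / 2, p.1)) p (by fun_prop)
  refine h1.differentiableWithinAt.congr (fun x hx => ?_) ?_
  · rw [theta_eq, ofComplex_apply_of_im_pos hx]
  · rw [theta_eq, ofComplex_apply_of_im_pos hp']

/-- Functions on `ℍ` that extend to holomorphic functions of `τ`. -/
theorem mdifferentiable_of_differentiableAt {f : ℍ → ℂ} (g : ℂ → ℂ) (h : ∀ τ : ℍ, f τ = g τ)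
    (hg : ∀ τ : ℂ, 0 < τ.im → DifferentiableAt ℂ g τ) : MDiff f := by
  rw [UpperHalfPlane.mdifferentiable_iff]
  intro τ hτ
  refine (hg τ hτ).differentiableWithinAt.congr (fun x hx => ?_) ?_
  · rw [Function.comp_apply, h, ofComplex_apply_of_im_pos hx]
  · rw [Function.comp_apply, h, ofComplex_apply_of_im_pos hτ]

theorem tendsto_cexp_atImInfty {a : ℝ} (ha : 0 < a) :
    Tendsto (fun τ : ℍ => cexp (2 * π * I * a * τ)) atImInfty (𝓝 0) := by
  rw [tendsto_zero_iff_norm_tendsto_zero]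
  simp only [norm_cexp_two_pi_mul]
  refine Real.tendsto_exp_atBot.comp ?_
  have : Tendsto (fun τ : ℍ => (τ : ℂ).im) atImInfty atTop := tendsto_comap
  exact this.const_mul_atTop_of_neg (by nlinarith [Real.pi_pos])

/-! ### The eta function -/

theorem eta_ne_zero (τ : ℍ) : ModularForm.eta τ ≠ 0 := ModularForm.eta_ne_zero τ.2

theorem eta_T_smul (τ : ℍ) :
    ModularForm.eta (T • τ : ℍ) = cexp (π * I / 12) * ModularForm.eta τ := by
  rw [coe_T_smul, ModularForm.eta, ModularForm.eta, ← mul_assoc]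
  have h1 : Function.Periodic.qParam 24 ((τ : ℂ) + 1) =
      cexp (π * I / 12) * Function.Periodic.qParam 24 τ := by
    rw [Function.Periodic.qParam, Function.Periodic.qParam, ← Complex.exp_add]
    congr 1
    push_cast
    ring
  have h2 : ∀ n, ModularForm.eta_q n ((τ : ℂ) + 1) = ModularForm.eta_q n τ := by
    intro n
    simp only [ModularForm.eta_q_eq_cexp]
    rw [Complex.exp_eq_exp_iff_exists_int]
    exact ⟨n + 1, by push_cast; ring⟩
  simp only [h1, h2]

theorem eta_pow_smul (A : SL(2, ℤ)) (τ : ℍ) :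
    ModularForm.eta (A • τ : ℍ) ^ 24 = jac A τ ^ 12 * ModularForm.eta τ ^ 24 := by
  have h := CuspForm.discriminant.slash_action_eq' A ⟨A, rfl⟩
  have h' : (ModularForm.discriminant ∣[(12 : ℤ)] A) = ModularForm.discriminant := h
  have h2 := congrFun h' τ
  rw [ModularForm.SL_slash_apply, ← jac_eq_denom] at h2
  have hj : jac A τ ^ 12 ≠ 0 := pow_ne_zero _ (jac_ne_zero A τ)
  rw [zpow_neg, mul_inv_eq_iff_eq_mul₀ (by exact_mod_cast hj)] at h2
  rw [mul_comm]
  exact_mod_cast h2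

theorem continuous_eta : Continuous fun τ : ℍ => ModularForm.eta τ := by
  refine continuous_iff_continuousAt.mpr fun τ => ?_
  exact (ModularForm.differentiableAt_eta_of_mem_upperHalfPlaneSet τ.2).continuousAt.comp
    UpperHalfPlane.continuous_coe.continuousAt

theorem mdifferentiable_eta : MDiff fun τ : ℍ => ModularForm.eta τ :=
  mdifferentiable_of_differentiableAt ModularForm.eta (fun _ => rfl)
    fun _ hτ => ModularForm.differentiableAt_eta_of_mem_upperHalfPlaneSet hτ

theorem continuous_jac (A : SL(2, ℤ)) : Continuous (jac A) := by
  unfold jac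
  fun_prop

theorem continuous_SL_smul (A : SL(2, ℤ)) : Continuous fun τ : ℍ => A • τ := by
  rw [UpperHalfPlane.isOpenEmbedding_coe.isEmbedding.continuous_iff]
  simp only [Function.comp_def, coe_SL_smul]
  exact Continuous.div (by fun_prop) (continuous_jac A) (jac_ne_zero A)

theorem jac_im (A : SL(2, ℤ)) (τ : ℍ) : (jac A τ).im = A 1 0 * τ.im := by
  simp [jac]

/-- Either c = 0 and cτ + d is constant, or its imaginary part never vanishes and the branch cut is
avoided. -/
theorem continuous_jac_sqrt (A : SL(2, ℤ)) : Continuous fun τ => jac A τ ^ (1 / 2 : ℂ) := by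
  by_cases hc : A 1 0 = 0
  · simp only [jac, hc, Int.cast_zero, zero_mul, zero_add]
    exact continuous_const
  · refine continuous_iff_continuousAt.mpr fun τ => ?_
    refine (continuous_jac A).continuousAt.cpow continuousAt_const (Or.inr ?_)
    rw [jac_im]
    exact mul_ne_zero (by exact_mod_cast hc) τ.im_pos.ne'

theorem jac_sqrt_ne_zero (A : SL(2, ℤ)) (τ : ℍ) : jac A τ ^ (1 / 2 : ℂ) ≠ 0 := by
  simp [Complex.cpow_eq_zero_iff, jac_ne_zero]

theorem jac_sqrt_sq (A : SL(2, ℤ)) (τ : ℍ) : (jac A τ ^ (1 / 2 : ℂ)) ^ 2 = jac A τ := by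
  rw [← Complex.cpow_nat_mul]
  norm_num

/-- By the weight 12 law of the discriminant, the quotient of the two sides without `vEta` has 24th
power 1. It is continuous on ℍ, hence constant, and its value at i is `vEta A` by definition. -/
theorem eta_smul (A : SL(2, ℤ)) (τ : ℍ) :
    ModularForm.eta (A • τ : ℍ) = vEta A * jac A τ ^ (1 / 2 : ℂ) * ModularForm.eta τ := by
  have hpow : ∀ τ : ℍ, (ModularForm.eta (A • τ : ℍ) /
      (jac A τ ^ (1 / 2 : ℂ) * ModularForm.eta τ)) ^ 24 = 1 := by
    intro τ
    rw [div_pow, mul_pow, eta_pow_smul, show (jac A τ ^ (1 / 2 : ℂ)) ^ 24 =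
      ((jac A τ ^ (1 / 2 : ℂ)) ^ 2) ^ 12 by rw [← pow_mul], jac_sqrt_sq]
    refine div_self (mul_ne_zero (pow_ne_zero _ (jac_ne_zero A τ)) (pow_ne_zero _ (eta_ne_zero τ)))
  have hcont : Continuous fun τ : ℍ => ModularForm.eta (A • τ : ℍ) /
      (jac A τ ^ (1 / 2 : ℂ) * ModularForm.eta τ) := by
    refine Continuous.div (continuous_eta.comp (continuous_SL_smul A))
      ((continuous_jac_sqrt A).mul continuous_eta)
      fun τ => mul_ne_zero (jac_sqrt_ne_zero A τ) (eta_ne_zero τ)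
  have h := eq_of_pow_eq_const hcont (by norm_num) hpow τ UpperHalfPlane.I
  have hv : vEta A = ModularForm.eta (A • UpperHalfPlane.I : ℍ) /
      (jac A UpperHalfPlane.I ^ (1 / 2 : ℂ) * ModularForm.eta UpperHalfPlane.I) := rfl
  rw [← hv, div_eq_iff (mul_ne_zero (jac_sqrt_ne_zero A τ) (eta_ne_zero τ))] at h
  rw [h]
  ring

theorem tendsto_eta_div : Tendsto (fun τ : ℍ => cexp (-(2 * π * I * τ / 24)) * ModularForm.eta τ)
    atImInfty (𝓝 1) := by
  have h0 : ContinuousAt (fun q : ℂ => ∏' n : ℕ, (1 - q ^ (n + 1))) 0 :=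
    (ModularForm.differentiableOn_tprod_one_sub_pow.differentiableAt
      (Metric.ball_mem_nhds 0 one_pos)).continuousAt
  have h1 := h0.tendsto.comp (qParam_tendsto_atImInfty one_pos)
  simp only [ne_eq, Nat.add_eq_zero_iff, one_ne_zero, and_false, not_false_eq_true, zero_pow,
    sub_zero, tprod_one] at h1
  refine h1.congr fun τ => ?_
  rw [ModularForm.eta, Function.Periodic.qParam, ← mul_assoc, ← Complex.exp_add]
  have : -(2 * π * I * τ / 24) + 2 * π * I * τ / ((24 : ℝ) : ℂ) = 0 := by push_cast; ring
  rw [this, Complex.exp_zero, one_mul]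
  rfl

/-! ### The derivative of the theta series at the origin -/

/-- `∂ϑ/∂z (τ, 0)`. -/
def thetaDeriv (τ : ℂ) : ℂ := cexp (π * I * (τ / 4)) * jacobiTheta₂' (τ / 2 + 1 / 2) τ

theorem hasDerivAt_theta_zero (τ : ℍ) : HasDerivAt (theta τ) (thetaDeriv τ) 0 := by
  have h1 : HasDerivAt (fun z : ℂ => cexp (π * I * (τ / 4 + z)))
      (cexp (π * I * (τ / 4 + 0)) * (π * I * 1)) 0 :=
    (((hasDerivAt_id (0 : ℂ)).const_add _).const_mul _).cexp
  have h2 : HasDerivAt (fun z : ℂ => jacobiTheta₂ (z + τ / 2 + 1 / 2) τ)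
      (jacobiTheta₂' (0 + τ / 2 + 1 / 2) τ * 1) 0 := by
    have hi : HasDerivAt (fun z : ℂ => z + τ / 2 + 1 / 2) 1 0 :=
      ((hasDerivAt_id (0 : ℂ)).add_const _).add_const _
    exact HasDerivAt.comp (h₂ := fun w => jacobiTheta₂ w τ) (0 : ℂ)
      (hasDerivAt_jacobiTheta₂_fst (0 + τ / 2 + 1 / 2) τ.im_pos) hi
  have h3 := h1.mul h2
  rw [funext (theta_eq τ)]
  refine h3.congr_deriv ?_
  have hz := theta_zero τ
  rw [theta_eq] at hz
  have hz' : jacobiTheta₂ (0 + τ / 2 + 1 / 2) τ = 0 := by simpa using hz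
  rw [hz', thetaDeriv]
  simp

theorem differentiableAt_thetaDeriv {τ : ℂ} (hτ : 0 < τ.im) : DifferentiableAt ℂ thetaDeriv τ := by
  refine DifferentiableAt.mul (by fun_prop) ?_
  obtain ⟨t, ht, htτ⟩ := exists_between hτ
  obtain ⟨s, hs⟩ := exists_gt |(τ / 2 + 1 / 2 : ℂ).im|
  -- On this neighbourhood the imaginary parts of both arguments are controlled, which yields one
  -- summable majorant and hence a holomorphic sum.
  let U : Set ℂ := {w | t < w.im} ∩ {w | |(w / 2 + 1 / 2 : ℂ).im| < s}
  have hU : IsOpen U := (isOpen_lt continuous_const Complex.continuous_im).inter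
    (isOpen_lt (by fun_prop) continuous_const)
  have hd : DifferentiableOn ℂ (fun w => ∑' n : ℤ, jacobiTheta₂'_term n (w / 2 + 1 / 2) w) U := by
    refine Complex.differentiableOn_tsum_of_summable_norm
      ((summable_pow_mul_jacobiTheta₂_term_bound s ht 1).mul_left (2 * π)) (fun n => ?_) hU
      (fun n w hw => ?_)
    · unfold jacobiTheta₂'_term jacobiTheta₂_term
      fun_prop
    · refine (norm_jacobiTheta₂'_term_le ht hw.2.le hw.1.le n).trans (le_of_eq ?_)
      push_cast
      ring
  exact hd.differentiableAt (hU.mem_nhds ⟨htτ, hs⟩)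

theorem thetaDeriv_T_smul (τ : ℍ) :
    thetaDeriv (T • τ : ℍ) = cexp (π * I / 4) * thetaDeriv τ := by
  have h := (hasDerivAt_theta_zero τ).const_mul (cexp (π * I / 4))
  rw [← funext (theta_T_smul τ)] at h
  exact (hasDerivAt_theta_zero (T • τ)).unique h

/-- Differentiating the S-law of `theta` at z = 0: as ϑ vanishes there, the exponential contributes
nothing, and the chain rule for z/τ produces the factor τ. -/
theorem thetaDeriv_S_smul (τ : ℍ) :
    thetaDeriv (S • τ : ℍ) = τ * (-I * rootS τ) * thetaDeriv τ := by
  have h1 : HasDerivAt (fun z : ℂ => -I * rootS τ * cexp (π * I * z ^ 2 / τ) * theta τ z)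
      (-I * rootS τ * thetaDeriv τ) 0 := by
    have he : HasDerivAt (fun z : ℂ => -I * rootS τ * cexp (π * I * z ^ 2 / τ)) 0 0 := by
      have : HasDerivAt (fun z : ℂ => π * I * z ^ 2 / τ) 0 0 := by
        simpa using ((hasDerivAt_pow 2 (0 : ℂ)).const_mul (π * I)).div_const (τ : ℂ)
      simpa using this.cexp.const_mul (-I * rootS τ)
    refine (he.mul (hasDerivAt_theta_zero τ)).congr_deriv ?_
    simp [theta_zero]
  have h2 : HasDerivAt (fun z : ℂ => theta (S • τ) (z / τ)) (thetaDeriv (S • τ : ℍ) * (1 / τ)) 0 := by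
    have h0 : HasDerivAt (theta (S • τ)) (thetaDeriv (S • τ : ℍ)) ((0 : ℂ) / τ) := by
      simpa using hasDerivAt_theta_zero (S • τ)
    exact h0.comp (0 : ℂ) ((hasDerivAt_id (0 : ℂ)).div_const (τ : ℂ))
  rw [funext (theta_S_smul τ)] at h2
  have := h2.unique h1
  have h0 := τ.ne_zero
  field_simp at this
  linear_combination this

theorem tendsto_thetaDeriv : Tendsto (fun τ : ℍ => cexp (-(π * I * τ / 4)) * thetaDeriv τ)
    atImInfty (𝓝 (2 * π * I)) := by
  have hsum := summable_jacobiTheta₂'_term_iff (I / 2 + 1 / 2) I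
  have h := tendsto_tsum_atImInfty (fun n : ℤ => 2 * π * I * n * cexp (π * I * n))
    (fun n => ((n : ℝ) ^ 2 + n) / 2) ?_ ?_
  · have hval : (∑' n : ℤ, if ((n : ℝ) ^ 2 + n) / 2 = 0 then 2 * π * I * n * cexp (π * I * n) else 0)
        = 2 * π * I := by
      -- The exponent (n² + n)/2 vanishes for n = 0 and n = -1 only, and the factor n removes the
      -- term n = 0.
      rw [tsum_eq_single (-1)]
      · simp [Complex.exp_neg, Complex.exp_pi_mul_I]
      · intro n hn
        split_ifs with h0
        · have h0' : (n : ℝ) * (n + 1) = 0 := by linarith [h0]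
          have h1 : n * (n + 1) = 0 := by exact_mod_cast h0'
          rcases mul_eq_zero.mp h1 with h1 | h1
          · simp [h1]
          · exact absurd (by linarith) hn
        · rfl
    rw [hval] at h
    refine h.congr fun τ => ?_
    rw [thetaDeriv, ← mul_assoc, ← Complex.exp_add,
      show -(π * I * τ / 4) + π * I * (τ / 4) = (0 : ℂ) by ring, Complex.exp_zero, one_mul]
    refine tsum_congr fun n => ?_
    rw [jacobiTheta₂'_term, jacobiTheta₂_term, mul_assoc, ← Complex.exp_add]
    congr 2
    push_cast
    ring
  · intro n _
    have : 0 ≤ n * (n + 1) := by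
      rcases le_or_gt 0 n with h | h
      · positivity
      · exact mul_nonneg_of_nonpos_of_nonpos h.le (by linarith)
    have : (0 : ℝ) ≤ n * (n + 1) := by exact_mod_cast this
    linarith
  · refine ((summable_jacobiTheta₂'_term_iff (I / 2 + 1 / 2) I).mpr (by simp)).norm.congr
      fun n => ?_
    rw [jacobiTheta₂'_term, norm_mul, norm_jacobiTheta₂_term, norm_mul (2 * π * I * n : ℂ),
      mul_assoc ‖_‖]
    congr 1
    rw [Complex.norm_exp, ← Real.exp_add]
    congr 1
    simp
    ring

/-- The eighth power of f is a cusp form of weight 12, so (f/η³)⁸ is constant; then f/η³ is constant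
by connectedness of ℍ, and the limit after removing q^{1/8} identifies the constant. Passing to
eighth powers makes knowledge of the roots of unity in the law of f unnecessary. -/
theorem exists_eq_mul_eta_pow {f : ℍ → ℂ} (hS : ∀ τ, f (S • τ) ^ 8 = (τ : ℂ) ^ 12 * f τ ^ 8)
    (hT : ∀ τ, f (T • τ) ^ 8 = f τ ^ 8) (hol : MDiff f) {c : ℂ}
    (hlim : Tendsto (fun τ : ℍ => cexp (-(π * I * τ / 4)) * f τ) atImInfty (𝓝 c)) (τ : ℍ) :
    f τ = c * ModularForm.eta τ ^ 3 := by
  have hf0 : IsZeroAtImInfty (fun τ => f τ ^ 8) := by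
    have h1 := (hlim.mul (tendsto_cexp_atImInfty (a := 1 / 8) (by norm_num))).pow 8
    rw [mul_zero, zero_pow (by norm_num)] at h1
    refine h1.congr fun τ => ?_
    rw [mul_right_comm, ← Complex.exp_add]
    have : -(π * I * τ / 4) + 2 * π * I * ((1 / 8 : ℝ) : ℂ) * τ = 0 := by push_cast; ring
    rw [this, Complex.exp_zero, one_mul]
  have hol8 : MDiff (fun τ => f τ ^ 8) := hol.pow 8
  obtain ⟨b, hb⟩ := levelOne_weight_twelve hS hT hol8 hf0
  have hpow : ∀ τ : ℍ, (f τ / ModularForm.eta τ ^ 3) ^ 8 = b := by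
    intro τ
    rw [div_pow, hb, ← pow_mul, mul_div_assoc, div_self (pow_ne_zero _ (eta_ne_zero τ)), mul_one]
  have hcont : Continuous fun τ : ℍ => f τ / ModularForm.eta τ ^ 3 :=
    hol.continuous.div (continuous_eta.pow 3) fun τ => pow_ne_zero _ (eta_ne_zero τ)
  have hconst := eq_of_pow_eq_const hcont (by norm_num) hpow
  have hl2 : Tendsto (fun τ : ℍ => f τ / ModularForm.eta τ ^ 3) atImInfty (𝓝 c) := by
    have h := hlim.div (tendsto_eta_div.pow 3) (by norm_num)
    rw [one_pow, div_one] at h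
    refine h.congr fun τ => ?_
    rw [Pi.div_apply, mul_pow, ← Complex.exp_nat_mul, show ((3 : ℕ) : ℂ) * -(2 * π * I * τ / 24) =
      -(π * I * τ / 4) by push_cast; ring, mul_div_mul_left _ _ (Complex.exp_ne_zero _)]
  have hc : f τ / ModularForm.eta τ ^ 3 = c :=
    tendsto_nhds_unique (tendsto_const_nhds.congr fun τ' => hconst τ τ') hl2
  rw [← hc, div_mul_cancel₀ _ (pow_ne_zero _ (eta_ne_zero τ))]

theorem cexp_pi_quarter_pow_eight : cexp (π * I / 4) ^ 8 = 1 := by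
  rw [← Complex.exp_nat_mul, show ((8 : ℕ) : ℂ) * (π * I / 4) = 2 * π * I by push_cast; ring,
    Complex.exp_two_pi_mul_I]

theorem thetaDeriv_eq (τ : ℍ) : thetaDeriv τ = 2 * π * I * ModularForm.eta τ ^ 3 := by
  refine exists_eq_mul_eta_pow (f := fun τ : ℍ => thetaDeriv τ) (fun τ => ?_) (fun τ => ?_)
    (mdifferentiable_of_differentiableAt thetaDeriv (fun _ => rfl)
      fun _ h => differentiableAt_thetaDeriv h) tendsto_thetaDeriv τ
  · rw [thetaDeriv_S_smul, mul_pow, mul_pow, mul_pow, rootS_pow_eight, neg_pow,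
      show I ^ 8 = 1 by rw [show 8 = 4 * 2 by norm_num, pow_mul, I_pow_four, one_pow]]
    ring
  · rw [thetaDeriv_T_smul, mul_pow, cexp_pi_quarter_pow_eight, one_mul]

theorem hasDerivAt_theta (τ : ℍ) :
    HasDerivAt (theta τ) (2 * π * I * ModularForm.eta τ ^ 3) 0 := by
  rw [← thetaDeriv_eq]; exact hasDerivAt_theta_zero τ

/-! ### The transformation law of the theta series -/

/-- Dividing by η³ removes every root and every root of unity: the quotient is invariant in the
integral weight -1 and index 1/2, where two generators suffice. Multiplying back by the law of η³
restores the multiplier. -/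
theorem theta_smul (A : SL(2, ℤ)) (τ : ℍ) (z : ℂ) :
    theta (A • τ) (z / jac A τ) = vEta A ^ 3 * jac A τ ^ (1 / 2 : ℂ) *
      cexp (π * I * (A 1 0 : ℂ) * z ^ 2 / jac A τ) * theta τ z := by
  have hπ : (2 * π * I : ℂ) ≠ 0 := by simp [Real.pi_ne_zero]
  have key : jslash (-1) (1 / 2) A (fun τ z => theta τ z / ModularForm.eta τ ^ 3) =
      fun τ z => theta τ z / ModularForm.eta τ ^ 3 := by
    refine jslash_eq_of_generators ?_ ?_ A
    · funext τ z
      have h0 := τ.ne_zero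
      have h1 := thetaDeriv_S_smul τ
      rw [thetaDeriv_eq, thetaDeriv_eq] at h1
      -- The S-law of η³ is read off from that of the derivative, so it carries the same factor `-I
      -- * rootS τ` as ϑ and the two cancel.
      have h2 : ModularForm.eta (S • τ : ℍ) ^ 3 = τ * (-I * rootS τ) * ModularForm.eta τ ^ 3 :=
        mul_left_cancel₀ hπ (by linear_combination h1)
      have h3 := eta_ne_zero τ
      have h4 := rootS_ne_zero h0
      have h5 : cexp (-(2 * π * I * (1 / 2) * ((S 1 0 : ℤ) : ℂ) * z ^ 2 / τ)) *
          cexp (π * I * z ^ 2 / τ) = 1 := by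
        rw [← Complex.exp_add, Complex.exp_eq_one_iff]
        exact ⟨0, by simp [S]; ring⟩
      simp only [jslash, jac_S]
      rw [theta_S_smul, h2, neg_neg, zpow_one]
      generalize cexp (-(2 * π * I * (1 / 2) * ((S 1 0 : ℤ) : ℂ) * z ^ 2 / τ)) = E1 at *
      generalize cexp (π * I * z ^ 2 / τ) = E2 at *
      field_simp
      linear_combination theta τ z * h5
    · funext τ z
      simp only [jslash, jac_T]
      rw [theta_T_smul, eta_T_smul, mul_pow, ← Complex.exp_nat_mul,
        show ((3 : ℕ) : ℂ) * (π * I / 12) = π * I / 4 by push_cast; ring]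
      simp [T]
      rw [mul_div_mul_left _ _ (Complex.exp_ne_zero _)]
  have h := congrFun (congrFun key τ) z
  simp only [jslash] at h
  rw [eta_smul A τ] at h
  have hs := jac_sqrt_sq A τ
  have hs0 := jac_sqrt_ne_zero A τ
  have he := eta_ne_zero τ
  have hv : vEta A ≠ 0 := by
    intro h0
    have := eta_smul A τ
    rw [h0] at this
    exact eta_ne_zero (A • τ) (by simpa using this)
  rw [neg_neg, zpow_one] at h
  have h5 : cexp (-(2 * π * I * (1 / 2) * (A 1 0 : ℂ) * z ^ 2 / jac A τ)) *
      cexp (π * I * (A 1 0 : ℂ) * z ^ 2 / jac A τ) = 1 := by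
    rw [← Complex.exp_add, Complex.exp_eq_one_iff]
    exact ⟨0, by simp; ring⟩
  have hj := jac_ne_zero A τ
  generalize cexp (-(2 * π * I * (1 / 2) * (A 1 0 : ℂ) * z ^ 2 / jac A τ)) = E1 at *
  generalize cexp (π * I * (A 1 0 : ℂ) * z ^ 2 / jac A τ) = E2 at *
  generalize jac A τ ^ (1 / 2 : ℂ) = r at *
  generalize theta (A • τ) (z / jac A τ) = X at *
  rw [← hs] at h
  field_simp at h
  linear_combination E2 * h - X * h5

/-! ### Limits at the cusp -/

theorem tsum_theta_const (b : ℂ) : (∑' n : ℤ, if (n : ℝ) * (0 : ℝ) + (n : ℝ) ^ 2 / 2 = 0 then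
    cexp (2 * π * I * n * b) else 0) = 1 := by
  rw [tsum_eq_single 0]
  · simp
  · intro n hn
    rw [if_neg]
    simpa using hn

theorem tendsto_jacobiTheta₂_const {b : ℂ} (hb : b.im = 0) :
    Tendsto (fun τ : ℍ => jacobiTheta₂ b τ) atImInfty (𝓝 1) := by
  have h := tendsto_jacobiTheta₂ (a := 0) hb fun n => by simpa using by positivity
  rw [tsum_theta_const] at h
  simpa using h

/-- The exponent (n² + n)/2 vanishes for n = 0 and n = -1, and each of these terms contributes 1. -/
theorem tendsto_jacobiTheta₂_half_period :
    Tendsto (fun τ : ℍ => jacobiTheta₂ (((1 / 2 : ℝ) : ℂ) * τ + 0) τ) atImInfty (𝓝 2) := by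
  have h2 := tendsto_jacobiTheta₂ (a := 1 / 2) (b := 0) (by simp) fun n => by
    have : 0 ≤ n * (n + 1) := by
      rcases le_or_gt 0 n with h | h
      · positivity
      · exact mul_nonneg_of_nonpos_of_nonpos h.le (by linarith)
    have : (0 : ℝ) ≤ n * (n + 1) := by exact_mod_cast this
    linarith
  have h2v : (∑' n : ℤ, if (n : ℝ) * (1 / 2) + (n : ℝ) ^ 2 / 2 = 0 then
      cexp (2 * π * I * n * 0) else 0) = 2 := by
    rw [tsum_eq_sum (s := {0, -1})]
    · rw [Finset.sum_pair (by norm_num)]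
      norm_num
    · intro n hn
      rw [if_neg]
      intro h0
      have h0' : (n : ℝ) * (n + 1) = 0 := by linarith [h0]
      have h1 : n * (n + 1) = 0 := by exact_mod_cast h0'
      simp only [Finset.mem_insert, Finset.mem_singleton, not_or] at hn
      rcases mul_eq_zero.mp h1 with h1 | h1
      · exact hn.1 h1
      · exact hn.2 (by linarith)
  rwa [h2v] at h2

/-! ### Non-vanishing of the theta constants -/

/-- The product `θ₂ θ₃ θ₄` of the theta constants. -/
def nullProd (τ : ℂ) : ℂ :=
  cexp (π * I * τ / 4) * jacobiTheta₂ (τ / 2) τ * jacobiTheta₂ 0 τ * jacobiTheta₂ (1 / 2) τ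

/-- S interchanges θ₂ and θ₄ and T interchanges θ₃ and θ₄, up to factors whose eighth powers are
known. So the product is a multiple of η³, and none of its factors can vanish on ℍ. -/
theorem nullProd_eq (τ : ℍ) : nullProd τ = 2 * ModularForm.eta τ ^ 3 := by
  refine exists_eq_mul_eta_pow (f := fun τ : ℍ => nullProd τ) (fun τ => ?_) (fun τ => ?_)
    (mdifferentiable_of_differentiableAt nullProd (fun _ => rfl) fun τ h => ?_) ?_ τ
  · have h0 := τ.ne_zero
    have h2 := jacobiTheta₂_div_S (-1 / 2) h0
    have h3 := jacobiTheta₂_div_S 0 h0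
    have h4 := jacobiTheta₂_div_S (τ / 2) h0
    have h2' : jacobiTheta₂ (-1 / 2) τ = jacobiTheta₂ (1 / 2) τ := by
      rw [← jacobiTheta₂_add_left]; norm_num
    simp only [nullProd, coe_S_smul]
    rw [show (-1 / τ / 2 : ℂ) = -1 / 2 / τ by ring, show (1 / 2 : ℂ) = τ / 2 / τ by field_simp,
      h2, h4, h2', ← show (1 / 2 : ℂ) = τ / 2 / τ by field_simp]
    rw [zero_div] at h3
    rw [h3]
    have e : cexp (π * I * (-1 / τ) / 4) * cexp (π * I * (-1 / 2) ^ 2 / τ) *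
        cexp (π * I * (τ / 2) ^ 2 / τ) * cexp (π * I * 0 ^ 2 / τ) = cexp (π * I * τ / 4) := by
      rw [← Complex.exp_add, ← Complex.exp_add, ← Complex.exp_add]
      congr 1
      field_simp
      ring
    rw [← e]
    have h8 : (rootS τ ^ 3) ^ 8 = (τ : ℂ) ^ 12 := by
      rw [pow_right_comm, rootS_pow_eight, ← pow_mul]
    rw [← h8, ← mul_pow]
    congr 1
    ring
  · simp only [nullProd, coe_T_smul, jacobiTheta₂_add_one_right]
    rw [show (((τ : ℂ) + 1) / 2 + 1 / 2 : ℂ) = τ / 2 + 1 by ring, jacobiTheta₂_add_left,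
      show (1 / 2 + 1 / 2 : ℂ) = 0 + 1 by ring, jacobiTheta₂_add_left,
      show (π * I * (τ + 1) / 4 : ℂ) = π * I / 4 + π * I * τ / 4 by ring, Complex.exp_add, zero_add]
    have := cexp_pi_quarter_pow_eight
    generalize cexp (π * I / 4) = x at *
    linear_combination (cexp (π * I * τ / 4) * jacobiTheta₂ (τ / 2) τ * jacobiTheta₂ 0 τ *
      jacobiTheta₂ (1 / 2) τ) ^ 8 * this
  · have hd (g : ℂ → ℂ) (hg : DifferentiableAt ℂ g τ) :
        DifferentiableAt ℂ (fun τ => jacobiTheta₂ (g τ) τ) τ :=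
      (hasFDerivAt_jacobiTheta₂ (g τ) h).differentiableAt.comp (f := fun τ => (g τ, τ)) τ
        (hg.prodMk differentiableAt_id)
    exact (((by fun_prop : DifferentiableAt ℂ (fun τ => cexp (π * I * τ / 4)) τ).mul
      (hd _ (by fun_prop))).mul (hd _ (by fun_prop))).mul (hd _ (by fun_prop))
  · have h := (tendsto_jacobiTheta₂_half_period.mul (tendsto_jacobiTheta₂_const (b := 0) (by simp))).mul
      (tendsto_jacobiTheta₂_const (b := 1 / 2) (by simp))
    rw [mul_one, mul_one] at h
    refine h.congr fun τ => ?_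
    rw [nullProd, ← mul_assoc, ← mul_assoc, ← mul_assoc, ← Complex.exp_add]
    have : -(π * I * τ / 4) + π * I * τ / 4 = (0 : ℂ) := by ring
    rw [this, Complex.exp_zero, one_mul]
    congr 3
    push_cast
    ring

theorem jacobiTheta₂_zero_ne_zero (τ : ℍ) : jacobiTheta₂ 0 τ ≠ 0 := by
  intro h
  have := nullProd_eq τ
  simp [nullProd, h, eta_ne_zero] at this

theorem jacobiTheta₂_half_period_ne_zero (τ : ℍ) : jacobiTheta₂ (τ / 2) τ ≠ 0 := by
  intro h
  have := nullProd_eq τ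
  simp [nullProd, h, eta_ne_zero] at this

/-! ### The theta functions of index one -/

/-- `∑ q^{l²} r^{2l}` over the integers. -/
def th0 (τ : ℍ) (z : ℂ) : ℂ := jacobiTheta₂ (2 * z) (2 * τ)

/-- `∑ q^{l²} r^{2l}` over the half-integers. -/
def th1 (τ : ℍ) (z : ℂ) : ℂ :=
  cexp (π * I * τ / 2 + 2 * π * I * z) * jacobiTheta₂ (2 * z + τ) (2 * τ)

theorem two_mul_im_pos (τ : ℍ) : 0 < (2 * τ : ℂ).im := by simpa using τ.im_pos

theorem hasSum_th0 (τ : ℍ) (z : ℂ) :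
    HasSum (fun l : ℤ => cexp (2 * π * I * (l ^ 2 * τ + 2 * l * z))) (th0 τ z) := by
  refine (hasSum_jacobiTheta₂_term (2 * z) (two_mul_im_pos τ)).congr_fun fun l => ?_
  rw [jacobiTheta₂_term]
  congr 1
  ring

theorem hasSum_th1 (τ : ℍ) (z : ℂ) :
    HasSum (fun l : ℤ => cexp (2 * π * I * ((l + 1 / 2) ^ 2 * τ + (2 * l + 1) * z))) (th1 τ z) := by
  refine ((hasSum_jacobiTheta₂_term (2 * z + τ) (two_mul_im_pos τ)).mul_left
    (cexp (π * I * τ / 2 + 2 * π * I * z))).congr_fun fun l => ?_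
  rw [jacobiTheta₂_term, ← Complex.exp_add]
  congr 1
  ring

theorem hasSum_int_even_odd {f : ℤ → ℂ} {a b : ℂ} (h0 : HasSum (fun l => f (2 * l)) a)
    (h1 : HasSum (fun l => f (2 * l + 1)) b) : HasSum f (a + b) := by
  have i0 : Function.Injective (fun l : ℤ => 2 * l) := fun x y h => by simpa using h
  have i1 : Function.Injective (fun l : ℤ => 2 * l + 1) := fun x y h => by simpa using h
  refine HasSum.add_isCompl (s := Set.range fun l : ℤ => 2 * l)
    (t := Set.range fun l : ℤ => 2 * l + 1) ?_ (i0.hasSum_range_iff.mpr h0)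
    (i1.hasSum_range_iff.mpr h1)
  have e0 : Set.range (fun l : ℤ => 2 * l) = {n | Even n} := by
    ext n
    simp [even_iff_exists_two_mul]
  have e1 : Set.range (fun l : ℤ => 2 * l + 1) = {n | Odd n} := by
    ext n
    simp [Odd]
  rw [e0, e1]
  exact Int.isCompl_even_odd

/-- Splitting the summation index by parity. Since S turns 2τ into -1/(τ/2), this is what expresses
the S-translate of `th0` through `th0` and `th1`. -/
theorem jacobiTheta₂_half (τ : ℍ) (z : ℂ) :
    jacobiTheta₂ z (τ / 2) = th0 τ z + th1 τ z := by
  have him : 0 < (τ / 2 : ℂ).im := by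
    have := τ.im_pos
    simpa using this
  refine (hasSum_jacobiTheta₂_term z him).unique ?_
  have h0 := hasSum_th0 τ z
  have h1 := hasSum_th1 τ z
  refine hasSum_int_even_odd (h0.congr_fun fun l => ?_) (h1.congr_fun fun l => ?_)
  · rw [jacobiTheta₂_term]
    congr 1
    push_cast
    ring
  · rw [jacobiTheta₂_term]
    congr 1
    push_cast
    ring

theorem th0_add_lattice (τ : ℍ) (z : ℂ) (x y : ℤ) :
    th0 τ (z + x * τ + y) = cexp (-(2 * π * I * (x ^ 2 * τ + 2 * x * z))) * th0 τ z := by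
  have h1 := jacobiTheta₂_add_int_left (2 * z + x * (2 * τ)) (2 * τ) (2 * y)
  rw [th0, show 2 * (z + x * τ + y) = 2 * z + x * (2 * τ) + ((2 * y : ℤ) : ℂ) by push_cast; ring,
    h1, jacobiTheta₂_add_int_mul_left, th0]
  congr 2
  ring

theorem th1_add_lattice (τ : ℍ) (z : ℂ) (x y : ℤ) :
    th1 τ (z + x * τ + y) = cexp (-(2 * π * I * (x ^ 2 * τ + 2 * x * z))) * th1 τ z := by
  have h1 := jacobiTheta₂_add_int_left (2 * z + τ + x * (2 * τ)) (2 * τ) (2 * y)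
  rw [th1, show 2 * (z + x * τ + y) + τ = 2 * z + τ + x * (2 * τ) + ((2 * y : ℤ) : ℂ) by
    push_cast; ring, h1, jacobiTheta₂_add_int_mul_left, th1]
  have e : cexp (π * I * τ / 2 + 2 * π * I * (z + x * τ + y)) *
      cexp (-(π * I * (x ^ 2 * (2 * τ) + 2 * x * (2 * z + τ)))) =
      cexp (-(2 * π * I * (x ^ 2 * τ + 2 * x * z))) * cexp (π * I * τ / 2 + 2 * π * I * z) := by
    rw [← Complex.exp_add, ← Complex.exp_add, Complex.exp_eq_exp_iff_exists_int]
    exact ⟨y, by ring⟩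
  linear_combination jacobiTheta₂ (2 * z + τ) (2 * τ) * e

theorem th0_add_half (τ : ℍ) (z : ℂ) : th0 τ (z + 1 / 2) = th0 τ z := by
  rw [th0, show 2 * (z + 1 / 2) = 2 * z + 1 by ring, jacobiTheta₂_add_left, th0]

theorem th1_add_half (τ : ℍ) (z : ℂ) : th1 τ (z + 1 / 2) = -th1 τ z := by
  rw [th1, show 2 * (z + 1 / 2) + (τ : ℂ) = 2 * z + τ + 1 by ring, jacobiTheta₂_add_left, th1,
    show (π * I * τ / 2 + 2 * π * I * (z + 1 / 2) : ℂ) = π * I * τ / 2 + 2 * π * I * z + π * I by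
    ring, Complex.exp_add, Complex.exp_pi_mul_I]
  ring

/-- Translation by τ/2 shifts the summation index by 1/2 and so interchanges integers and
half-integers. -/
theorem th0_half_period (τ : ℍ) : cexp (π * I * τ / 2) * th0 τ (τ / 2) = th1 τ 0 := by
  rw [th0, th1]
  ring_nf

theorem th1_half_period (τ : ℍ) : cexp (π * I * τ / 2) * th1 τ (τ / 2) = th0 τ 0 := by
  have h := jacobiTheta₂_add_int_mul_left 0 (2 * τ) 1
  rw [th0, th1, ← mul_assoc, ← Complex.exp_add,
    show (2 * (τ / 2 : ℂ) + τ) = 0 + (1 : ℤ) * (2 * τ) by push_cast; ring, h, ← mul_assoc,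
    ← Complex.exp_add]
  simp only [mul_zero]
  convert one_mul (jacobiTheta₂ 0 (2 * τ))
  rw [Complex.exp_eq_one_iff]
  exact ⟨0, by push_cast; ring⟩

theorem th0_zero_ne_zero (τ : ℍ) : th0 τ 0 ≠ 0 := by
  have := jacobiTheta₂_zero_ne_zero ⟨2 * τ, two_mul_im_pos τ⟩
  simpa [th0] using this

theorem th1_zero_ne_zero (τ : ℍ) : th1 τ 0 ≠ 0 := by
  have := jacobiTheta₂_half_period_ne_zero ⟨2 * τ, two_mul_im_pos τ⟩
  simp only [show (2 * (τ : ℂ)) / 2 = τ by ring] at this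
  simpa [th1] using this

theorem th0_S_smul (τ : ℍ) (z : ℂ) : th0 (S • τ) (z / τ) =
    rootS (τ / 2) * cexp (2 * π * I * z ^ 2 / τ) * (th0 τ z + th1 τ z) := by
  have h0 := τ.ne_zero
  have h := jacobiTheta₂_div_S z (τ := τ / 2) (by simpa using h0)
  rw [← jacobiTheta₂_half, th0, coe_S_smul, show 2 * (z / τ) = z / (τ / 2) by field_simp,
    show 2 * (-1 / (τ : ℂ)) = -1 / (τ / 2) by field_simp, h]
  congr 3
  field_simp

theorem th1_S_smul (τ : ℍ) (z : ℂ) : th1 (S • τ) (z / τ) =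
    rootS (τ / 2) * cexp (2 * π * I * z ^ 2 / τ) * (th0 τ z - th1 τ z) := by
  have h0 := τ.ne_zero
  have h := jacobiTheta₂_div_S (z - 1 / 2) (τ := τ / 2) (by simpa using h0)
  have e0 := th0_add_half τ (z - 1 / 2)
  have e1 := th1_add_half τ (z - 1 / 2)
  rw [sub_add_cancel] at e0 e1
  rw [e0, e1, sub_neg_eq_add, ← jacobiTheta₂_half, th1, coe_S_smul,
    show 2 * (z / τ) + -1 / (τ : ℂ) = (z - 1 / 2) / (τ / 2) by field_simp; ring,
    show 2 * (-1 / (τ : ℂ)) = -1 / (τ / 2) by field_simp, h]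
  have e : cexp (π * I * (-1 / τ) / 2 + 2 * π * I * (z / τ)) *
      cexp (π * I * (z - 1 / 2) ^ 2 / (τ / 2)) = cexp (2 * π * I * z ^ 2 / τ) := by
    rw [← Complex.exp_add]
    congr 1
    field_simp
    ring
  rw [← e]
  ring

theorem th0_eq_of_add_int {τ τ' : ℍ} {n : ℤ} (h : (τ' : ℂ) = τ + n) (z : ℂ) :
    th0 τ' z = th0 τ z := by
  refine (hasSum_th0 τ' z).unique ((hasSum_th0 τ z).congr_fun fun l => ?_)
  rw [h, Complex.exp_eq_exp_iff_exists_int]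
  exact ⟨l ^ 2 * n, by push_cast; ring⟩

theorem th0_T_smul (τ : ℍ) (z : ℂ) : th0 (T • τ) z = th0 τ z :=
  th0_eq_of_add_int (n := 1) (by simpa using coe_T_smul τ) z

theorem th1_T_smul (τ : ℍ) (z : ℂ) : th1 (T • τ) z = cexp (π * I / 2) * th1 τ z := by
  refine (hasSum_th1 (T • τ) z).unique (((hasSum_th1 τ z).mul_left _).congr_fun fun l => ?_)
  rw [coe_T_smul, ← Complex.exp_add, Complex.exp_eq_exp_iff_exists_int]
  exact ⟨l ^ 2 + l, by push_cast; ring⟩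

/-- The space of theta functions of index one. -/
def InThetaSpan (τ : ℍ) (f : ℂ → ℂ) : Prop := ∃ a b : ℂ, ∀ z, f z = a * th0 τ z + b * th1 τ z

/-- S and T act on `th0` and `th1` by 2 × 2 matrices depending on τ only (the Weil representation),
and the slash operator is multiplicative. -/
theorem inThetaSpan_jslash (k : ℤ) (A : SL(2, ℤ)) {φ : ℍ → ℂ → ℂ}
    (h : ∀ τ, InThetaSpan τ (φ τ)) (τ : ℍ) : InThetaSpan τ (jslash k 1 A φ τ) := by
  induction A using SL2Z_induction generalizing φ τ with
  | hS =>
    obtain ⟨a, b, hab⟩ := h (S • τ)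
    refine ⟨(τ : ℂ) ^ (-k) * rootS (τ / 2) * (a + b), (τ : ℂ) ^ (-k) * rootS (τ / 2) * (a - b),
      fun z => ?_⟩
    have h5 : cexp (-(2 * π * I * 1 * ((S 1 0 : ℤ) : ℂ) * z ^ 2 / τ)) *
        cexp (2 * π * I * z ^ 2 / τ) = 1 := by
      rw [← Complex.exp_add, Complex.exp_eq_one_iff]
      exact ⟨0, by simp [S]⟩
    rw [jslash, jac_S, hab, th0_S_smul, th1_S_smul]
    linear_combination ((τ : ℂ) ^ (-k) * rootS (τ / 2) *
      (a * (th0 τ z + th1 τ z) + b * (th0 τ z - th1 τ z))) * h5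
  | hT =>
    obtain ⟨a, b, hab⟩ := h (T • τ)
    refine ⟨a, b * cexp (π * I / 2), fun z => ?_⟩
    rw [jslash, jac_T, hab, div_one, th0_T_smul, th1_T_smul]
    simp [T]
    ring
  | hmul A B hA hB =>
    rw [jslash_mul]
    exact hB (fun τ => hA h τ) τ

/-- A theta function of index one is determined by its values at `0` and `1/2`. -/
theorem InThetaSpan.eq {τ : ℍ} {f : ℂ → ℂ} (h : InThetaSpan τ f) (z : ℂ) :
    f z = f 0 * ((th0 τ z / th0 τ 0 + th1 τ z / th1 τ 0) / 2) +
      f (1 / 2) * ((th0 τ z / th0 τ 0 - th1 τ z / th1 τ 0) / 2) := by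
  obtain ⟨a, b, hab⟩ := h
  have e0 := th0_add_half τ 0
  have e1 := th1_add_half τ 0
  rw [zero_add] at e0 e1
  rw [hab z, hab 0, hab (1 / 2), e0, e1]
  have h0 := th0_zero_ne_zero τ
  have h1 := th1_zero_ne_zero τ
  field_simp
  ring

theorem differentiableOn_th0 :
    DifferentiableOn ℂ (fun p : ℂ × ℂ => th0 (ofComplex p.1) p.2) {p | 0 < p.1.im} := by
  intro p hp
  have hp' : 0 < (2 * p.1).im := by simpa using hp
  have h1 : DifferentiableAt ℂ (fun p : ℂ × ℂ => jacobiTheta₂ (2 * p.2) (2 * p.1)) p :=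
    (hasFDerivAt_jacobiTheta₂ (2 * p.2) hp').differentiableAt.comp
      (f := fun p : ℂ × ℂ => (2 * p.2, 2 * p.1)) p (by fun_prop)
  refine h1.differentiableWithinAt.congr (fun x hx => ?_) ?_
  · rw [th0, ofComplex_apply_of_im_pos hx]
  · rw [th0, ofComplex_apply_of_im_pos hp]

theorem differentiableOn_th1 :
    DifferentiableOn ℂ (fun p : ℂ × ℂ => th1 (ofComplex p.1) p.2) {p | 0 < p.1.im} := by
  intro p hp
  have hp' : 0 < (2 * p.1).im := by simpa using hp
  have h1 : DifferentiableAt ℂ (fun p : ℂ × ℂ => cexp (π * I * p.1 / 2 + 2 * π * I * p.2) *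
      jacobiTheta₂ (2 * p.2 + p.1) (2 * p.1)) p := by
    refine DifferentiableAt.mul (by fun_prop) ?_
    exact (hasFDerivAt_jacobiTheta₂ (2 * p.2 + p.1) hp').differentiableAt.comp
      (f := fun p : ℂ × ℂ => (2 * p.2 + p.1, 2 * p.1)) p (by fun_prop)
  refine h1.differentiableWithinAt.congr (fun x hx => ?_) ?_
  · rw [th1, ofComplex_apply_of_im_pos hx]
  · rw [th1, ofComplex_apply_of_im_pos hp]

theorem mdifferentiable_of_joint {φ : ℍ → ℂ → ℂ}
    (h : DifferentiableOn ℂ (fun p : ℂ × ℂ => φ (ofComplex p.1) p.2) {p | 0 < p.1.im}) (z : ℂ) :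
    MDiff fun τ => φ τ z := by
  rw [UpperHalfPlane.mdifferentiable_iff]
  exact h.comp (f := fun τ : ℂ => (τ, z)) (by fun_prop) fun τ hτ => hτ

theorem tendsto_two_mul : Tendsto (fun τ : ℍ => (⟨2 * τ, two_mul_im_pos τ⟩ : ℍ)) atImInfty
    atImInfty := by
  refine tendsto_comap_iff.mpr ?_
  have h : Tendsto (fun τ : ℍ => τ.im) atImInfty atTop := tendsto_comap
  refine (h.const_mul_atTop two_pos).congr fun τ => ?_
  change 2 * τ.im = (2 * τ : ℂ).im
  simp

theorem tendsto_th0 : Tendsto (fun τ => th0 τ 0) atImInfty (𝓝 1) := by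
  refine ((tendsto_jacobiTheta₂_const (b := 0) (by simp)).comp tendsto_two_mul).congr fun τ => ?_
  simp [th0]

theorem tendsto_th1 : Tendsto (fun τ : ℍ => cexp (-(π * I * τ / 2)) * th1 τ 0) atImInfty (𝓝 2) := by
  refine (tendsto_jacobiTheta₂_half_period.comp tendsto_two_mul).congr fun τ => ?_
  rw [th1, ← mul_assoc, ← Complex.exp_add]
  simp only [Function.comp_apply]
  rw [show -(π * I * τ / 2) + (π * I * τ / 2 + 2 * π * I * 0) = (0 : ℂ) by ring, Complex.exp_zero,
    one_mul]
  congr 1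
  push_cast
  ring

/-! ### Convergence of the Jacobi–Eisenstein series -/

/-- Coprime pairs of integers. -/
abbrev CoprimePair := {p : ℤ × ℤ // Int.gcd p.1 p.2 = 1}

/-- A matrix of determinant one with a given bottom row. -/
def bezoutMat (p : CoprimePair) : SL(2, ℤ) :=
  ⟨!![Int.gcdB p.1.1 p.1.2, -Int.gcdA p.1.1 p.1.2; p.1.1, p.1.2], by
    have h := Int.gcd_eq_gcd_ab p.1.1 p.1.2
    rw [p.2] at h
    rw [Matrix.det_fin_two_of]
    push_cast at h
    linarith⟩

@[simp] theorem bezoutMat_one_zero (p : CoprimePair) : bezoutMat p 1 0 = p.1.1 := rfl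
@[simp] theorem bezoutMat_one_one (p : CoprimePair) : bezoutMat p 1 1 = p.1.2 := rfl

/-- The summands of the Jacobi–Eisenstein series. -/
def eisTerm (k : ℕ) (z : ℂ) (i : CoprimePair × ℤ) (τ : ℂ) : ℂ :=
  (((i.1.1.1 : ℂ) * τ + (i.1.1.2 : ℂ)) ^ k)⁻¹ * cexp (2 * π * I *
    ((i.2 : ℂ) ^ 2 * (((Int.gcdB i.1.1.1 i.1.1.2 : ℂ) * τ + ((-Int.gcdA i.1.1.1 i.1.1.2 : ℤ) : ℂ)) /
        ((i.1.1.1 : ℂ) * τ + (i.1.1.2 : ℂ)))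
      + 2 * (i.2 : ℂ) * z / ((i.1.1.1 : ℂ) * τ + (i.1.1.2 : ℂ))
      - (i.1.1.1 : ℂ) * z ^ 2 / ((i.1.1.1 : ℂ) * τ + (i.1.1.2 : ℂ))))

theorem jacobiEisenstein_eq (k : ℕ) (τ : ℍ) (z : ℂ) :
    jacobiEisenstein k τ z = 1 / 2 * ∑' i, eisTerm k z i τ := rfl

theorem eisTerm_eq (k : ℕ) (z : ℂ) (p : CoprimePair) (l : ℤ) (τ : ℍ) :
    eisTerm k z (p, l) τ = (jac (bezoutMat p) τ ^ k)⁻¹ * cexp (2 * π * I *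
      ((l : ℂ) ^ 2 * ((bezoutMat p • τ : ℍ) : ℂ) + 2 * l * z / jac (bezoutMat p) τ
        - (p.1.1 : ℂ) * z ^ 2 / jac (bezoutMat p) τ)) := by
  rw [coe_SL_smul]
  rfl

/-- Since Im(Aτ) = Im τ/|cτ + d|², the quadratic term in l gives Gaussian decay in |l|/|cτ + d|.
Half of this decay absorbs the term linear in l, and the term with c is bounded through |c| Im τ ≤
|cτ + d|. -/
theorem norm_eisTerm_le (k : ℕ) (z : ℂ) (p : CoprimePair) (l : ℤ) (τ : ℍ) :
    ‖eisTerm k z (p, l) τ‖ ≤ (‖jac (bezoutMat p) τ‖ ^ k)⁻¹ * (Real.exp (6 * π * ‖z‖ ^ 2 / τ.im) *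
      Real.exp (-(π * τ.im) * |(l : ℝ)| ^ 2 / ‖jac (bezoutMat p) τ‖ ^ 2)) := by
  rw [eisTerm_eq, norm_mul, norm_inv, norm_pow]
  refine mul_le_mul_of_nonneg_left ?_ (by positivity)
  rw [Complex.norm_exp, ← Real.exp_add, Real.exp_le_exp]
  have hj0 : 0 < ‖jac (bezoutMat p) τ‖ := norm_pos_iff.mpr (jac_ne_zero _ _)
  have hy := τ.im_pos
  have him : (bezoutMat p • τ : ℍ).im = τ.im / ‖jac (bezoutMat p) τ‖ ^ 2 := by
    rw [ModularGroup.im_smul_eq_div_normSq, ← jac_eq_denom, Complex.normSq_eq_norm_sq]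
  have hc : |(p.1.1 : ℝ)| * τ.im ≤ ‖jac (bezoutMat p) τ‖ := by
    have h := Complex.abs_im_le_norm (jac (bezoutMat p) τ)
    rw [jac_im, abs_mul, abs_of_pos hy] at h
    exact h
  generalize jac (bezoutMat p) τ = j at *
  have h1 : |(2 * (l : ℂ) * z / j).im| ≤ 2 * |(l : ℝ)| * ‖z‖ / ‖j‖ := by
    refine (Complex.abs_im_le_norm _).trans (le_of_eq ?_)
    rw [norm_div, norm_mul, norm_mul, Complex.norm_intCast]
    simp
  have h2 : |((p.1.1 : ℂ) * z ^ 2 / j).im| ≤ ‖z‖ ^ 2 / τ.im := by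
    refine (Complex.abs_im_le_norm _).trans ?_
    rw [norm_div, norm_mul, norm_pow, Complex.norm_intCast, div_le_div_iff₀ hj0 hy]
    nlinarith [sq_nonneg ‖z‖]
  have hre : (2 * π * I * ((l : ℂ) ^ 2 * ((bezoutMat p • τ : ℍ) : ℂ) + 2 * l * z / j
        - (p.1.1 : ℂ) * z ^ 2 / j)).re = -(2 * π) * ((l : ℝ) ^ 2 * (τ.im / ‖j‖ ^ 2) +
          (2 * (l : ℂ) * z / j).im - ((p.1.1 : ℂ) * z ^ 2 / j).im) := by
    rw [show ∀ w : ℂ, 2 * π * I * w = ((2 * π : ℝ) : ℂ) * (I * w) by intro w; push_cast; ring,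
      Complex.re_ofReal_mul, Complex.I_mul_re, Complex.sub_im, Complex.add_im,
      show ((l : ℂ) ^ 2) = (((l : ℝ) ^ 2 : ℝ) : ℂ) by push_cast; rfl, Complex.im_ofReal_mul]
    change 2 * π * (-(l ^ 2 * (bezoutMat p • τ : ℍ).im + _ - _)) = _
    rw [him]
    ring
  rw [hre]
  have h1' := (abs_le.mp h1).1
  have h2' := (abs_le.mp h2).2
  set X := |(l : ℝ)| / ‖j‖ with hX
  set Z := ‖z‖
  set y := τ.im
  have hl : (l : ℝ) ^ 2 * (y / ‖j‖ ^ 2) = y * X ^ 2 := by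
    rw [hX, div_pow, sq_abs]; ring
  have hr : -(π * y) * |(l : ℝ)| ^ 2 / ‖j‖ ^ 2 = -(π * (y * X ^ 2)) := by
    rw [hX, div_pow]; ring
  have h1'' : -(2 * (X * Z)) ≤ (2 * (l : ℂ) * z / j).im := by
    refine le_trans (le_of_eq ?_) h1'
    rw [hX]; ring
  -- Completing a square; the 4 here and the 2 from the term with c add up to the constant 6.
  have hW : 4 * (X * Z) ≤ y * X ^ 2 + 4 * (Z ^ 2 / y) := by
    have : 0 ≤ (y * X - 2 * Z) ^ 2 / y := by positivity
    have e : (y * X - 2 * Z) ^ 2 / y = y * X ^ 2 - 4 * (X * Z) + 4 * (Z ^ 2 / y) := by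
      field_simp
      ring
    linarith
  rw [hl, hr, show 6 * π * Z ^ 2 / y = 6 * π * (Z ^ 2 / y) by ring]
  have hfin : -2 * (y * X ^ 2) + 4 * (X * Z) + 2 * (Z ^ 2 / y) ≤ 6 * (Z ^ 2 / y) - y * X ^ 2 := by
    linarith
  have := mul_le_mul_of_nonneg_left hfin Real.pi_pos.le
  have h3 := mul_le_mul_of_nonneg_left h1'' Real.pi_pos.le
  have h4 := mul_le_mul_of_nonneg_left h2' Real.pi_pos.le
  nlinarith

/-- The Gaussian in m/J is traded for a power: with w = (1 + m)/J one has w^{3/2} ≤ 1 + w², and w²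
times the Gaussian is bounded. The exponent 3/2 exceeds 1, so the sum over l converges; the cost
J^{3/2} leaves the exponent k - 3/2 > 2 for the sum over (c, d) when k ≥ 4. -/
theorem exp_neg_sq_div_le {b r J m : ℝ} (hb : 0 < b) (hr : 0 < r) (hJ : r ≤ J) (hm : 0 ≤ m) :
    Real.exp (-b * m ^ 2 / J ^ 2) ≤
      (1 + 2 / r ^ 2 + 2 / b) * (J ^ (3 / 2 : ℝ) * (1 + m) ^ (-(3 / 2) : ℝ)) := by
  have hJ0 : 0 < J := hr.trans_le hJ
  have hm1 : 0 < 1 + m := by positivity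
  set w := (1 + m) / J with hw
  have hw0 : 0 < w := by positivity
  have h1 : w ^ (3 / 2 : ℝ) ≤ 1 + w ^ 2 := by
    rcases le_total w 1 with h | h
    · have := Real.rpow_le_one hw0.le h (by norm_num : (0 : ℝ) ≤ 3 / 2)
      nlinarith [sq_nonneg w]
    · have := Real.rpow_le_rpow_of_exponent_le h (by norm_num : (3 / 2 : ℝ) ≤ (2 : ℕ))
      rw [Real.rpow_natCast] at this
      linarith
  have h2 : w ^ 2 ≤ 2 / r ^ 2 + 2 * (m / J) ^ 2 := by
    have e : w = 1 / J + m / J := by rw [hw]; ring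
    have : (1 / J) ^ 2 ≤ 1 / r ^ 2 := by
      rw [div_pow, one_pow]
      gcongr
    rw [e]
    have e2 : 2 / r ^ 2 = 2 * (1 / r ^ 2) := by ring
    nlinarith [sq_nonneg (1 / J - m / J)]
  set E := Real.exp (-b * m ^ 2 / J ^ 2) with hE
  have hE0 : 0 < E := Real.exp_pos _
  have hE1 : E ≤ 1 := by
    rw [hE, Real.exp_le_one_iff]
    apply div_nonpos_of_nonpos_of_nonneg
    · nlinarith [sq_nonneg m]
    · positivity
  have h3 : (m / J) ^ 2 * E ≤ 1 / b := by
    have h := Real.add_one_le_exp (b * (m / J) ^ 2)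
    have hEE : E * Real.exp (b * (m / J) ^ 2) = 1 := by
      rw [hE, ← Real.exp_add, Real.exp_eq_one_iff]
      field_simp
      ring
    rw [le_div_iff₀ hb]
    have : E * (b * (m / J) ^ 2) ≤ E * Real.exp (b * (m / J) ^ 2) :=
      mul_le_mul_of_nonneg_left (by linarith) hE0.le
    linarith
  have hpos : 0 < w ^ (3 / 2 : ℝ) := Real.rpow_pos_of_pos hw0 _
  have h4 : E * w ^ (3 / 2 : ℝ) ≤ 1 + 2 / r ^ 2 + 2 / b := by
    have h5 : w ^ (3 / 2 : ℝ) ≤ 1 + 2 / r ^ 2 + 2 * (m / J) ^ 2 := by linarith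
    have h6 := mul_le_mul_of_nonneg_left h5 hE0.le
    have h7 : E * (1 + 2 / r ^ 2) ≤ 1 * (1 + 2 / r ^ 2) :=
      mul_le_mul_of_nonneg_right hE1 (by positivity)
    have e3 : 2 / b = 2 * (1 / b) := by ring
    rw [e3]
    nlinarith
  have h5 : J ^ (3 / 2 : ℝ) * (1 + m) ^ (-(3 / 2) : ℝ) = (w ^ (3 / 2 : ℝ))⁻¹ := by
    rw [hw, Real.div_rpow hm1.le hJ0.le, Real.rpow_neg hm1.le, inv_div]
    rfl
  rw [h5, ← div_eq_mul_inv, le_div_iff₀ hpos]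
  exact h4

/-- A summable majorant of the Jacobi–Eisenstein series. -/
def eisBound (k : ℕ) (i : CoprimePair × ℤ) : ℝ :=
  ‖![i.1.1.1, i.1.1.2]‖ ^ (-((k : ℝ) - 3 / 2)) * (1 + |(i.2 : ℝ)|) ^ (-(3 / 2) : ℝ)

theorem summable_eisBound {k : ℕ} (hk : 4 ≤ k) : Summable (eisBound k) := by
  have hk' : (4 : ℝ) ≤ k := by exact_mod_cast hk
  have h1 : Summable fun p : CoprimePair => ‖![p.1.1, p.1.2]‖ ^ (-((k : ℝ) - 3 / 2)) := by
    have hinj : Function.Injective fun p : CoprimePair => ![p.1.1, p.1.2] := by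
      intro p q h
      have h0 := congrFun h 0
      have h1 := congrFun h 1
      exact Subtype.ext (Prod.ext h0 h1)
    exact (EisensteinSeries.summable_one_div_norm_rpow
      (k := (k : ℝ) - 3 / 2) (by linarith)).comp_injective hinj
  have h2 : Summable fun l : ℤ => (1 + |(l : ℝ)|) ^ (-(3 / 2) : ℝ) := by
    have hn : Summable fun n : ℕ => (1 + (n : ℝ)) ^ (-(3 / 2) : ℝ) := by
      have := (summable_nat_add_iff 1).mpr
        (Real.summable_nat_rpow (p := -(3 / 2)) |>.mpr (by norm_num))
      refine this.congr fun n => ?_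
      push_cast
      rw [add_comm]
    apply Summable.of_nat_of_neg <;> simpa using hn
  exact h1.mul_of_nonneg h2 (fun p => by positivity) (fun l => by positivity)

theorem norm_coprimePair_pos (p : CoprimePair) : ![p.1.1, p.1.2] ≠ 0 := by
  intro h
  have h0 : p.1.1 = 0 := congrFun h 0
  have h1 : p.1.2 = 0 := congrFun h 1
  have := p.2
  rw [h0, h1] at this
  simp at this

/-- Uniformity on vertical strips serves both holomorphy in τ and the termwise limit at i∞; it comes
from the lower bound for |cτ + d| by a multiple of max(|c|, |d|). -/
theorem exists_norm_eisTerm_le {k : ℕ} (hk : 4 ≤ k) (z : ℂ) (A : ℝ) {B : ℝ} (hB : 0 < B) :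
    ∃ C : ℝ, ∀ i, ∀ τ : ℍ, τ ∈ verticalStrip A B → ‖eisTerm k z i τ‖ ≤ C * eisBound k i := by
  have hk' : (4 : ℝ) ≤ k := by exact_mod_cast hk
  set r := EisensteinSeries.r ⟨⟨A, B⟩, hB⟩ with hr
  have hr0 : 0 < r := EisensteinSeries.r_pos _
  refine ⟨Real.exp (6 * π * ‖z‖ ^ 2 / B) * ((1 + 2 / r ^ 2 + 2 / (π * B)) *
    r ^ (-((k : ℝ) - 3 / 2))), fun ⟨p, l⟩ τ hτ => ?_⟩
  have hBy : B ≤ τ.im := hτ.2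
  refine (norm_eisTerm_le k z p l τ).trans ?_
  have hJ : jac (bezoutMat p) τ = (![p.1.1, p.1.2] 0 : ℂ) * τ + (![p.1.1, p.1.2] 1 : ℂ) := by
    simp [jac]
  have hn1 : 1 ≤ ‖![p.1.1, p.1.2]‖ := by
    have hz := norm_pos_iff.mpr (norm_coprimePair_pos p)
    rw [EisensteinSeries.norm_eq_max_natAbs] at hz ⊢
    exact_mod_cast hz
  have hle : r ≤ ‖jac (bezoutMat p) τ‖ := by
    have h1 := EisensteinSeries.r_mul_max_le τ (norm_coprimePair_pos p)
    have h2 := EisensteinSeries.r_lower_bound_on_verticalStrip τ hB hτ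
    rw [hJ]
    refine le_trans ?_ h1
    have h3 := EisensteinSeries.r_pos τ
    nlinarith
  have hbound := EisensteinSeries.summand_bound_of_mem_verticalStrip (z := τ)
    (k := (k : ℝ) - 3 / 2) (by linarith) ![p.1.1, p.1.2] hB hτ
  rw [← hJ, ← hr] at hbound
  set J := ‖jac (bezoutMat p) τ‖
  have hJ0 : 0 < J := hr0.trans_le hle
  have h1 : Real.exp (6 * π * ‖z‖ ^ 2 / τ.im) ≤ Real.exp (6 * π * ‖z‖ ^ 2 / B) := by
    gcongr
  have h2 : Real.exp (-(π * τ.im) * |(l : ℝ)| ^ 2 / J ^ 2) ≤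
      Real.exp (-(π * B) * |(l : ℝ)| ^ 2 / J ^ 2) := by
    gcongr
  have h3 := exp_neg_sq_div_le (b := π * B) (by positivity) hr0 hle (abs_nonneg (l : ℝ))
  have h4 : (J ^ k)⁻¹ * J ^ (3 / 2 : ℝ) = J ^ (-((k : ℝ) - 3 / 2)) := by
    rw [neg_sub, Real.rpow_sub hJ0, Real.rpow_natCast]
    field_simp
  set C1 := 1 + 2 / r ^ 2 + 2 / (π * B) with hC1
  have hC1' : 0 ≤ C1 := by positivity
  calc (J ^ k)⁻¹ * (Real.exp (6 * π * ‖z‖ ^ 2 / τ.im) *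
        Real.exp (-(π * τ.im) * |(l : ℝ)| ^ 2 / J ^ 2))
      ≤ (J ^ k)⁻¹ * (Real.exp (6 * π * ‖z‖ ^ 2 / B) *
        (C1 * (J ^ (3 / 2 : ℝ) * (1 + |(l : ℝ)|) ^ (-(3 / 2) : ℝ)))) := by
        refine mul_le_mul_of_nonneg_left ?_ (by positivity)
        exact mul_le_mul h1 (h2.trans h3) (Real.exp_nonneg _) (Real.exp_nonneg _)
    _ = Real.exp (6 * π * ‖z‖ ^ 2 / B) * (C1 * (((J ^ k)⁻¹ * J ^ (3 / 2 : ℝ)) *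
          (1 + |(l : ℝ)|) ^ (-(3 / 2) : ℝ))) := by ring
    _ ≤ Real.exp (6 * π * ‖z‖ ^ 2 / B) * (C1 * ((r ^ (-((k : ℝ) - 3 / 2)) *
          ‖![p.1.1, p.1.2]‖ ^ (-((k : ℝ) - 3 / 2))) * (1 + |(l : ℝ)|) ^ (-(3 / 2) : ℝ))) := by
        rw [h4]
        gcongr
    _ = _ := by rw [eisBound]; ring

theorem summable_eisTerm {k : ℕ} (hk : 4 ≤ k) (z : ℂ) (τ : ℍ) :
    Summable fun i => eisTerm k z i τ := by
  obtain ⟨C, hC⟩ := exists_norm_eisTerm_le hk z |τ.re| τ.im_pos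
  exact ((summable_eisBound hk).mul_left C).of_norm_bounded fun i => hC i τ ⟨le_rfl, le_rfl⟩

theorem mdifferentiable_jacobiEisenstein {k : ℕ} (hk : 4 ≤ k) (z : ℂ) :
    MDiff fun τ => jacobiEisenstein k τ z := by
  refine mdifferentiable_of_differentiableAt (fun τ => 1 / 2 * ∑' i, eisTerm k z i τ)
    (fun τ => jacobiEisenstein_eq k τ z) fun τ hτ => ?_
  refine DifferentiableAt.const_mul ?_ _
  obtain ⟨B, hB, hBτ⟩ := exists_between hτ
  obtain ⟨A, hA⟩ := exists_gt |τ.re|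
  obtain ⟨C, hC⟩ := exists_norm_eisTerm_le hk z A hB
  let U : Set ℂ := {w | B < w.im} ∩ {w | |w.re| < A}
  have hU : IsOpen U := (isOpen_lt continuous_const Complex.continuous_im).inter
    (isOpen_lt (by fun_prop) continuous_const)
  have hd : DifferentiableOn ℂ (fun w => ∑' i, eisTerm k z i w) U := by
    refine Complex.differentiableOn_tsum_of_summable_norm ((summable_eisBound hk).mul_left C)
      (fun i w hw => ?_) hU (fun i w hw => ?_)
    · have hw' : 0 < w.im := hB.trans hw.1
      have hj : (i.1.1.1 : ℂ) * w + (i.1.1.2 : ℂ) ≠ 0 := jac_ne_zero (bezoutMat i.1) ⟨w, hw'⟩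
      refine DifferentiableAt.differentiableWithinAt ?_
      unfold eisTerm
      have hjk := pow_ne_zero k hj
      fun_prop (disch := assumption)
    · have hw' : 0 < w.im := hB.trans hw.1
      exact hC i ⟨w, hw'⟩ ⟨le_of_lt hw.2, le_of_lt hw.1⟩
  exact hd.differentiableAt (hU.mem_nhds ⟨hBτ, hA⟩)

/-! ### The transformation law of the Jacobi–Eisenstein series -/

/-- For fixed (c, d) the sum over λ is `th0` slashed by a matrix with bottom row (c, d). The series
thus becomes a Poincaré-type sum over coprime pairs. -/
theorem hasSum_eisTerm_fiber (k : ℕ) (z : ℂ) (p : CoprimePair) (τ : ℍ) :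
    HasSum (fun l => eisTerm k z (p, l) τ) (jslash k 1 (bezoutMat p) th0 τ z) := by
  refine ((hasSum_th0 (bezoutMat p • τ) (z / jac (bezoutMat p) τ)).mul_left
    (jac (bezoutMat p) τ ^ (-(k : ℤ)) *
      cexp (-(2 * π * I * 1 * (bezoutMat p 1 0 : ℂ) * z ^ 2 / jac (bezoutMat p) τ)))).congr_fun
    fun l => ?_
  have h (a b c d : ℂ) (h : d = b + c) : a * cexp d = a * cexp b * cexp c := by
    rw [h, Complex.exp_add, mul_assoc]
  rw [eisTerm_eq, zpow_neg, zpow_natCast]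
  refine h _ _ _ _ ?_
  rw [bezoutMat_one_zero]
  ring

theorem hasSum_jslash_th0 {k : ℕ} (hk : 4 ≤ k) (τ : ℍ) (z : ℂ) :
    HasSum (fun p => jslash k 1 (bezoutMat p) th0 τ z) (2 * jacobiEisenstein k τ z) := by
  have h := (summable_eisTerm hk z τ).hasSum.prod_fiberwise
    fun p => hasSum_eisTerm_fiber k z p τ
  rw [jacobiEisenstein_eq]
  convert h using 1
  ring

theorem jslash_th0_congr (k : ℤ) {A B : SL(2, ℤ)} (h0 : A 1 0 = B 1 0) (h1 : A 1 1 = B 1 1) :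
    jslash k 1 A th0 = jslash k 1 B th0 := by
  funext τ z
  have hj : jac A τ = jac B τ := by rw [jac, jac, h0, h1]
  -- Matrices with the same bottom row differ by an integral translation on the left, under which
  -- `th0` is invariant; the choice of a and b is therefore immaterial.
  have hs : ((A • τ : ℍ) : ℂ) = (B • τ : ℍ) + ((A 0 1 * B 0 0 - A 0 0 * B 0 1 : ℤ) : ℂ) := by
    have hA := det_SL A
    have hB := det_SL B
    rw [h0, h1] at hA
    rw [coe_SL_smul, coe_SL_smul, hj, div_add' _ _ _ (jac_ne_zero B τ)]
    congr 1
    push_cast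
    rw [jac]
    linear_combination (τ * B 0 0 + B 0 1 : ℂ) * hA - (τ * A 0 0 + A 0 1 : ℂ) * hB
  rw [jslash, jslash, hj, h0, th0_eq_of_add_int hs]

/-- Right multiplication by a matrix, on coprime pairs. -/
def coprimePairMul (B : SL(2, ℤ)) (p : CoprimePair) : CoprimePair :=
  ⟨((bezoutMat p * B) 1 0, (bezoutMat p * B) 1 1), by
    have h := (bezoutMat p * B).det_coe
    rw [Matrix.det_fin_two] at h
    rw [← Int.isCoprime_iff_gcd_eq_one]
    exact ⟨-(bezoutMat p * B) 0 1, (bezoutMat p * B) 0 0, by linarith⟩⟩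

theorem bottom_row_mul (A B : SL(2, ℤ)) (i : Fin 2) :
    (A * B) 1 i = A 1 0 * B 0 i + A 1 1 * B 1 i := by
  simp [Matrix.SpecialLinearGroup.coe_mul, Matrix.mul_apply, Fin.sum_univ_two]

theorem coprimePairMul_mul (A B : SL(2, ℤ)) (h : A * B = 1) (p : CoprimePair) :
    coprimePairMul B (coprimePairMul A p) = p := by
  have key : ∀ i, (bezoutMat (coprimePairMul A p) * B) 1 i = bezoutMat p 1 i := by
    intro i
    have : bezoutMat p = bezoutMat p * A * B := by rw [mul_assoc, h, mul_one]
    conv_rhs => rw [this]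
    rw [bottom_row_mul, bottom_row_mul]
    rfl
  exact Subtype.ext (Prod.ext (key 0) (key 1))

/-- Right multiplication by a matrix permutes the coprime pairs. -/
def coprimePairEquiv (B : SL(2, ℤ)) : CoprimePair ≃ CoprimePair where
  toFun := coprimePairMul B
  invFun := coprimePairMul B⁻¹
  left_inv := coprimePairMul_mul B B⁻¹ (mul_inv_cancel B)
  right_inv := coprimePairMul_mul B⁻¹ B (inv_mul_cancel B)

/-- Slashing by B multiplies each matrix on the right by B, which only permutes the bottom rows. -/
theorem jslash_jacobiEisenstein {k : ℕ} (hk : 4 ≤ k) (B : SL(2, ℤ)) :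
    jslash k 1 B (jacobiEisenstein k) = jacobiEisenstein k := by
  funext τ z
  have h1 := ((hasSum_jslash_th0 hk (B • τ) (z / jac B τ)).mul_left
    (jac B τ ^ (-(k : ℤ)) * cexp (-(2 * π * I * 1 * (B 1 0 : ℂ) * z ^ 2 / jac B τ))))
  have h2 := (coprimePairEquiv B).hasSum_iff.mpr (hasSum_jslash_th0 hk τ z)
  have h3 := h1.unique (h2.congr_fun fun p => ?_)
  · rw [jslash]
    linear_combination h3 / 2
  · change _ = jslash k 1 (bezoutMat (coprimePairMul B p)) th0 τ z
    rw [jslash_th0_congr k (A := bezoutMat (coprimePairMul B p)) (B := bezoutMat p * B) rfl rfl,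
      jslash_mul]
    rfl

/-- Each summand over (c, d) is an index-one theta function, hence a fixed linear combination of its
values at 0 and 1/2. Summing these relations avoids any convergence question for the theta
coefficients themselves. -/
theorem jacobiEisenstein_decomp {k : ℕ} (hk : 4 ≤ k) (τ : ℍ) (z : ℂ) :
    jacobiEisenstein k τ z =
      jacobiEisenstein k τ 0 * ((th0 τ z / th0 τ 0 + th1 τ z / th1 τ 0) / 2) +
      jacobiEisenstein k τ (1 / 2) * ((th0 τ z / th0 τ 0 - th1 τ z / th1 τ 0) / 2) := by
  have hspan (p : CoprimePair) : InThetaSpan τ (jslash k 1 (bezoutMat p) th0 τ) :=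
    inThetaSpan_jslash k _ (fun τ => ⟨1, 0, fun z => by ring⟩) τ
  have h := ((hasSum_jslash_th0 hk τ 0).mul_right
    ((th0 τ z / th0 τ 0 + th1 τ z / th1 τ 0) / 2)).add ((hasSum_jslash_th0 hk τ (1 / 2)).mul_right
    ((th0 τ z / th0 τ 0 - th1 τ z / th1 τ 0) / 2))
  have h' := (hasSum_jslash_th0 hk τ z).unique (h.congr_fun fun p => (hspan p).eq z)
  linear_combination h' / 2

/-! ### The limit at the cusp -/

/-- Subtracting the integral part of Re τ moves τ into a strip without changing its height. The
majorants above are available only on strips. -/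
theorem tendsto_of_T_invariant {f : ℍ → ℂ} (hT : ∀ τ, f (T • τ) = f τ) {c : ℂ}
    (h : Tendsto f (atImInfty ⊓ 𝓟 {τ | |τ.re| ≤ 1}) (𝓝 c)) : Tendsto f atImInfty (𝓝 c) := by
  have hTz : ∀ (n : ℤ) τ, f (T ^ n • τ) = f τ := by
    intro n
    induction n using Int.induction_on with
    | zero => simp
    | succ n ih =>
      intro τ
      rw [zpow_add_one, mul_smul, ih, hT]
    | pred n ih =>
      intro τ
      have e : T * T ^ (-(n : ℤ) - 1) = T ^ (-(n : ℤ)) := by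
        rw [zpow_sub_one]; group
      rw [← hT (T ^ (-(n : ℤ) - 1) • τ), ← mul_smul, e, ih]
  intro s hs
  have := h hs
  rw [mem_map, mem_inf_principal, atImInfty_mem] at this
  obtain ⟨A, hA⟩ := this
  rw [mem_map, atImInfty_mem]
  refine ⟨A, fun τ hτ => ?_⟩
  have hre : (T ^ (-⌊τ.re⌋) • τ).re = Int.fract τ.re := by
    rw [ModularGroup.re_T_zpow_smul, Int.fract]
    push_cast
    ring
  have him : (T ^ (-⌊τ.re⌋) • τ).im = τ.im := ModularGroup.im_T_zpow_smul _ _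
  have := hA (T ^ (-⌊τ.re⌋) • τ) (by rw [him]; exact hτ) (by
    change |(T ^ (-⌊τ.re⌋) • τ).re| ≤ 1
    rw [hre, abs_of_nonneg (Int.fract_nonneg _)]
    exact (Int.fract_lt_one _).le)
  rw [Set.mem_preimage, hTz] at this
  exact this

theorem jacobiEisenstein_T_smul {k : ℕ} (hk : 4 ≤ k) (τ : ℍ) (z : ℂ) :
    jacobiEisenstein k (T • τ) z = jacobiEisenstein k τ z := by
  have h := congrFun (congrFun (jslash_jacobiEisenstein hk T) τ) z
  rw [jslash, jac_T] at h
  simpa [T] using h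

/-- For c ≠ 0 one has |cτ + d| ≥ Im τ, so the term decays like (Im τ)^{-k}. For c = 0 one has d =
±1, and the term decays exponentially unless λ = 0, where it equals 1 because k is even. -/
theorem tendsto_eisTerm {k : ℕ} (hk : 4 ≤ k) (hk2 : Even k) (z : ℂ) (p : CoprimePair) (l : ℤ) :
    Tendsto (fun τ : ℍ => eisTerm k z (p, l) τ) atImInfty
      (𝓝 (if p.1.1 = 0 ∧ l = 0 then 1 else 0)) := by
  have him : Tendsto (fun τ : ℍ => τ.im) atImInfty atTop := tendsto_comap
  have hE : Tendsto (fun τ : ℍ => Real.exp (6 * π * ‖z‖ ^ 2 / τ.im)) atImInfty (𝓝 1) := by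
    have := (Real.continuous_exp.tendsto 0).comp (him.const_div_atTop (6 * π * ‖z‖ ^ 2))
    simpa [Function.comp_def] using this
  by_cases hc : p.1.1 = 0
  · have hd : (p.1.2 : ℂ) = 1 ∨ (p.1.2 : ℂ) = -1 := by
      have h := p.2
      rw [hc, Int.gcd_zero_left] at h
      rcases Int.natAbs_eq_iff.mp h with h | h <;> rw [h] <;> simp
    have hj : ∀ τ : ℍ, jac (bezoutMat p) τ = p.1.2 := fun τ => by simp [jac, hc]
    by_cases hl : l = 0
    · rw [if_pos ⟨hc, hl⟩]
      refine tendsto_const_nhds.congr fun τ => ?_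
      have hdk : (p.1.2 : ℂ) ^ k = 1 := by rcases hd with h | h <;> simp [h, hk2.neg_one_pow]
      rw [eisTerm_eq, hj, hl, hc, hdk]
      simp
    · rw [if_neg (fun h => hl h.2), tendsto_zero_iff_norm_tendsto_zero]
      have hlim : Tendsto (fun τ : ℍ => Real.exp (6 * π * ‖z‖ ^ 2 / τ.im) *
          Real.exp (-(π * |(l : ℝ)| ^ 2) * τ.im)) atImInfty (𝓝 0) := by
        rw [show (0 : ℝ) = 1 * 0 by ring]
        refine hE.mul (Real.tendsto_exp_atBot.comp (him.const_mul_atTop_of_neg ?_))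
        have : (l : ℝ) ≠ 0 := by exact_mod_cast hl
        have : 0 < π * |(l : ℝ)| ^ 2 := by positivity
        linarith
      refine squeeze_zero (fun _ => norm_nonneg _) (fun τ => ?_) hlim
      refine (norm_eisTerm_le k z p l τ).trans (le_of_eq ?_)
      have hn : ‖(p.1.2 : ℂ)‖ = 1 := by rcases hd with h | h <;> simp [h]
      rw [hj, hn]
      simp only [one_pow, inv_one, one_mul, div_one]
      congr 2
      ring
  · rw [if_neg (fun h => hc h.1), tendsto_zero_iff_norm_tendsto_zero]
    have hlim : Tendsto (fun τ : ℍ => (τ.im ^ k)⁻¹ * Real.exp (6 * π * ‖z‖ ^ 2 / τ.im)) atImInfty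
        (𝓝 0) := by
      rw [show (0 : ℝ) = 0 * 1 by ring]
      exact (((tendsto_pow_atTop (by omega)).comp him).inv_tendsto_atTop).mul hE
    refine squeeze_zero (fun _ => norm_nonneg _) (fun τ => ?_) hlim
    refine (norm_eisTerm_le k z p l τ).trans ?_
    have hy := τ.im_pos
    have hJ : τ.im ≤ ‖jac (bezoutMat p) τ‖ := by
      have h := Complex.abs_im_le_norm (jac (bezoutMat p) τ)
      rw [jac_im, abs_mul, abs_of_pos hy, bezoutMat_one_zero] at h
      have : (1 : ℝ) ≤ |(p.1.1 : ℝ)| := by exact_mod_cast Int.one_le_abs hc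
      nlinarith
    refine mul_le_mul (by gcongr) ?_ (by positivity) (by positivity)
    refine mul_le_of_le_one_right (Real.exp_nonneg _) (Real.exp_le_one_iff.mpr ?_)
    apply div_nonpos_of_nonpos_of_nonneg
    · have := Real.pi_pos
      have : 0 ≤ π * τ.im * |(l : ℝ)| ^ 2 := by positivity
      linarith
    · positivity

theorem tendsto_jacobiEisenstein {k : ℕ} (hk : 4 ≤ k) (hk2 : Even k) (z : ℂ) :
    Tendsto (fun τ => jacobiEisenstein k τ z) atImInfty (𝓝 1) := by
  refine tendsto_of_T_invariant (fun τ => jacobiEisenstein_T_smul hk τ z) ?_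
  obtain ⟨C, hC⟩ := exists_norm_eisTerm_le hk z 1 one_pos
  have h := tendsto_tsum_of_dominated_convergence
    (𝓕 := atImInfty ⊓ 𝓟 {τ : ℍ | |τ.re| ≤ 1}) (f := fun (τ : ℍ) i => eisTerm k z i τ)
    (g := fun i : CoprimePair × ℤ => if i.1.1.1 = 0 ∧ i.2 = 0 then (1 : ℂ) else 0)
    ((summable_eisBound hk).mul_left C)
    (fun i => (tendsto_eisTerm hk hk2 z i.1 i.2).mono_left inf_le_left) ?_
  -- The surviving terms are (c, d) = (0, ±1) with λ = 0; the factor 1/2 of the series normalizes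
  -- their sum to 1.
  · have hval : (∑' i : CoprimePair × ℤ, if i.1.1.1 = 0 ∧ i.2 = 0 then (1 : ℂ) else 0) = 2 := by
      have hne : ((⟨(0, 1), by simp⟩, 0) : CoprimePair × ℤ) ≠ (⟨(0, -1), by simp⟩, 0) := by
        simp
      rw [tsum_eq_sum (s := {((⟨(0, 1), by simp⟩, 0) : CoprimePair × ℤ), (⟨(0, -1), by simp⟩, 0)}),
        Finset.sum_pair hne]
      · norm_num
      · rintro ⟨⟨⟨c, d⟩, hp⟩, l⟩ hi
        rw [if_neg]
        rintro ⟨h1, h2⟩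
        simp only at h1 h2 hp
        subst h1 h2
        apply hi
        rw [Int.gcd_zero_left] at hp
        rcases Int.natAbs_eq_iff.mp hp with h | h <;> simp at h <;> subst h <;> simp
    rw [hval] at h
    have := h.const_mul (1 / 2)
    norm_num at this
    refine this.congr fun τ => ?_
    rw [jacobiEisenstein_eq]
  · have h1 : ∀ᶠ τ : ℍ in atImInfty ⊓ 𝓟 {τ : ℍ | |τ.re| ≤ 1}, 1 ≤ τ.im :=
      (tendsto_comap.eventually_ge_atTop 1).filter_mono inf_le_left
    have h2 : ∀ᶠ τ : ℍ in atImInfty ⊓ 𝓟 {τ : ℍ | |τ.re| ≤ 1}, |τ.re| ≤ 1 :=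
      Filter.Eventually.filter_mono inf_le_right (eventually_principal.mpr fun _ h => h)
    filter_upwards [h1, h2] with τ ht1 ht2 i
    exact hC i τ ⟨ht2, ht1⟩

theorem jacobiEisenstein_zero_S_smul {k : ℕ} (hk : 4 ≤ k) (τ : ℍ) :
    jacobiEisenstein k (S • τ) 0 = (τ : ℂ) ^ k * jacobiEisenstein k τ 0 := by
  have h := congrFun (congrFun (jslash_jacobiEisenstein hk S) τ) 0
  rw [jslash, jac_S] at h
  have h0 := pow_ne_zero k τ.ne_zero
  rw [zero_div, show -(2 * π * I * 1 * (S 1 0 : ℂ) * 0 ^ 2 / (τ : ℂ)) = 0 by ring,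
    Complex.exp_zero, mul_one, zpow_neg, zpow_natCast] at h
  rw [← h, mul_inv_cancel_left₀ h0]

theorem jacobiEisenstein_four_zero (τ : ℍ) : jacobiEisenstein 4 τ 0 = ModularForm.E₄ τ :=
  levelOne_of_rank_one (by norm_num) (by decide) ModularForm.levelOne_weight_four_rank_one
    (jacobiEisenstein_zero_S_smul le_rfl) (fun τ => jacobiEisenstein_T_smul le_rfl τ 0)
    (mdifferentiable_jacobiEisenstein le_rfl 0) (tendsto_jacobiEisenstein le_rfl (by decide) 0) τ

theorem jacobiEisenstein_six_zero (τ : ℍ) : jacobiEisenstein 6 τ 0 = ModularForm.E₆ τ :=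
  levelOne_of_rank_one (by norm_num) (by decide) ModularForm.levelOne_weight_six_rank_one
    (jacobiEisenstein_zero_S_smul (by norm_num)) (fun τ => jacobiEisenstein_T_smul (by norm_num) τ 0)
    (mdifferentiable_jacobiEisenstein (by norm_num) 0)
    (tendsto_jacobiEisenstein (by norm_num) (by decide) 0) τ

/-! ### The weak Jacobi form `φ_{0,1}` -/

theorem mdifferentiable_comp_SL_smul {f : ℍ → ℂ} (hf : MDiff f) (A : SL(2, ℤ)) :
    MDiff fun τ => f (A • τ) := by
  refine hf.comp (UpperHalfPlane.mdifferentiable_smul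
    (g := ((A : SL(2, ℝ)) : GL (Fin 2) ℝ)) ?_)
  simp

theorem isBoundedAtImInfty_of_tendsto {f : ℍ → ℂ} {c : ℂ} (h : Tendsto f atImInfty (𝓝 c)) :
    IsBoundedAtImInfty f := h.isBigO_one ℝ

theorem tendsto_T_smul : Tendsto (fun τ : ℍ => T • τ) atImInfty atImInfty := by
  refine tendsto_comap_iff.mpr ?_
  have h : Tendsto (fun τ : ℍ => τ.im) atImInfty atTop := tendsto_comap
  refine h.congr fun τ => ?_
  change (τ : ℂ).im = ((T • τ : ℍ) : ℂ).im
  rw [coe_T_smul]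
  simp

/-- A modular function of level two which is bounded at the cusps, and vanishes at one of them,
vanishes at the other. -/
theorem eq_zero_of_tendsto_level_two {F : ℍ → ℂ} {c : ℂ} (hol : MDiff F)
    (hT : ∀ τ, F (T • τ) = F τ) (hST : ∀ τ, F (S • T • T • τ) = F (S • τ))
    (hF : Tendsto F atImInfty (𝓝 c)) (hG : Tendsto (fun τ => F (S • τ)) atImInfty (𝓝 0)) :
    c = 0 := by
  have hTG := hG.comp tendsto_T_smul
  have holG := mdifferentiable_comp_SL_smul hol S
  have holTG := mdifferentiable_comp_SL_smul holG T
  -- After inserting a T the claim is TSTSTτ = Sτ, that is, the relation (ST)³ = -1.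
  have hrel (τ : ℍ) : F (S • T • S • T • τ) = F (S • τ) := by
    rw [← hT]
    congr 1
    ext
    have h0 := τ.ne_zero
    have h1 := (T • τ).ne_zero
    have h2 := (T • S • T • τ).ne_zero
    simp only [coe_T_smul, coe_S_smul] at *
    have h3 : -1 + ((τ : ℂ) + 1) ≠ 0 := by simpa using h0
    field_simp
    ring
  have hrel' (τ : ℍ) : F (S • T • S • τ) = F (S • T • τ) := by
    have h := hrel (T⁻¹ • τ)
    rw [smul_inv_smul] at h
    rw [h, ← hST (T⁻¹ • τ), smul_inv_smul]
  -- S and T permute the three functions F, F ∘ S and F ∘ ST, so their elementary symmetric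
  -- functions are bounded, of level one and weight zero, hence constant.
  obtain ⟨e₁, he₁⟩ := levelOne_weight_zero (f := fun τ => F τ + F (S • τ) + F (S • T • τ))
    (fun τ => by rw [S_smul_S_smul, hrel']; ring) (fun τ => by rw [hT, hST]; ring)
    ((hol.add holG).add holTG) (isBoundedAtImInfty_of_tendsto ((hF.add hG).add hTG))
  obtain ⟨e₂, he₂⟩ := levelOne_weight_zero
    (f := fun τ => F τ * F (S • τ) + F τ * F (S • T • τ) + F (S • τ) * F (S • T • τ))
    (fun τ => by rw [S_smul_S_smul, hrel']; ring) (fun τ => by rw [hT, hST]; ring)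
    (((hol.mul holG).add (hol.mul holTG)).add (holG.mul holTG))
    (isBoundedAtImInfty_of_tendsto (((hF.mul hG).add (hF.mul hTG)).add (hG.mul hTG)))
  obtain ⟨e₃, he₃⟩ := levelOne_weight_zero (f := fun τ => F τ * F (S • τ) * F (S • T • τ))
    (fun τ => by rw [S_smul_S_smul, hrel']; ring) (fun τ => by rw [hT, hST]; ring)
    ((hol.mul holG).mul holTG) (isBoundedAtImInfty_of_tendsto ((hF.mul hG).mul hTG))
  have h₁ : e₁ = c := by
    refine tendsto_nhds_unique (tendsto_const_nhds.congr fun τ => (he₁ τ).symm)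
      (l := atImInfty) ?_
    simpa using (hF.add hG).add hTG
  have h₂ : e₂ = 0 := by
    refine tendsto_nhds_unique (tendsto_const_nhds.congr fun τ => (he₂ τ).symm)
      (l := atImInfty) ?_
    simpa using ((hF.mul hG).add (hF.mul hTG)).add (hG.mul hTG)
  have h₃ : e₃ = 0 := by
    refine tendsto_nhds_unique (tendsto_const_nhds.congr fun τ => (he₃ τ).symm)
      (l := atImInfty) ?_
    simpa using (hF.mul hG).mul hTG
  subst h₁ h₂ h₃
  -- The limits at i∞ show that F is a root of X²(X - c). Its values 0 and c have the same square
  -- after the shift 2F - c, so continuity makes F constant.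
  have hsq (τ : ℍ) : (2 * F τ - e₁) ^ 2 = e₁ ^ 2 := by
    have hroot : F τ ^ 2 * (F τ - e₁) = 0 := by
      linear_combination F τ ^ 2 * he₁ τ - F τ * he₂ τ + he₃ τ
    rcases mul_eq_zero.mp hroot with h | h
    · rw [pow_eq_zero_iff two_ne_zero] at h
      rw [h]
      ring
    · rw [sub_eq_zero.mp h]
      ring
  have hconst (τ : ℍ) : F τ = F UpperHalfPlane.I := by
    have hcont : Continuous fun τ => 2 * F τ - e₁ := by
      have := hol.continuous
      fun_prop
    linear_combination eq_of_pow_eq_const hcont two_pos hsq τ UpperHalfPlane.I / 2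
  have hc := tendsto_nhds_unique hF (tendsto_const_nhds.congr fun τ => (hconst τ).symm)
  rw [hc]
  exact tendsto_nhds_unique (tendsto_const_nhds.congr fun τ => (hconst (S • τ)).symm) hG

/-- A holomorphic function of q vanishing at q = 0 is O(q). -/
theorem isBoundedAtImInfty_div_q {f : ℍ → ℂ} (hT : ∀ τ, f (T • τ) = f τ) (hol : MDiff f)
    (h0 : Tendsto f atImInfty (𝓝 0)) :
    IsBoundedAtImInfty fun τ => cexp (-(2 * π * I * τ)) * f τ := by
  have h0' : IsZeroAtImInfty f := h0
  have h := h0'.exp_decay_atImInfty one_pos (periodic_of_T_invariant hT) hol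
    (isBoundedAtImInfty_of_tendsto h0)
  have h1 : (fun τ : ℍ => cexp (-(2 * π * I * τ))) =O[atImInfty]
      fun τ => Real.exp (2 * π * τ.im) := by
    refine Asymptotics.isBigO_of_le _ fun τ => ?_
    rw [Complex.norm_exp, Real.norm_eq_abs, Real.abs_exp]
    simp
  refine (h1.mul h).congr_right fun τ => ?_
  rw [← Real.exp_add, Pi.one_apply, Real.exp_eq_one_iff]
  ring

theorem jacobiEisenstein_smul {k : ℕ} (hk : 4 ≤ k) (A : SL(2, ℤ)) (τ : ℍ) (z : ℂ) :
    jacobiEisenstein k (A • τ) (z / jac A τ) =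
      jac A τ ^ k * cexp (2 * π * I * (A 1 0 : ℂ) * z ^ 2 / jac A τ) * jacobiEisenstein k τ z := by
  have h := congrFun (congrFun (jslash_jacobiEisenstein hk A) τ) z
  have hj := pow_ne_zero k (jac_ne_zero A τ)
  rw [← h, jslash, Complex.exp_neg, zpow_neg, zpow_natCast]
  have := Complex.exp_ne_zero (2 * π * I * 1 * (A 1 0 : ℂ) * z ^ 2 / jac A τ)
  rw [mul_one] at *
  field_simp

theorem jacobiEisenstein_zero_smul {k : ℕ} (hk : 4 ≤ k) (A : SL(2, ℤ)) (τ : ℍ) :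
    jacobiEisenstein k (A • τ) 0 = jac A τ ^ k * jacobiEisenstein k τ 0 := by
  have h := jacobiEisenstein_smul hk A τ 0
  rwa [zero_div, show 2 * π * I * (A 1 0 : ℂ) * 0 ^ 2 / jac A τ = 0 by ring, Complex.exp_zero,
    mul_one] at h

/-- The numerator of `φ_{0,1}`. -/
def phiNum (τ : ℍ) (z : ℂ) : ℂ :=
  jacobiEisenstein 4 τ 0 ^ 2 * jacobiEisenstein 4 τ z -
    jacobiEisenstein 6 τ 0 * jacobiEisenstein 6 τ z

/-- The constant is 1728/12 = 144, from E₄³ - E₆² = 1728 η²⁴. -/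
theorem phi01_eq (τ : ℍ) (z : ℂ) :
    phi01 τ z = phiNum τ z / (144 * ModularForm.eta τ ^ 24) := by
  have h := ModularForm.discriminant_eq_E₄_cube_sub_E₆_sq τ
  rw [ModularForm.discriminant] at h
  rw [phi01, phiNum, h, jacobiEisenstein_four_zero, jacobiEisenstein_six_zero]
  congr 1
  ring

theorem phi01_zero (τ : ℍ) : phi01 τ 0 = 12 := by
  have h := ModularForm.discriminant_eq_E₄_cube_sub_E₆_sq τ
  rw [ModularForm.discriminant] at h
  have h0 := pow_ne_zero 24 (eta_ne_zero τ)
  rw [phi01_eq, div_eq_iff (by simpa using h0), phiNum, h, jacobiEisenstein_four_zero,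
    jacobiEisenstein_six_zero]
  ring

theorem phi01_smul (A : SL(2, ℤ)) (τ : ℍ) (z : ℂ) :
    phi01 (A • τ) (z / jac A τ) =
      cexp (2 * π * I * (A 1 0 : ℂ) * z ^ 2 / jac A τ) * phi01 τ z := by
  have h0 := eta_ne_zero τ
  have hj := jac_ne_zero A τ
  rw [phi01_eq, phi01_eq, phiNum, phiNum, eta_pow_smul, jacobiEisenstein_zero_smul (by norm_num),
    jacobiEisenstein_zero_smul (by norm_num), jacobiEisenstein_smul (by norm_num),
    jacobiEisenstein_smul (by norm_num)]
  generalize cexp _ = e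
  field_simp

theorem phi01_T_smul (τ : ℍ) (z : ℂ) : phi01 (T • τ) z = phi01 τ z := by
  have h := phi01_smul T τ z
  rw [jac_T] at h
  simpa [T] using h

theorem phi01_S_smul_half (τ : ℍ) :
    phi01 (S • τ) (1 / 2) = cexp (π * I * τ / 2) * phi01 τ (τ / 2) := by
  have h := phi01_smul S τ (τ / 2)
  have h0 := τ.ne_zero
  rw [jac_S, show (τ / 2 / τ : ℂ) = 1 / 2 by field_simp] at h
  rw [h]
  congr 2
  simp only [S, Matrix.SpecialLinearGroup.coe_mk]
  simp
  field_simp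

/-! ### The theta decomposition of φ_{0,1} and its behaviour at the cusp -/

/-- The coefficients of `φ_{0,1}` in the basis of theta functions. -/
def phiCoeff0 (τ : ℍ) : ℂ := (12 + phi01 τ (1 / 2)) / (2 * th0 τ 0)

/-- The second coefficient, normalized by the power `q^{1/4}`. -/
def phiCoeff1 (τ : ℍ) : ℂ := (12 - phi01 τ (1 / 2)) / (2 * (cexp (-(π * I * τ / 2)) * th1 τ 0))

/-- The numerator is linear in the two Jacobi–Eisenstein series with coefficients depending on τ
only, so their decomposition passes to φ_{0,1}; the value at z = 0 is 12. -/
theorem phi01_decomp (τ : ℍ) (z : ℂ) : phi01 τ z =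
    phiCoeff0 τ * th0 τ z + cexp (-(π * I * τ / 2)) * phiCoeff1 τ * th1 τ z := by
  have h4 := jacobiEisenstein_decomp le_rfl τ z
  have h6 := jacobiEisenstein_decomp (show 4 ≤ 6 by norm_num) τ z
  have hη := pow_ne_zero 24 (eta_ne_zero τ)
  have hz : phi01 τ z = phi01 τ 0 * ((th0 τ z / th0 τ 0 + th1 τ z / th1 τ 0) / 2) +
      phi01 τ (1 / 2) * ((th0 τ z / th0 τ 0 - th1 τ z / th1 τ 0) / 2) := by
    simp only [phi01_eq]
    rw [div_mul_eq_mul_div, div_mul_eq_mul_div, ← add_div]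
    congr 1
    simp only [phiNum]
    rw [h4, h6]
    ring
  have t0 := th0_zero_ne_zero τ
  have t1 := th1_zero_ne_zero τ
  have te := Complex.exp_ne_zero (-(π * I * τ / 2))
  rw [hz, phi01_zero, phiCoeff0, phiCoeff1]
  field_simp
  ring

theorem phi01_add_lattice (τ : ℍ) (z : ℂ) (x y : ℤ) :
    phi01 τ (z + x * τ + y) = cexp (-(2 * π * I * (x ^ 2 * τ + 2 * x * z))) * phi01 τ z := by
  rw [phi01_decomp, phi01_decomp τ z, th0_add_lattice, th1_add_lattice]
  ring

theorem mdifferentiable_phi01 (z : ℂ) : MDiff fun τ => phi01 τ z := by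
  have h4 := fun z => mdifferentiable_jacobiEisenstein (k := 4) le_rfl z
  have h6 := fun z => mdifferentiable_jacobiEisenstein (k := 6) (by norm_num) z
  rw [funext fun τ => phi01_eq τ z]
  refine MDifferentiable.div ((((h4 0).pow 2).mul (h4 z)).sub ((h6 0).mul (h6 z)))
    (mdifferentiable_const.mul (mdifferentiable_eta.pow 24)) fun τ => ?_
  exact mul_ne_zero (by norm_num) (pow_ne_zero 24 (eta_ne_zero τ))

theorem tendsto_phiNum (z : ℂ) : Tendsto (fun τ => phiNum τ z) atImInfty (𝓝 0) := by
  have h4 := fun z => tendsto_jacobiEisenstein (k := 4) le_rfl (by decide) z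
  have h6 := fun z => tendsto_jacobiEisenstein (k := 6) (by norm_num) (by decide) z
  simpa [phiNum] using (((h4 0).pow 2).mul (h4 z)).sub ((h6 0).mul (h6 z))

/-- All the Eisenstein series tend to 1, so the numerator vanishes at i∞ and is O(q), which
compensates the simple zero of η²⁴ in q. -/
theorem isBoundedAtImInfty_phi01 (z : ℂ) : IsBoundedAtImInfty fun τ => phi01 τ z := by
  have h4 := fun z => mdifferentiable_jacobiEisenstein (k := 4) le_rfl z
  have h6 := fun z => mdifferentiable_jacobiEisenstein (k := 6) (by norm_num) z
  have hb := isBoundedAtImInfty_div_q (f := fun τ => phiNum τ z)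
    (fun τ => by simp only [phiNum, jacobiEisenstein_T_smul le_rfl,
      jacobiEisenstein_T_smul (show 4 ≤ 6 by norm_num)])
    ((((h4 0).pow 2).mul (h4 z)).sub ((h6 0).mul (h6 z))) (tendsto_phiNum z)
  have hη : Tendsto (fun τ : ℍ => (144 * (cexp (-(2 * π * I * τ / 24)) * ModularForm.eta τ) ^ 24)⁻¹)
      atImInfty (𝓝 (144 * 1 ^ 24)⁻¹) :=
    ((tendsto_eta_div.pow 24).const_mul 144).inv₀ (by norm_num)
  have h := hb.mul (isBoundedAtImInfty_of_tendsto hη)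
  refine h.congr (fun τ => ?_) fun τ => by simp
  simp only [Pi.mul_apply, mul_pow, ← Complex.exp_nat_mul, phi01_eq]
  rw [show ((24 : ℕ) : ℂ) * -(2 * π * I * τ / 24) = -(2 * π * I * τ) by push_cast; ring]
  have := Complex.exp_ne_zero (-(2 * π * I * τ))
  have := eta_ne_zero τ
  field_simp

theorem exists_tendsto_phi01_half :
    ∃ c, Tendsto (fun τ => phi01 τ (1 / 2)) atImInfty (𝓝 c) := by
  obtain ⟨a, -, h⟩ := exists_qExpansion (fun τ => phi01_T_smul τ (1 / 2))
    (mdifferentiable_phi01 _) (isBoundedAtImInfty_phi01 _)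
  exact ⟨_, h⟩

theorem mdifferentiable_th0 (z : ℂ) : MDiff fun τ => th0 τ z :=
  mdifferentiable_of_joint differentiableOn_th0 z

theorem mdifferentiable_th1 (z : ℂ) : MDiff fun τ => th1 τ z :=
  mdifferentiable_of_joint differentiableOn_th1 z

theorem mdifferentiable_cexp_mul (a : ℂ) : MDiff fun τ : ℍ => cexp (a * τ) :=
  mdifferentiable_of_differentiableAt (fun τ => cexp (a * τ)) (fun _ => rfl) fun τ _ => by fun_prop

theorem phiCoeff0_T_smul (τ : ℍ) : phiCoeff0 (T • τ) = phiCoeff0 τ := by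
  rw [phiCoeff0, phiCoeff0, phi01_T_smul, th0_T_smul]

theorem phiCoeff1_T_smul (τ : ℍ) : phiCoeff1 (T • τ) = phiCoeff1 τ := by
  have e : cexp (-(π * I * (T • τ : ℍ) / 2)) * cexp (π * I / 2) = cexp (-(π * I * τ / 2)) := by
    rw [← Complex.exp_add, coe_T_smul]
    congr 1
    ring
  rw [phiCoeff1, phiCoeff1, phi01_T_smul, th1_T_smul, ← mul_assoc (cexp _) (cexp _), e]

theorem mdifferentiable_phiCoeff0 : MDiff phiCoeff0 :=
  (mdifferentiable_const.add (mdifferentiable_phi01 _)).div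
    (mdifferentiable_const.mul (mdifferentiable_th0 0))
    fun τ => mul_ne_zero two_ne_zero (th0_zero_ne_zero τ)

theorem mdifferentiable_phiCoeff1 : MDiff phiCoeff1 := by
  have h : MDiff fun τ : ℍ => cexp (-(π * I * τ / 2)) := by
    convert mdifferentiable_cexp_mul (-(π * I / 2)) using 3
    ring
  exact (mdifferentiable_const.sub (mdifferentiable_phi01 _)).div
    (mdifferentiable_const.mul (h.mul (mdifferentiable_th1 0)))
    fun τ => mul_ne_zero two_ne_zero (mul_ne_zero (Complex.exp_ne_zero _) (th1_zero_ne_zero τ))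

theorem tendsto_phiCoeff0 {c : ℂ} (hc : Tendsto (fun τ => phi01 τ (1 / 2)) atImInfty (𝓝 c)) :
    Tendsto phiCoeff0 atImInfty (𝓝 ((12 + c) / (2 * 1))) :=
  (hc.const_add 12).div (tendsto_th0.const_mul 2) (by norm_num)

theorem tendsto_phiCoeff1 {c : ℂ} (hc : Tendsto (fun τ => phi01 τ (1 / 2)) atImInfty (𝓝 c)) :
    Tendsto phiCoeff1 atImInfty (𝓝 ((12 - c) / (2 * 2))) :=
  (hc.const_sub 12).div (tendsto_th1.const_mul 2) (by norm_num)

theorem phi01_half_period (τ : ℍ) : cexp (π * I * τ / 2) * phi01 τ (τ / 2) =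
    phiCoeff0 τ * th1 τ 0 + cexp (-(π * I * τ / 2)) * phiCoeff1 τ * th0 τ 0 := by
  rw [phi01_decomp, ← th0_half_period, ← th1_half_period]
  ring

theorem tendsto_th1_zero : Tendsto (fun τ => th1 τ 0) atImInfty (𝓝 0) := by
  have h := (tendsto_cexp_atImInfty (a := 1 / 4) (by norm_num)).mul tendsto_th1
  rw [zero_mul] at h
  refine h.congr fun τ => ?_
  rw [← mul_assoc, ← Complex.exp_add]
  push_cast
  rw [show 2 * π * I * (1 / 4) * τ + -(π * I * τ / 2) = (0 : ℂ) by ring, Complex.exp_zero, one_mul]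

/-- If c = 12, the normalized coefficient of `th1` vanishes at the cusp and so is O(q). Then
φ_{0,1}(Sτ, 1/2) tends to 0, while φ_{0,1}(τ, 1/2) tends to 12, against the rigidity of bounded
modular functions of level two. -/
theorem tendsto_phi01_half_ne {c : ℂ}
    (hc : Tendsto (fun τ => phi01 τ (1 / 2)) atImInfty (𝓝 c)) : c ≠ 12 := by
  rintro rfl
  have hH := tendsto_phiCoeff1 hc
  rw [sub_self, zero_div] at hH
  have hb := isBoundedAtImInfty_div_q phiCoeff1_T_smul mdifferentiable_phiCoeff1 hH
  -- The factor q^{-1/4} times O(q) is O(q^{3/4}).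
  have h1 : Tendsto (fun τ : ℍ => cexp (-(π * I * τ / 2)) * phiCoeff1 τ) atImInfty (𝓝 0) := by
    have hq := tendsto_cexp_atImInfty (a := 3 / 4) (by norm_num)
    have hb' : (fun τ : ℍ => cexp (-(2 * π * I * τ)) * phiCoeff1 τ) =O[atImInfty]
      (fun _ => (1 : ℂ)) := hb.trans (Asymptotics.isBigO_of_le _ fun _ => by simp)
    have := (Asymptotics.isBigO_refl (fun τ : ℍ => cexp (2 * π * I * (3 / 4 : ℝ) * τ))
      atImInfty).mul hb'
    simp only [mul_one] at this
    refine (this.trans_tendsto hq).congr fun τ => ?_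
    rw [← mul_assoc, ← Complex.exp_add]
    congr 2
    push_cast
    ring
  have hG : Tendsto (fun τ => phi01 (S • τ) (1 / 2)) atImInfty (𝓝 0) := by
    have h := ((tendsto_phiCoeff0 hc).mul tendsto_th1_zero).add (h1.mul tendsto_th0)
    simp only [mul_zero, zero_mul, add_zero] at h
    refine h.congr fun τ => ?_
    rw [phi01_S_smul_half, phi01_half_period]
  -- The square is needed because φ_{0,1}(Sτ, 1/2) changes sign under T².
  have h := eq_zero_of_tendsto_level_two (F := fun τ => phi01 τ (1 / 2) ^ 2)
    ((mdifferentiable_phi01 _).pow 2) (fun τ => by rw [phi01_T_smul]) (fun τ => ?_) (hc.pow 2)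
    (by simpa using hG.pow 2)
  · norm_num at h
  · simp only [phi01_S_smul_half]
    rw [phi01_half_period, phi01_half_period]
    simp only [phiCoeff0_T_smul, phiCoeff1_T_smul, th0_T_smul, th1_T_smul, coe_T_smul]
    have e1 : cexp (π * I / 2) * cexp (π * I / 2) = -1 := by
      rw [← Complex.exp_add, add_halves, Complex.exp_pi_mul_I]
    have e2 : cexp (-(π * I * (τ + 1 + 1) / 2)) = -cexp (-(π * I * τ / 2)) := by
      rw [show -(π * I * (τ + 1 + 1) / 2) = -(π * I * τ / 2) + -(π * I) by ring, Complex.exp_add,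
        Complex.exp_neg (π * I), Complex.exp_pi_mul_I]
      norm_num
    rw [e2, ← mul_assoc (cexp _) (cexp _), e1]
    ring

/-- The expansion of `φ_{0,1}` at the cusp, as a combination of theta functions. -/
theorem exists_phi01_expansion : ∃ a b : ℕ → ℂ,
    (∀ τ : ℍ, HasSum (fun m : ℕ => a m * cexp (2 * π * I * m * τ)) (phiCoeff0 τ)) ∧
    (∀ τ : ℍ, HasSum (fun m : ℕ => b m * cexp (2 * π * I * m * τ)) (phiCoeff1 τ)) := by
  obtain ⟨c, hc⟩ := exists_tendsto_phi01_half
  obtain ⟨a, ha, -⟩ := exists_qExpansion phiCoeff0_T_smul mdifferentiable_phiCoeff0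
    (isBoundedAtImInfty_of_tendsto (tendsto_phiCoeff0 hc))
  obtain ⟨b, hb, -⟩ := exists_qExpansion phiCoeff1_T_smul mdifferentiable_phiCoeff1
    (isBoundedAtImInfty_of_tendsto (tendsto_phiCoeff1 hc))
  exact ⟨a, b, ha, hb⟩

/-- The leading term of `φ_{0,1}` along `z = -τ/2`. -/
theorem exists_tendsto_phi01_neg_half : ∃ c : ℂ, c ≠ 0 ∧
    Tendsto (fun τ : ℍ => ModularForm.eta τ ^ 6 * (cexp (π * I * τ / 2) * phi01 τ (-τ / 2)))
      atImInfty (𝓝 c) := by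
  obtain ⟨c, hc⟩ := exists_tendsto_phi01_half
  refine ⟨(12 - c) / (2 * 2), div_ne_zero (sub_ne_zero.mpr (tendsto_phi01_half_ne hc).symm)
    (by norm_num), ?_⟩
  have h := (tendsto_eta_div.pow 6).mul ((((tendsto_cexp_atImInfty (a := 1 / 4)
    (by norm_num)).mul (tendsto_phiCoeff0 hc)).mul tendsto_th1_zero).add
      ((tendsto_phiCoeff1 hc).mul tendsto_th0))
  simp only [zero_mul, one_pow, one_mul, zero_add, mul_one] at h
  refine h.congr fun τ => ?_
  -- The points τ/2 and -τ/2 differ by a period, and the automorphy factor there is 1.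
  have hneg : phi01 τ (-τ / 2) = phi01 τ (τ / 2) := by
    have h := phi01_add_lattice τ (τ / 2) (-1) 0
    rw [show (τ / 2 + ((-1 : ℤ) : ℂ) * τ + ((0 : ℤ) : ℂ) : ℂ) = -τ / 2 by push_cast; ring] at h
    rw [h]
    push_cast
    rw [show -(2 * π * I * ((-1) ^ 2 * τ + 2 * (-1) * (τ / 2))) = (0 : ℂ) by ring,
      Complex.exp_zero, one_mul]
  rw [hneg, phi01_half_period, mul_pow, ← Complex.exp_nat_mul]
  have e1 : cexp (2 * π * I * (1 / 4 : ℝ) * τ) = cexp (π * I * τ / 2) := by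
    congr 1
    push_cast
    ring
  have e2 : cexp ((6 : ℕ) * -(2 * π * I * τ / 24)) = (cexp (π * I * τ / 2))⁻¹ := by
    rw [← Complex.exp_neg]
    congr 1
    push_cast
    ring
  have := Complex.exp_ne_zero (π * I * τ / 2)
  rw [e1, e2, Complex.exp_neg]
  field_simp

/-- Joint holomorphy is read off the theta decomposition, whose coefficients depend on τ alone; the
double series is needed only at fixed z. -/
theorem differentiableOn_phi01 :
    DifferentiableOn ℂ (fun p : ℂ × ℂ => phi01 (ofComplex p.1) p.2) {p | 0 < p.1.im} := by
  have h0 : DifferentiableOn ℂ (fun p : ℂ × ℂ => phiCoeff0 (ofComplex p.1)) {p | 0 < p.1.im} :=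
    (UpperHalfPlane.mdifferentiable_iff.mp mdifferentiable_phiCoeff0).comp (f := Prod.fst)
      differentiableOn_fst fun _ h => h
  have h1 : DifferentiableOn ℂ (fun p : ℂ × ℂ => phiCoeff1 (ofComplex p.1)) {p | 0 < p.1.im} :=
    (UpperHalfPlane.mdifferentiable_iff.mp mdifferentiable_phiCoeff1).comp (f := Prod.fst)
      differentiableOn_fst fun _ h => h
  have h2 : DifferentiableOn ℂ (fun p : ℂ × ℂ => cexp (-(π * I * p.1 / 2))) {p | 0 < p.1.im} := by
    fun_prop
  refine ((h0.mul differentiableOn_th0).add ((h2.mul h1).mul differentiableOn_th1)).congr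
    fun p hp => ?_
  simp only [phi01_decomp, Pi.add_apply, Pi.mul_apply]
  rw [UpperHalfPlane.ofComplex_apply_of_im_pos hp]

/-! ### Fourier expansions as sums over families -/

/-- `φ(τ, z) = ∑ c_i exp (2πi (n_i τ + ∑ u_{ij} z_j))`, where `c_i ≠ 0` implies `P n_i u_i`. -/
def HasExpansion {N : ℕ} (φ : ℍ → (Fin N → ℂ) → ℂ) (P : ℚ → (Fin N → ℚ) → Prop) : Prop :=
  ∃ (ι : Type) (c : ι → ℂ) (n : ι → ℚ) (u : ι → Fin N → ℚ), (∀ i, c i ≠ 0 → P (n i) (u i)) ∧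
    ∀ (τ : ℍ) (z : Fin N → ℂ),
      HasSum (fun i => c i * cexp (2 * π * I * (n i * τ + ∑ j, u i j * z j))) (φ τ z)

/-- The same notion in one variable. -/
def HasExpansionOne (φ : ℍ → ℂ → ℂ) (P : ℚ → ℚ → Prop) : Prop :=
  ∃ (ι : Type) (c : ι → ℂ) (n : ι → ℚ) (u : ι → ℚ), (∀ i, c i ≠ 0 → P (n i) (u i)) ∧
    ∀ (τ : ℍ) (z : ℂ), HasSum (fun i => c i * cexp (2 * π * I * (n i * τ + u i * z))) (φ τ z)

theorem hasSum_mul_complex {ι κ : Type*} {f : ι → ℂ} {g : κ → ℂ} {a b : ℂ} (hf : HasSum f a)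
    (hg : HasSum g b) : HasSum (fun x : ι × κ => f x.1 * g x.2) (a * b) :=
  hf.mul hg (summable_mul_of_summable_norm hf.summable.norm hg.summable.norm)

theorem HasExpansion.mul {N : ℕ} {φ ψ : ℍ → (Fin N → ℂ) → ℂ} {P Q R : ℚ → (Fin N → ℚ) → Prop}
    (hφ : HasExpansion φ P) (hψ : HasExpansion ψ Q)
    (h : ∀ n u n' u', P n u → Q n' u' → R (n + n') (u + u')) :
    HasExpansion (fun τ z => φ τ z * ψ τ z) R := by
  obtain ⟨ι, c, n, u, hP, hs⟩ := hφ
  obtain ⟨κ, c', n', u', hQ, hs'⟩ := hψ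
  refine ⟨ι × κ, fun i => c i.1 * c' i.2, fun i => n i.1 + n' i.2, fun i => u i.1 + u' i.2,
    fun i hi => h _ _ _ _ (hP _ (left_ne_zero_of_mul hi)) (hQ _ (right_ne_zero_of_mul hi)),
    fun τ z => (hasSum_mul_complex (hs τ z) (hs' τ z)).congr_fun fun i => ?_⟩
  rw [mul_mul_mul_comm, ← Complex.exp_add]
  congr 2
  simp only [Pi.add_apply, Rat.cast_add, add_mul, Finset.sum_add_distrib]
  ring

theorem HasExpansion.mul_last {N : ℕ} {φ : ℍ → (Fin N → ℂ) → ℂ} {g : ℍ → ℂ → ℂ}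
    {P : ℚ → (Fin N → ℚ) → Prop} {Q : ℚ → ℚ → Prop} {R : ℚ → (Fin (N + 1) → ℚ) → Prop}
    (hφ : HasExpansion φ P) (hg : HasExpansionOne g Q)
    (h : ∀ n u n' u', P n u → Q n' u' → R (n + n') (Fin.snoc u u')) :
    HasExpansion (fun τ z => g τ (z (Fin.last N)) * φ τ (Fin.init z)) R := by
  obtain ⟨ι, c, n, u, hP, hs⟩ := hφ
  obtain ⟨κ, c', n', u', hQ, hs'⟩ := hg
  refine ⟨κ × ι, fun i => c' i.1 * c i.2, fun i => n i.2 + n' i.1,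
    fun i => Fin.snoc (u i.2) (u' i.1),
    fun i hi => h _ _ _ _ (hP _ (right_ne_zero_of_mul hi)) (hQ _ (left_ne_zero_of_mul hi)),
    fun τ z => (hasSum_mul_complex (hs' τ _) (hs τ _)).congr_fun fun i => ?_⟩
  rw [mul_mul_mul_comm, ← Complex.exp_add]
  congr 2
  simp only [Fin.sum_univ_castSucc, Fin.snoc_castSucc, Fin.snoc_last, Fin.init, Rat.cast_add]
  ring

theorem HasExpansion.congr {N : ℕ} {φ ψ : ℍ → (Fin N → ℂ) → ℂ} {P Q : ℚ → (Fin N → ℚ) → Prop}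
    (hφ : HasExpansion φ P) (h : ∀ τ z, φ τ z = ψ τ z) (hPQ : ∀ n u, P n u → Q n u) :
    HasExpansion ψ Q := by
  obtain ⟨ι, c, n, u, hP, hs⟩ := hφ
  exact ⟨ι, c, n, u, fun i hi => hPQ _ _ (hP i hi), fun τ z => by rw [← h]; exact hs τ z⟩

theorem HasExpansion.hasFourierExpansion {N : ℕ} {φ : ℍ → (Fin N → ℂ) → ℂ}
    {P : ℚ → (Fin N → ℚ) → Prop} (hφ : HasExpansion φ P) (L : EvenLattice N) (D : ℕ)
    {Q : ℚ → ℚ → Prop} (h : ∀ n l, P n (fun j => L.scale * l j) →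
      (∃ m : ℤ, n = (D : ℚ) / 24 + m) ∧ L.InDual (2 • l) ∧ Q n (form L.scale l l)) :
    HasFourierExpansion L φ Q := by
  obtain ⟨ι, c, n, u, hP, hs⟩ := hφ
  have hscale : (L.scale : ℚ) ≠ 0 := by exact_mod_cast L.scale_pos.ne'
  let p : ι → ℚ × (Fin N → ℚ) := fun i => (n i, fun j => u i j / L.scale)
  -- Terms with equal exponents are collected into one coefficient. If the coefficient is nonzero,
  -- some term in its fibre is, and the support condition follows from that term.
  refine ⟨D, fun q => ∑' i : p ⁻¹' {q}, c i, fun m l hne => ?_, fun τ z => ?_⟩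
  · obtain ⟨⟨i, hi⟩, hci⟩ : ∃ i : p ⁻¹' {(m, l)}, c i ≠ 0 := by
      by_contra! hall
      exact hne (by simp [hall])
    obtain ⟨h1, h2⟩ := Prod.ext_iff.mp (Set.mem_singleton_iff.mp hi)
    simp only [p] at h1 h2
    refine h m l ?_
    have := hP i hci
    rw [h1] at this
    convert this using 1
    funext j
    rw [← h2]
    field_simp
  · refine ((hs τ z).tsum_fiberwise p).congr_fun fun q => ?_
    rw [← tsum_mul_right]
    refine tsum_congr fun ⟨i, hi⟩ => ?_
    have hi' : p i = q := hi
    subst hi'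
    have hs : (L.scale : ℂ) ≠ 0 := by exact_mod_cast L.scale_pos.ne'
    have hform : form L.scale (fun j => ((p i).2 j : ℂ)) z = ∑ j, u i j * z j := by
      simp only [p, form, Finset.mul_sum]
      refine Finset.sum_congr rfl fun j _ => ?_
      push_cast
      field_simp
    rw [hform]

/-- Cusp forms vanish at the cusp along all torsion points. -/
theorem IsJacobiCuspForm.tendsto_zero {N : ℕ} {L : EvenLattice N} {k : ℚ} {v : SL(2, ℤ) → ℂ}
    {ν : Heisenberg L → ℂ} {φ : ℍ → (Fin N → ℂ) → ℂ} (hφ : IsJacobiCuspForm L k 1 v ν φ)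
    (l₀ : Fin N → ℚ) :
    Tendsto (fun τ : ℍ => cexp (2 * π * I * ((form L.scale l₀ l₀ / 2 : ℚ) : ℂ) * τ) *
      φ τ (fun j => l₀ j * τ)) atImInfty (𝓝 0) := by
  obtain ⟨D, f, hf, hs⟩ := hφ.2
  -- Twice this exponent is (2n - (l, l)) + (l + l₀, l + l₀), which is positive on the support of a
  -- cusp form.
  let e : ℚ × (Fin N → ℚ) → ℚ := fun p => p.1 + form L.scale p.2 l₀ + form L.scale l₀ l₀ / 2
  have hpos (p : ℚ × (Fin N → ℚ)) (hp : f p ≠ 0) : 0 < e p := by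
    obtain ⟨-, -, -, h⟩ := hf p.1 p.2 hp
    have hsq : (0 : ℚ) ≤ form L.scale (p.2 + l₀) (p.2 + l₀) :=
      mul_nonneg (Nat.cast_nonneg _) (Finset.sum_nonneg fun j _ => mul_self_nonneg _)
    have hexp : form L.scale (p.2 + l₀) (p.2 + l₀) =
        form L.scale p.2 p.2 + 2 * form L.scale p.2 l₀ + form L.scale l₀ l₀ := by
      simp only [form, Finset.mul_sum, ← Finset.sum_add_distrib]
      refine Finset.sum_congr rfl fun j _ => ?_
      simp only [Pi.add_apply]
      ring
    simp only [e]
    linarith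
  have hterm (τ : ℍ) : HasSum (fun p => f p * cexp (2 * π * I * (e p : ℝ) * τ))
      (cexp (2 * π * I * ((form L.scale l₀ l₀ / 2 : ℚ) : ℂ) * τ) * φ τ (fun j => l₀ j * τ)) := by
    refine ((hs τ fun j => l₀ j * τ).mul_left _).congr_fun fun p => ?_
    rw [mul_left_comm, ← Complex.exp_add]
    congr 2
    have : (form L.scale (fun i => (p.2 i : ℂ)) fun j => (l₀ j : ℂ) * τ) =
        ((form L.scale p.2 l₀ : ℚ) : ℂ) * τ := by
      simp only [form]
      push_cast
      rw [mul_assoc, Finset.sum_mul]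
      congr 1
      exact Finset.sum_congr rfl fun j _ => by ring
    rw [this]
    simp only [e]
    push_cast
    ring
  have hlim := tendsto_tsum_atImInfty f (fun p => (e p : ℝ))
    (fun p hp => by exact_mod_cast (hpos p hp).le) ?_
  · refine (hlim.congr fun τ => (hterm τ).tsum_eq).trans (le_of_eq ?_)
    congr 1
    refine (tsum_congr fun p => ?_).trans tsum_zero
    split_ifs with h
    · by_contra hne
      exact (hpos p hne).ne' (by exact_mod_cast h)
    · rfl
  · refine (hterm UpperHalfPlane.I).summable.norm.congr fun p => ?_
    rw [norm_mul, norm_cexp_two_pi_mul]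
    simp

/-! ### Expansions of the building blocks -/

theorem exists_eta_expansion (m : ℕ) : ∃ a : ℕ → ℂ, ∀ τ : ℍ,
    HasSum (fun k : ℕ => a k * cexp (2 * π * I * (((m / 24 + k : ℚ) : ℂ) * τ)))
      (ModularForm.eta τ ^ m) := by
  have hT (τ : ℍ) : (cexp (-(2 * π * I * (T • τ : ℍ) / 24)) * ModularForm.eta (T • τ : ℍ)) ^ m =
      (cexp (-(2 * π * I * τ / 24)) * ModularForm.eta τ) ^ m := by
    rw [eta_T_smul, ← mul_assoc, ← Complex.exp_add, coe_T_smul]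
    congr 3
    ring
  have hol : MDiff fun τ : ℍ => (cexp (-(2 * π * I * τ / 24)) * ModularForm.eta τ) ^ m := by
    have h : MDiff fun τ : ℍ => cexp (-(2 * π * I * τ / 24)) := by
      convert mdifferentiable_cexp_mul (-(2 * π * I / 24)) using 3
      ring
    exact (h.mul mdifferentiable_eta).pow m
  obtain ⟨a, ha, -⟩ := exists_qExpansion hT hol
    (isBoundedAtImInfty_of_tendsto (tendsto_eta_div.pow m))
  refine ⟨a, fun τ => ?_⟩
  have h := (ha τ).mul_left (cexp (2 * π * I * τ / 24) ^ m)
  rw [← mul_pow, ← mul_assoc, ← Complex.exp_add, add_neg_cancel, Complex.exp_zero, one_mul] at h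
  refine h.congr_fun fun k => ?_
  rw [← Complex.exp_nat_mul, mul_left_comm (cexp _) (a k), ← Complex.exp_add]
  congr 2
  push_cast
  ring

theorem hasExpansionOne_theta :
    HasExpansionOne theta fun n u => (∃ a : ℤ, u = a + 1 / 2) ∧ 2 * n = u ^ 2 := by
  refine ⟨ℤ, fun m => cexp (π * I * m), fun m => (2 * m + 1) ^ 2 / 8, fun m => (2 * m + 1) / 2,
    fun m _ => ⟨⟨m, by ring⟩, by ring⟩, fun τ z => (hasSum_theta τ z).congr_fun fun m => ?_⟩
  push_cast
  rfl

theorem mul_cexp_of_eq_add (a : ℂ) {b c d : ℂ} (h : d = b + c) :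
    a * cexp d = a * cexp b * cexp c := by
  rw [h, Complex.exp_add, mul_assoc]

/-- The `th0` part has norms 2m ≥ 0; in the `th1` part q^{-1/4} q^{(l+1/2)²} = q^{l²+l}, so the
norms are 2m - 1/2. -/
theorem hasExpansionOne_phi01 : HasExpansionOne phi01 fun n u =>
    (∃ a : ℤ, n = a) ∧ (∃ b : ℤ, u = b) ∧ -(1 / 2) ≤ 2 * n - u ^ 2 / 2 := by
  obtain ⟨a, b, ha, hb⟩ := exists_phi01_expansion
  refine ⟨(ℕ × ℤ) ⊕ (ℕ × ℤ), Sum.elim (fun i => a i.1) (fun i => b i.1),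
    Sum.elim (fun i => i.1 + i.2 ^ 2) (fun i => i.1 + i.2 ^ 2 + i.2),
    Sum.elim (fun i => 2 * i.2) (fun i => 2 * i.2 + 1), ?_, fun τ z => ?_⟩
  · rintro (⟨m, l⟩ | ⟨m, l⟩) -
    · refine ⟨⟨m + l ^ 2, by simp⟩, ⟨2 * l, by simp⟩, ?_⟩
      simp only [Sum.elim_inl]
      have : (0 : ℚ) ≤ m := Nat.cast_nonneg m
      linarith
    · refine ⟨⟨m + l ^ 2 + l, by simp⟩, ⟨2 * l + 1, by simp⟩, ?_⟩
      simp only [Sum.elim_inr]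
      have : (0 : ℚ) ≤ m := Nat.cast_nonneg m
      linarith
  · rw [phi01_decomp]
    refine HasSum.sum ?_ ?_
    · refine (hasSum_mul_complex (ha τ) (hasSum_th0 τ z)).congr_fun fun i => ?_
      simp only [Function.comp_apply, Sum.elim_inl]
      refine mul_cexp_of_eq_add _ ?_
      push_cast
      ring
    · refine (hasSum_mul_complex ((hb τ).mul_left _) (hasSum_th1 τ z)).congr_fun fun i => ?_
      simp only [Function.comp_apply, Sum.elim_inr]
      rw [mul_left_comm, ← Complex.exp_add]
      refine mul_cexp_of_eq_add _ ?_
      push_cast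
      ring

/-- The exponents in the expansion of `η^m ϑ_{D_N}`. -/
def ThetaSupport (m N : ℕ) (n : ℚ) (u : Fin N → ℚ) : Prop :=
  (∃ k : ℤ, n = ((m + 3 * N : ℕ) : ℚ) / 24 + k) ∧ (∀ j, ∃ a : ℤ, u j = a + 1 / 2) ∧
    (m : ℚ) / 12 ≤ 2 * n - ∑ j, u j ^ 2

theorem hasExpansion_eta_mul_thetaD (m N : ℕ) :
    HasExpansion (fun τ z => ModularForm.eta τ ^ m * thetaD N τ z) (ThetaSupport m N) := by
  induction N with
  | zero =>
    obtain ⟨a, ha⟩ := exists_eta_expansion m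
    refine ⟨ℕ, a, fun k => m / 24 + k, fun _ => 0, fun k _ => ⟨⟨k, by simp⟩, by simp, ?_⟩,
      fun τ z => ?_⟩
    · have : (0 : ℚ) ≤ k := Nat.cast_nonneg k
      simp only [Finset.univ_eq_empty, Finset.sum_empty]
      linarith
    · simpa [thetaD] using ha τ
  | succ N ih =>
    refine (ih.mul_last (R := ThetaSupport m (N + 1)) hasExpansionOne_theta ?_).congr
      (fun τ z => ?_) fun _ _ h => h
    · rintro n u n' u' ⟨⟨k, hk⟩, hu, hn⟩ ⟨⟨a, ha⟩, hn'⟩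
      -- An odd square is 1 plus eight times a triangular number; each theta factor thus adds 1/8 =
      -- 3/24 to the class of n modulo 1.
      have h8 : n' = 1 / 8 + ((a * (a + 1) / 2 : ℤ) : ℚ) := by
        obtain ⟨b, hb⟩ := Int.even_mul_succ_self a
        have : a * (a + 1) / 2 = b := by omega
        rw [this]
        have hb' : (a : ℚ) * (a + 1) = b + b := by exact_mod_cast hb
        rw [ha] at hn'
        linear_combination hn' / 2 + hb' / 2
      refine ⟨⟨k + a * (a + 1) / 2, ?_⟩, fun j => ?_, ?_⟩
      · rw [hk, h8]
        push_cast
        ring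
      · refine Fin.lastCases ?_ (fun j => ?_) j
        · rw [Fin.snoc_last]
          exact ⟨a, ha⟩
        · rw [Fin.snoc_castSucc]
          exact hu j
      · rw [Fin.sum_univ_castSucc]
        simp only [Fin.snoc_castSucc, Fin.snoc_last]
        linarith
    · simp only [thetaD, Fin.prod_univ_castSucc, Fin.init]
      ring

theorem psi_eq {N : ℕ} (hN : N ≤ 8) (τ : ℍ) (z : Fin N → ℂ) :
    psi N τ z = ModularForm.eta τ ^ (24 - 3 * N) * thetaD N τ z := by
  rw [psi, ← zpow_natCast]
  congr 2
  omega

theorem hasExpansion_psi {N : ℕ} (hN : N ≤ 8) :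
    HasExpansion (psi N) (ThetaSupport (24 - 3 * N) N) :=
  (hasExpansion_eta_mul_thetaD _ N).congr (fun τ z => (psi_eq hN τ z).symm) fun _ _ h => h

/-- The exponents in the expansion of `φ_{k, D_N(2)}`. -/
def TowerSupport (N : ℕ) (n : ℚ) (u : Fin N → ℚ) : Prop :=
  (∃ k : ℤ, n = k) ∧ (∀ j, ∃ a : ℤ, u j = a) ∧
    4 - (N : ℚ) / 2 ≤ 2 * n - (∑ j, u j ^ 2) / 2

theorem hasExpansion_psi_sq {N : ℕ} (hN : N ≤ 8) :
    HasExpansion (fun τ z => psi N τ z ^ 2) (TowerSupport N) := by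
  have hm : ((24 - 3 * N + 3 * N : ℕ) : ℚ) = 24 := by
    rw [Nat.sub_add_cancel (by omega)]
    norm_num
  have hm' : ((24 - 3 * N : ℕ) : ℚ) = 24 - 3 * N := by
    rw [Nat.cast_sub (by omega)]
    push_cast
    rfl
  refine ((hasExpansion_psi hN).mul (R := TowerSupport N) (hasExpansion_psi hN) ?_).congr
    (fun τ z => (sq _).symm) fun _ _ h => h
  rintro n u n' u' ⟨⟨k, hk⟩, hu, hn⟩ ⟨⟨k', hk'⟩, hu', hn'⟩
  refine ⟨⟨k + k' + 2, ?_⟩, fun j => ?_, ?_⟩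
  · rw [hk, hk', hm]
    push_cast
    ring
  · obtain ⟨a, ha⟩ := hu j
    obtain ⟨b, hb⟩ := hu' j
    refine ⟨a + b + 1, ?_⟩
    rw [Pi.add_apply, ha, hb]
    push_cast
    ring
  -- By the parallelogram inequality, norms at least add up for a product measured in the doubled
  -- form; this gives twice 2 - N/4.
  · have hsum : (∑ j, (u + u') j ^ 2) / 2 ≤ ∑ j, u j ^ 2 + ∑ j, u' j ^ 2 := by
      rw [Finset.sum_div, ← Finset.sum_add_distrib]
      refine Finset.sum_le_sum fun j _ => ?_
      simp only [Pi.add_apply]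
      nlinarith [sq_nonneg (u j - u' j)]
    rw [hm'] at hn hn'
    linarith

/-- The factor φ_{0,1} costs at most 1/2 in norm, exactly the drop of 4 - N/2 as N grows by one. -/
theorem HasExpansion.timesPhi01 {N : ℕ} {φ : ℍ → (Fin N → ℂ) → ℂ}
    (h : HasExpansion φ (TowerSupport N)) :
    HasExpansion (timesPhi01 φ) (TowerSupport (N + 1)) := by
  refine h.mul_last hasExpansionOne_phi01 ?_
  rintro n u n' u' ⟨⟨k, rfl⟩, hu, hn⟩ ⟨⟨k', rfl⟩, hu', hn'⟩
  refine ⟨⟨k + k', by push_cast; rfl⟩, fun j => ?_, ?_⟩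
  · refine Fin.lastCases ?_ (fun j => ?_) j
    · simpa using hu'
    · simpa using hu j
  · rw [Fin.sum_univ_castSucc]
    simp only [Fin.snoc_castSucc, Fin.snoc_last]
    push_cast
    linarith

/-! ### Criteria for Jacobi forms -/

theorem form_div {N : ℕ} (s : ℕ) (z : Fin N → ℂ) (w : ℂ) :
    form s z z / w = ∑ j, s * z j ^ 2 / w := by
  simp only [form, Finset.mul_sum, Finset.sum_div]
  exact Finset.sum_congr rfl fun j _ => by ring

theorem slashHeisenberg_eq {N : ℕ} {L : EvenLattice N} {φ : ℍ → (Fin N → ℂ) → ℂ}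
    (h : Heisenberg L) (τ : ℍ) (z : Fin N → ℂ)
    (hφ : φ τ (fun i => z i + h.x i * τ + h.y i) =
      cexp (-(π * I * ((form L.scale (fun i => (h.x i : ℂ)) fun i => (h.x i : ℂ)) * τ +
        2 * form L.scale (fun i => (h.x i : ℂ)) z))) * φ τ z) :
    slashHeisenberg L 1 φ h τ z = φ τ z := by
  obtain ⟨m, hm⟩ := h.integral
  have hm' : (h.r : ℂ) + ((form L.scale h.x h.y : ℤ) : ℂ) / 2 = m := by
    have := congrArg (fun q : ℚ => (q : ℂ)) hm
    push_cast at this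
    exact this
  have hxx : ((form L.scale h.x h.x : ℤ) : ℂ) =
      form L.scale (fun i => (h.x i : ℂ)) fun i => (h.x i : ℂ) := by
    simp [form]
  rw [slashHeisenberg, hφ, ← mul_assoc, ← Complex.exp_add, hxx]
  -- What remains of the exponent is 2πi(r + (x, y)/2), and the integrality condition of the
  -- Heisenberg group makes this trivial.
  have he : cexp (m * (2 * π * I)) = 1 := Complex.exp_int_mul_two_pi_mul_I m
  have : ∀ w, w = (m : ℂ) * (2 * π * I) → cexp w * φ τ z = φ τ z := by
    rintro w rfl
    rw [he, one_mul]
  refine this _ ?_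
  rw [← hm']
  push_cast
  ring

theorem slashSL_eq {N : ℕ} {L : EvenLattice N} {φ : ℍ → (Fin N → ℂ) → ℂ} {k : ℚ} {A : SL(2, ℤ)}
    {τ : ℍ} {z : Fin N → ℂ} {w : ℂ}
    (hφ : φ (A • τ) (fun i => z i / jac A τ) =
      jac A τ ^ (k : ℂ) * cexp (π * I * ((A 1 0 : ℂ) * (form L.scale z z / jac A τ))) * w) :
    slashSL L k 1 φ A τ z = w := by
  change jac A τ ^ (-(k : ℂ)) * cexp (-(π * I * ((1 : ℚ) : ℂ) *
    ((A 1 0 : ℂ) * form L.scale z z / jac A τ))) * φ (A • τ) (fun i => z i / jac A τ) = w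
  rw [hφ, Complex.cpow_neg, Complex.exp_neg, Rat.cast_one, mul_one, mul_div_assoc]
  have h1 : jac A τ ^ (k : ℂ) ≠ 0 := by simp [Complex.cpow_eq_zero_iff, jac_ne_zero]
  have h2 := Complex.exp_ne_zero (π * I * ((A 1 0 : ℂ) * (form L.scale z z / jac A τ)))
  field_simp

theorem transforms_of_natural_weight {N : ℕ} {L : EvenLattice N} {φ : ℍ → (Fin N → ℂ) → ℂ} {k : ℕ}
    (hol : IsHolomorphic φ)
    (hmod : ∀ A (τ : ℍ) z, φ (A • τ) (fun i => z i / jac A τ) =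
      jac A τ ^ k * cexp (π * I * ((A 1 0 : ℂ) * (form L.scale z z / jac A τ))) * φ τ z)
    (hell : ∀ x ∈ L.carrier, ∀ y ∈ L.carrier, ∀ (τ : ℍ) (z : Fin N → ℂ),
      φ τ (fun i => z i + x i * τ + y i) =
        cexp (-(π * I * ((form L.scale (fun i => (x i : ℂ)) fun i => (x i : ℂ)) * τ +
          2 * form L.scale (fun i => (x i : ℂ)) z))) * φ τ z) :
    Transforms L k 1 1 1 φ where
  holomorphic := hol
  modular A τ z := by
    refine slashSL_eq ?_
    rw [hmod, Rat.cast_natCast, Complex.cpow_natCast, Pi.one_apply, one_mul]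
  elliptic h τ z := by
    rw [slashHeisenberg_eq h τ z (hell _ h.x_mem _ h.y_mem τ z), Pi.one_apply, one_mul]

theorem EvenLattice.inDual_of_int {N : ℕ} (L : EvenLattice N) {l : Fin N → ℚ}
    (h : ∀ j, ∃ a : ℤ, l j = a) : L.InDual l := by
  choose a ha using h
  refine fun x _ => ⟨form L.scale a x, ?_⟩
  simp [form, ha]

/-! ### Theta products -/

theorem isHolomorphic_thetaD (N : ℕ) : IsHolomorphic (thetaD N) := by
  have h (j : Fin N) : DifferentiableOn ℂ
      (fun p : ℂ × (Fin N → ℂ) => theta (ofComplex p.1) (p.2 j)) {p | 0 < p.1.im} :=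
    differentiableOn_theta.comp (f := fun p : ℂ × (Fin N → ℂ) => (p.1, p.2 j)) (by fun_prop)
      fun _ h => h
  change DifferentiableOn ℂ (fun p : ℂ × (Fin N → ℂ) => ∏ j, theta (ofComplex p.1) (p.2 j)) _
  induction (Finset.univ : Finset (Fin N)) using Finset.induction_on with
  | empty => simp
  | insert a s ha ih =>
    simp only [Finset.prod_insert ha]
    exact (h a).mul ih

theorem thetaD_smul {N : ℕ} (A : SL(2, ℤ)) (τ : ℍ) (z : Fin N → ℂ) :
    thetaD N (A • τ) (fun i => z i / jac A τ) =
      vEta A ^ (3 * N) * (jac A τ ^ (1 / 2 : ℂ)) ^ N *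
        cexp (π * I * ((A 1 0 : ℂ) * (form 1 z z / jac A τ))) * thetaD N τ z := by
  have e : π * I * ((A 1 0 : ℂ) * (form 1 z z / jac A τ)) =
      ∑ j, π * I * (A 1 0 : ℂ) * z j ^ 2 / jac A τ := by
    rw [form_div, Finset.mul_sum, Finset.mul_sum]
    refine Finset.sum_congr rfl fun j _ => ?_
    push_cast
    ring
  rw [e, Complex.exp_sum]
  simp only [thetaD, theta_smul, Finset.prod_mul_distrib, Finset.prod_const, Finset.card_univ,
    Fintype.card_fin, pow_mul]

theorem thetaD_add_lattice {N : ℕ} (x y : Fin N → ℤ) (τ : ℍ) (z : Fin N → ℂ) :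
    thetaD N τ (fun i => z i + x i * τ + y i) =
      cexp (π * I * (∑ j, (x j + y j) : ℤ)) *
      cexp (-(π * I * ((form 1 (fun i => (x i : ℂ)) fun i => (x i : ℂ)) * τ +
        2 * form 1 (fun i => (x i : ℂ)) z))) * thetaD N τ z := by
  simp only [thetaD, theta_add_lattice, Finset.prod_mul_distrib, ← Complex.exp_sum]
  congr 3
  · push_cast
    rw [Finset.mul_sum]
  · simp only [form, Nat.cast_one, one_mul, Finset.sum_mul, Finset.mul_sum,
      ← Finset.sum_add_distrib, ← Finset.sum_neg_distrib]
    exact Finset.sum_congr rfl fun j _ => by ring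

theorem cexp_pi_mul_I_of_even {m : ℤ} (hm : Even m) : cexp (π * I * m) = 1 := by
  obtain ⟨n, rfl⟩ := hm
  rw [show (π * I * ((n + n : ℤ) : ℂ) : ℂ) = n * (2 * π * I) by push_cast; ring]
  exact Complex.exp_int_mul_two_pi_mul_I n

theorem thetaD_add_latticeD {N : ℕ} {x y : Fin N → ℤ} (hx : x ∈ (latticeD N).carrier)
    (hy : y ∈ (latticeD N).carrier) (τ : ℍ) (z : Fin N → ℂ) :
    thetaD N τ (fun i => z i + x i * τ + y i) =
      cexp (-(π * I * ((form 1 (fun i => (x i : ℂ)) fun i => (x i : ℂ)) * τ +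
        2 * form 1 (fun i => (x i : ℂ)) z))) * thetaD N τ z := by
  have hx' : Even (∑ j, x j) := hx
  have hy' : Even (∑ j, y j) := hy
  rw [thetaD_add_lattice, cexp_pi_mul_I_of_even, one_mul]
  rw [Finset.sum_add_distrib]
  exact hx'.add hy'

theorem ThetaSupport.property {m N : ℕ} {D : ℕ} {n : ℚ} {l : Fin N → ℚ}
    (h : ThetaSupport m N n (fun j => (latticeD N).scale * l j)) (hD : m + 3 * N = D) :
    (∃ k : ℤ, n = (D : ℚ) / 24 + k) ∧ (latticeD N).InDual (2 • l) ∧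
      (0 ≤ n ∧ (m : ℚ) / 12 ≤ 2 * n * 1 - form (latticeD N).scale l l) := by
  obtain ⟨hk, hu, hn⟩ := h
  have hscale : (((latticeD N).scale : ℕ) : ℚ) = 1 := Nat.cast_one
  simp only [hscale, one_mul] at hu hn
  rw [hD] at hk
  refine ⟨hk, EvenLattice.inDual_of_int _ fun j => ?_, ?_, ?_⟩
  · obtain ⟨a, ha⟩ := hu j
    refine ⟨2 * a + 1, ?_⟩
    rw [Pi.smul_apply, ha, nsmul_eq_mul]
    push_cast
    ring
  · have h1 : (0 : ℚ) ≤ m / 12 := by positivity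
    have h2 : 0 ≤ ∑ j, l j ^ 2 := Finset.sum_nonneg fun j _ => sq_nonneg _
    linarith
  · rw [form, hscale, one_mul, mul_one]
    simpa only [sq] using hn

theorem isJacobiForm_thetaD (N : ℕ) :
    IsJacobiForm (latticeD N) ((N : ℚ) / 2) 1 (fun A => vEta A ^ (3 * N)) 1 (thetaD N) := by
  refine ⟨⟨isHolomorphic_thetaD N, fun A τ z => slashSL_eq ?_, fun h τ z => ?_⟩, ?_⟩
  · rw [thetaD_smul, show (((N : ℚ) / 2 : ℚ) : ℂ) = N * (1 / 2) by push_cast; ring,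
      Complex.cpow_nat_mul]
    change _ = _ * cexp (π * I * ((A 1 0 : ℂ) * (form 1 z z / jac A τ))) * _
    ring
  · rw [slashHeisenberg_eq h τ z (thetaD_add_latticeD h.x_mem h.y_mem τ z), Pi.one_apply, one_mul]
  · refine ((hasExpansion_eta_mul_thetaD 0 N).congr (Q := ThetaSupport 0 N) (fun τ z => ?_)
      fun _ _ h => h).hasFourierExpansion _ (3 * N) fun n l h => ?_
    · rw [pow_zero, one_mul]
    · obtain ⟨h1, h2, h3, h4⟩ := h.property (zero_add _)
      exact ⟨h1, h2, h3, by simpa using h4⟩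

/-! ### The forms `ψ_{12-N, D_N}` -/

theorem differentiableOn_eta_fst {N : ℕ} :
    DifferentiableOn ℂ (fun p : ℂ × (Fin N → ℂ) => ModularForm.eta (ofComplex p.1))
      {p | 0 < p.1.im} :=
  (UpperHalfPlane.mdifferentiable_iff.mp mdifferentiable_eta).comp (f := Prod.fst)
    differentiableOn_fst fun _ h => h

theorem isHolomorphic_psi {N : ℕ} (hN : N ≤ 8) : IsHolomorphic (psi N) :=
  ((differentiableOn_eta_fst.pow (24 - 3 * N)).mul (isHolomorphic_thetaD N)).congr
    fun _ _ => psi_eq hN _ _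

theorem vEta_pow (A : SL(2, ℤ)) : vEta A ^ 24 = 1 := by
  have h := eta_pow_smul A UpperHalfPlane.I
  have h0 := pow_ne_zero 24 (eta_ne_zero UpperHalfPlane.I)
  have hj := pow_ne_zero 12 (jac_ne_zero A UpperHalfPlane.I)
  have h12 : (jac A UpperHalfPlane.I ^ (1 / 2 : ℂ)) ^ 24 = jac A UpperHalfPlane.I ^ 12 := by
    rw [show 24 = 2 * 12 by rfl, pow_mul, jac_sqrt_sq]
  rw [eta_smul, mul_pow, mul_pow, h12, mul_assoc] at h
  exact (mul_eq_right₀ (mul_ne_zero hj h0)).mp h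

theorem psi_smul {N : ℕ} (hN : N ≤ 8) (A : SL(2, ℤ)) (τ : ℍ) (z : Fin N → ℂ) :
    psi N (A • τ) (fun i => z i / jac A τ) = jac A τ ^ (12 - N) *
      cexp (π * I * ((A 1 0 : ℂ) * (form 1 z z / jac A τ))) * psi N τ z := by
  rw [psi_eq hN, psi_eq hN, thetaD_smul, eta_smul, mul_pow, mul_pow]
  have h1 : vEta A ^ (24 - 3 * N) * vEta A ^ (3 * N) = 1 := by
    rw [← pow_add, Nat.sub_add_cancel (by omega), vEta_pow]
  have h2 : (jac A τ ^ (1 / 2 : ℂ)) ^ (24 - 3 * N) * (jac A τ ^ (1 / 2 : ℂ)) ^ N =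
      jac A τ ^ (12 - N) := by
    rw [← pow_add, show 24 - 3 * N + N = 2 * (12 - N) by omega, pow_mul, jac_sqrt_sq]
  rw [← h2]
  linear_combination ((jac A τ ^ (1 / 2 : ℂ)) ^ (24 - 3 * N) * (jac A τ ^ (1 / 2 : ℂ)) ^ N *
    cexp (π * I * ((A 1 0 : ℂ) * (form 1 z z / jac A τ))) * ModularForm.eta τ ^ (24 - 3 * N) *
    thetaD N τ z) * h1

theorem transforms_psi {N : ℕ} (hN : N ≤ 8) :
    Transforms (latticeD N) (12 - (N : ℚ)) 1 1 1 (psi N) := by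
  have h := transforms_of_natural_weight (L := latticeD N) (k := 12 - N) (isHolomorphic_psi hN)
    (psi_smul hN) fun x hx y hy τ z => by
      rw [psi, thetaD_add_latticeD hx hy, psi, mul_left_comm]
      rfl
  rwa [Nat.cast_sub (by omega)] at h

theorem isJacobiForm_psi {N : ℕ} (hN : N ≤ 8) :
    IsJacobiForm (latticeD N) (12 - (N : ℚ)) 1 1 1 (psi N) := by
  refine ⟨transforms_psi hN, (hasExpansion_psi hN).hasFourierExpansion _ 24 fun n l h => ?_⟩
  obtain ⟨h1, h2, h3, h4⟩ := h.property (D := 24) (by omega)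
  exact ⟨h1, h2, h3, le_trans (by positivity) h4⟩

theorem isJacobiCuspForm_psi {N : ℕ} (hN : N < 8) :
    IsJacobiCuspForm (latticeD N) (12 - (N : ℚ)) 1 1 1 (psi N) := by
  refine ⟨transforms_psi hN.le, (hasExpansion_psi hN.le).hasFourierExpansion _ 24 fun n l h => ?_⟩
  obtain ⟨h1, h2, h3, h4⟩ := h.property (D := 24) (by omega)
  refine ⟨h1, h2, h3, lt_of_lt_of_le ?_ h4⟩
  have : 0 < 24 - 3 * N := by omega
  positivity

theorem tendsto_thetaD (N : ℕ) :
    Tendsto (fun τ : ℍ => cexp (π * I * τ / 4) ^ N * thetaD N τ (fun _ => -τ / 2)) atImInfty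
      (𝓝 1) := by
  have h := (tendsto_jacobiTheta₂_const (b := 1 / 2) (by simp)).pow N
  rw [one_pow] at h
  refine h.congr fun τ => ?_
  rw [thetaD, Finset.prod_const, Finset.card_univ, Fintype.card_fin, ← mul_pow, theta_neg_half,
    ← mul_assoc, ← Complex.exp_add, add_neg_cancel, Complex.exp_zero, one_mul]

theorem psi_eight : psi 8 = thetaD 8 := by
  funext τ z
  rw [psi_eq le_rfl, Nat.sub_self, pow_zero, one_mul]

/-- The vector (-1/2, …, -1/2) has norm 2 in rank 8, and q ϑ_{D_8}(τ, -τ/2, …, -τ/2) tends to 1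
instead of 0. -/
theorem not_isJacobiCuspForm_psi_eight :
    ¬ IsJacobiCuspForm (latticeD 8) (12 - ((8 : ℕ) : ℚ)) 1 1 1 (psi 8) := by
  intro h
  refine one_ne_zero (α := ℂ) (tendsto_nhds_unique (tendsto_thetaD 8)
    ((h.tendsto_zero fun _ => -1 / 2).congr fun τ => ?_))
  rw [psi_eight, ← Complex.exp_nat_mul]
  congr 2
  · have : form (latticeD 8).scale (fun _ : Fin 8 => (-1 / 2 : ℚ)) (fun _ => -1 / 2) = 2 := by
      simp only [form, latticeD, Finset.sum_const, Finset.card_univ, Fintype.card_fin]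
      norm_num
    rw [this]
    push_cast
    ring
  · funext j
    push_cast
    ring

theorem hasDerivAt_psi (N : ℕ) (τ : ℍ) (z : Fin N → ℂ) :
    HasDerivAt (fun w : ℂ => psi (N + 1) τ (Fin.snoc z w)) (2 * π * I * psi N τ z) 0 := by
  have h := (hasDerivAt_theta τ).const_mul
    (ModularForm.eta τ ^ (24 - 3 * ((N + 1 : ℕ) : ℤ)) * thetaD N τ z)
  have hf : (fun w : ℂ => psi (N + 1) τ (Fin.snoc z w)) = fun w =>
      ModularForm.eta τ ^ (24 - 3 * ((N + 1 : ℕ) : ℤ)) * thetaD N τ z * theta τ w := by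
    funext w
    rw [psi, thetaD, Fin.prod_univ_castSucc]
    simp only [Fin.snoc_castSucc, Fin.snoc_last, thetaD]
    ring
  rw [hf]
  refine h.congr_deriv ?_
  -- The η³ from the derivative of ϑ raises the exponent 24 - 3(N + 1) to 24 - 3N.
  · rw [psi, show 24 - 3 * (N : ℤ) = 24 - 3 * ((N + 1 : ℕ) : ℤ) + 3 by push_cast; ring,
      zpow_add₀ (eta_ne_zero τ)]
    norm_cast
    ring

/-! ### The tower `φ_{k, D_N(2)}` -/

theorem phiD_of_eq {k N : ℕ} (hN : 1 ≤ N) (h : k + 2 * N = 24) :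
    phiD k N = fun τ z => psi N τ z ^ 2 := by
  obtain ⟨N, rfl⟩ := Nat.exists_eq_add_of_le' hN
  rw [phiD, if_pos h]

theorem phiD_succ {k N : ℕ} (h : k + 2 * (N + 1) ≠ 24) : phiD k (N + 1) = timesPhi01 (phiD k N) := by
  rw [phiD, if_neg h]

/-- Every entry of the tower arises from a square on the line k + 2N = 24 by repeated multiplication
with φ_{0,1} at fixed k. The bound k ≤ 22 excludes rank 0. -/
theorem phiD_induction {P : ℕ → (N : ℕ) → (ℍ → (Fin N → ℂ) → ℂ) → Prop}
    (base : ∀ N ≤ 8, P (24 - 2 * N) N fun τ z => psi N τ z ^ 2)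
    (step : ∀ k N φ, P k N φ → P k (N + 1) (timesPhi01 φ)) {k N : ℕ} (hN : N ≤ 8)
    (hk : Even k) (hkN : 24 ≤ k + 2 * N) (hk22 : k ≤ 22) : P k N (phiD k N) := by
  induction N with
  | zero => omega
  | succ N ih =>
    by_cases h : k + 2 * (N + 1) = 24
    · rw [phiD_of_eq (by omega) h]
      obtain rfl : k = 24 - 2 * (N + 1) := by omega
      exact base _ hN
    · rw [phiD_succ h]
      -- Evenness excludes k + 2(N + 1) = 25, so the bound persists when the rank drops by one.
      obtain ⟨m, rfl⟩ := hk
      exact step _ _ _ (ih (by omega) (by omega))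

theorem IsHolomorphic.timesPhi01 {N : ℕ} {φ : ℍ → (Fin N → ℂ) → ℂ} (h : IsHolomorphic φ) :
    IsHolomorphic (timesPhi01 φ) := by
  refine DifferentiableOn.mul ?_ ?_
  · exact differentiableOn_phi01.comp
      (f := fun p : ℂ × (Fin (N + 1) → ℂ) => (p.1, p.2 (Fin.last N))) (by fun_prop) fun _ h => h
  · refine DifferentiableOn.comp (g := fun p : ℂ × (Fin N → ℂ) => φ (ofComplex p.1) p.2) h
      (f := fun p : ℂ × (Fin (N + 1) → ℂ) => (p.1, Fin.init p.2)) ?_ fun _ h => h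
    unfold Fin.init
    fun_prop

theorem isHolomorphic_phiD {k N : ℕ} (hN : N ≤ 8) (hk : Even k) (hkN : 24 ≤ k + 2 * N)
    (hk22 : k ≤ 22) : IsHolomorphic (phiD k N) :=
  phiD_induction (P := fun _ _ φ => IsHolomorphic φ) (fun _ hN => (isHolomorphic_psi hN).pow 2)
    (fun _ _ _ h => h.timesPhi01) hN hk hkN hk22

theorem phiD_smul {k N : ℕ} (hN : N ≤ 8) (hk : Even k) (hkN : 24 ≤ k + 2 * N)
    (hk22 : k ≤ 22) (A : SL(2, ℤ)) (τ : ℍ) (z : Fin N → ℂ) :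
    phiD k N (A • τ) (fun i => z i / jac A τ) = jac A τ ^ k *
      cexp (π * I * ((A 1 0 : ℂ) * (form 2 z z / jac A τ))) * phiD k N τ z := by
  refine phiD_induction (P := fun k N φ => ∀ z, φ (A • τ) (fun i => z i / jac A τ) = jac A τ ^ k *
      cexp (π * I * ((A 1 0 : ℂ) * (form 2 z z / jac A τ))) * φ τ z)
    (fun N hN z => ?_) (fun k N φ h z => ?_) hN hk hkN hk22 z
  · have e : cexp (π * I * ((A 1 0 : ℂ) * (form 2 z z / jac A τ))) =
        cexp (π * I * ((A 1 0 : ℂ) * (form 1 z z / jac A τ))) ^ 2 := by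
      rw [← Complex.exp_nat_mul]
      congr 1
      simp only [form]
      push_cast
      ring
    change psi N (A • τ) (fun i => z i / jac A τ) ^ 2 = _ * psi N τ z ^ 2
    rw [psi_smul hN, mul_pow, mul_pow, e, ← pow_mul, show (12 - N) * 2 = 24 - 2 * N by omega]
  · have e : cexp (π * I * ((A 1 0 : ℂ) * (form 2 z z / jac A τ))) =
        cexp (2 * π * I * (A 1 0 : ℂ) * z (Fin.last N) ^ 2 / jac A τ) *
        cexp (π * I * ((A 1 0 : ℂ) * (form 2 (Fin.init z) (Fin.init z) / jac A τ))) := by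
      rw [← Complex.exp_add]
      congr 1
      simp only [form, Fin.sum_univ_castSucc, Fin.init]
      push_cast
      ring
    have hz := h (Fin.init z)
    rw [timesPhi01, timesPhi01, phi01_smul, e]
    change _ * φ (A • τ) (fun i => Fin.init z i / jac A τ) = _
    rw [hz]
    ring

theorem phiD_add_lattice {k N : ℕ} (hN : N ≤ 8) (hk : Even k) (hkN : 24 ≤ k + 2 * N)
    (hk22 : k ≤ 22) (x y : Fin N → ℤ) (τ : ℍ) (z : Fin N → ℂ) :
    phiD k N τ (fun i => z i + x i * τ + y i) =
      cexp (-(π * I * ((form 2 (fun i => (x i : ℂ)) fun i => (x i : ℂ)) * τ +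
        2 * form 2 (fun i => (x i : ℂ)) z))) * phiD k N τ z := by
  refine phiD_induction (P := fun k N φ => ∀ (x y : Fin N → ℤ) (z : Fin N → ℂ),
    φ τ (fun i => z i + x i * τ + y i) =
      cexp (-(π * I * ((form 2 (fun i => (x i : ℂ)) fun i => (x i : ℂ)) * τ +
        2 * form 2 (fun i => (x i : ℂ)) z))) * φ τ z)
    (fun N hN x y z => ?_) (fun k N φ h x y z => ?_) hN hk hkN hk22 x y z
  · simp only [psi, thetaD_add_lattice, mul_pow, ← Complex.exp_nat_mul]
    have e : cexp ((2 : ℕ) * (π * I * (∑ j, (x j + y j) : ℤ))) = 1 := by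
      rw [show ((2 : ℕ) * (π * I * ((∑ j, (x j + y j) : ℤ) : ℂ)) : ℂ) =
        ((∑ j, (x j + y j) : ℤ) : ℂ) * (2 * π * I) by push_cast; ring]
      exact Complex.exp_int_mul_two_pi_mul_I _
    rw [e, one_mul, mul_left_comm]
    congr 2
    simp only [form]
    push_cast
    ring
  · have e : cexp (-(π * I * ((form 2 (fun i => (x i : ℂ)) fun i => (x i : ℂ)) * τ +
        2 * form 2 (fun i => (x i : ℂ)) z))) =
        cexp (-(2 * π * I * (x (Fin.last N) ^ 2 * τ + 2 * x (Fin.last N) * z (Fin.last N)))) *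
        cexp (-(π * I * ((form 2 (fun i : Fin N => (x i.castSucc : ℂ)) fun i : Fin N =>
          (x i.castSucc : ℂ)) * τ +
          2 * form 2 (fun i : Fin N => (x i.castSucc : ℂ)) (Fin.init z)))) := by
      rw [← Complex.exp_add]
      congr 1
      simp only [form, Fin.sum_univ_castSucc, Fin.init]
      push_cast
      ring
    have hz := h (fun i => x i.castSucc) (fun i => y i.castSucc) (Fin.init z)
    rw [timesPhi01, timesPhi01, phi01_add_lattice, e]
    change _ * φ τ (fun i => Fin.init z i + (x i.castSucc) * τ + (y i.castSucc)) = _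
    rw [hz]
    ring

theorem hasExpansion_phiD {k N : ℕ} (hN : N ≤ 8) (hk : Even k) (hkN : 24 ≤ k + 2 * N)
    (hk22 : k ≤ 22) : HasExpansion (phiD k N) (TowerSupport N) :=
  phiD_induction (P := fun _ N φ => HasExpansion φ (TowerSupport N))
    (fun _ hN => hasExpansion_psi_sq hN) (fun _ _ _ h => h.timesPhi01) hN hk hkN hk22

theorem transforms_phiD {k N : ℕ} (hN : N ≤ 8) (hk : Even k) (hkN : 24 ≤ k + 2 * N)
    (hk22 : k ≤ 22) : Transforms (latticeD2 N) k 1 1 1 (phiD k N) :=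
  transforms_of_natural_weight (L := latticeD2 N) (isHolomorphic_phiD hN hk hkN hk22)
    (phiD_smul hN hk hkN hk22) fun x _ y _ => phiD_add_lattice hN hk hkN hk22 x y

theorem TowerSupport.property {N : ℕ} (hN : N ≤ 8) {n : ℚ} {l : Fin N → ℚ}
    (h : TowerSupport N n (fun j => (latticeD2 N).scale * l j)) :
    (∃ k : ℤ, n = ((0 : ℕ) : ℚ) / 24 + k) ∧ (latticeD2 N).InDual (2 • l) ∧
      (0 ≤ n ∧ 4 - (N : ℚ) / 2 ≤ 2 * n * 1 - form (latticeD2 N).scale l l) := by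
  obtain ⟨⟨k, hk⟩, hu, hn⟩ := h
  have hscale : (((latticeD2 N).scale : ℕ) : ℚ) = 2 := by
    simp [latticeD2, EvenLattice.rescale, latticeD]
  simp only [hscale] at hu hn
  have hN' : (N : ℚ) ≤ 8 := by exact_mod_cast hN
  refine ⟨⟨k, by rw [hk]; simp⟩, EvenLattice.inDual_of_int _ fun j => ?_, ?_, ?_⟩
  · simpa using hu j
  · have h2 : 0 ≤ ∑ j, (2 * l j) ^ 2 := Finset.sum_nonneg fun j _ => sq_nonneg _
    linarith
  · refine hn.trans (le_of_eq ?_)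
    rw [form, hscale, Finset.sum_div, Finset.mul_sum, mul_one]
    congr 1
    exact Finset.sum_congr rfl fun j _ => by ring

theorem isJacobiForm_phiD {k N : ℕ} (hN : N ≤ 8) (hk : Even k) (hkN : 24 ≤ k + 2 * N)
    (hk22 : k ≤ 22) : IsJacobiForm (latticeD2 N) k 1 1 1 (phiD k N) := by
  refine ⟨transforms_phiD hN hk hkN hk22,
    (hasExpansion_phiD hN hk hkN hk22).hasFourierExpansion _ 0 fun n l h => ?_⟩
  obtain ⟨h1, h2, h3, h4⟩ := h.property hN
  have hN' : (N : ℚ) ≤ 8 := by exact_mod_cast hN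
  exact ⟨h1, h2, h3, by linarith⟩

theorem isJacobiCuspForm_phiD {k N : ℕ} (hN : N < 8) (hk : Even k) (hkN : 24 ≤ k + 2 * N)
    (hk22 : k ≤ 22) : IsJacobiCuspForm (latticeD2 N) k 1 1 1 (phiD k N) := by
  refine ⟨transforms_phiD hN.le hk hkN hk22,
    (hasExpansion_phiD hN.le hk hkN hk22).hasFourierExpansion _ 0 fun n l h => ?_⟩
  obtain ⟨h1, h2, h3, h4⟩ := h.property hN.le
  have hN' : (N : ℚ) < 8 := by exact_mod_cast hN
  exact ⟨h1, h2, h3, by linarith⟩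

/-- The power of η removes the η-factors of ψ² on the initial line; each further φ_{0,1} brings an
η⁶, which cancels its pole of order q^{-1/4} left after the factor q^{1/4}. For N = 8 the exponent
is 0 and the limit tests cuspidality directly. -/
theorem exists_tendsto_phiD {k N : ℕ} (hN : N ≤ 8) (hk : Even k) (hkN : 24 ≤ k + 2 * N)
    (hk22 : k ≤ 22) : ∃ c : ℂ, c ≠ 0 ∧
    Tendsto (fun τ : ℍ => ModularForm.eta τ ^ (6 * (N : ℤ) - 48) *
      (cexp (π * I * τ / 2) ^ N * phiD k N τ (fun _ => -τ / 2))) atImInfty (𝓝 c) := by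
  refine phiD_induction (P := fun _ N φ => ∃ c : ℂ, c ≠ 0 ∧
    Tendsto (fun τ : ℍ => ModularForm.eta τ ^ (6 * (N : ℤ) - 48) *
      (cexp (π * I * τ / 2) ^ N * φ τ (fun _ => -τ / 2))) atImInfty (𝓝 c))
    (fun N hN => ⟨1, one_ne_zero, ?_⟩) (fun k N φ h => ?_) hN hk hkN hk22
  · have h := (tendsto_thetaD N).pow 2
    rw [one_pow] at h
    refine h.congr fun τ => ?_
    have e1 : cexp (π * I * τ / 2) = cexp (π * I * τ / 4) ^ 2 := by
      rw [← Complex.exp_nat_mul]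
      congr 1
      push_cast
      ring
    have e2 : ModularForm.eta τ ^ (6 * (N : ℤ) - 48) *
        (ModularForm.eta τ ^ (24 - 3 * (N : ℤ))) ^ 2 = 1 := by
      rw [← zpow_natCast, ← zpow_mul, ← zpow_add₀ (eta_ne_zero τ),
        show 6 * (N : ℤ) - 48 + (24 - 3 * (N : ℤ)) * ((2 : ℕ) : ℤ) = 0 by push_cast; ring,
        zpow_zero]
    change _ = _ * (_ * psi N τ _ ^ 2)
    rw [psi, e1]
    linear_combination (-((cexp (π * I * τ / 4) ^ N) ^ 2 * thetaD N τ (fun _ => -τ / 2) ^ 2)) * e2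
  · obtain ⟨c, hc, hlim⟩ := h
    obtain ⟨d, hd, hlim'⟩ := exists_tendsto_phi01_neg_half
    refine ⟨d * c, mul_ne_zero hd hc, (hlim'.mul hlim).congr fun τ => ?_⟩
    rw [show 6 * ((N + 1 : ℕ) : ℤ) - 48 = 6 * (N : ℤ) - 48 + 6 by push_cast; ring,
      zpow_add₀ (eta_ne_zero τ), timesPhi01, pow_succ]
    have e : (Fin.init fun _ : Fin (N + 1) => -(τ : ℂ) / 2) = fun _ => -(τ : ℂ) / 2 := rfl
    rw [e]
    norm_cast
    ring

theorem not_isJacobiCuspForm_phiD_eight {k : ℕ} (hk : Even k) (hk8 : 8 ≤ k) (hk22 : k ≤ 22) :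
    ¬ IsJacobiCuspForm (latticeD2 8) k 1 1 1 (phiD k 8) := by
  intro h
  obtain ⟨c, hc, hlim⟩ := exists_tendsto_phiD le_rfl hk (by omega) hk22
  refine hc (tendsto_nhds_unique hlim ((h.tendsto_zero fun _ => -1 / 2).congr fun τ => ?_))
  rw [show 6 * ((8 : ℕ) : ℤ) - 48 = 0 by norm_num, zpow_zero, one_mul, ← Complex.exp_nat_mul]
  congr 2
  · have : form (latticeD2 8).scale (fun _ : Fin 8 => (-1 / 2 : ℚ)) (fun _ => -1 / 2) = 4 := by
      simp only [form, latticeD2, latticeD, EvenLattice.rescale, Finset.sum_const,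
        Finset.card_univ, Fintype.card_fin]
      norm_num
    rw [this]
    push_cast
    ring
  · funext j
    push_cast
    ring

theorem pullsBackTo_timesPhi01 {N : ℕ} (φ : ℍ → (Fin N → ℂ) → ℂ) :
    PullsBackTo (timesPhi01 φ) φ := by
  -- The constant is the inverse of φ_{0,1}(τ, 0) = 12.
  refine ⟨1 / 12, by norm_num, fun τ z => ?_⟩
  rw [pullback, timesPhi01, Fin.snoc_last, Fin.init_snoc, phi01_zero]
  ring

end

end LatticeJacobi

/-! ### Assembly of the theorem -/

theorem mainTheorem2 :
    -- the theta product, of singular weight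
    (∀ N : ℕ, 1 ≤ N →
      LatticeJacobi.IsJacobiForm (LatticeJacobi.latticeD N) ((N : ℚ) / 2) 1
        (fun A => LatticeJacobi.vEta A ^ (3 * N)) 1 (LatticeJacobi.thetaD N)) ∧
    -- the forms of weight 12 - N
    (∀ N : ℕ, 1 ≤ N → N ≤ 8 →
      LatticeJacobi.IsJacobiForm (LatticeJacobi.latticeD N) (12 - (N : ℚ)) 1 1 1
        (LatticeJacobi.psi N) ∧
      (LatticeJacobi.IsJacobiCuspForm (LatticeJacobi.latticeD N) (12 - (N : ℚ)) 1 1 1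
        (LatticeJacobi.psi N) ↔ N < 8)) ∧
    -- quasi-pullbacks, from rank N + 1 to rank N, starting at the theta product of rank 8
    LatticeJacobi.psi 8 = LatticeJacobi.thetaD 8 ∧
    (∀ N : ℕ, N + 1 ≤ 8 → ∀ (τ : UpperHalfPlane) (z : Fin N → ℂ),
      HasDerivAt (fun w : ℂ => LatticeJacobi.psi (N + 1) τ (Fin.snoc z w))
        (2 * Real.pi * Complex.I * LatticeJacobi.psi N τ z) 0) ∧
    -- the tower: the first line, the remaining entries, and the arrows
    (∀ N : ℕ, 1 ≤ N → N ≤ 8 →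
      LatticeJacobi.phiD (24 - 2 * N) N = fun τ z => LatticeJacobi.psi N τ z ^ 2) ∧
    (∀ N k : ℕ, 1 ≤ N → N ≤ 8 → Even k → 24 ≤ k + 2 * N → k ≤ 22 →
      LatticeJacobi.IsJacobiForm (LatticeJacobi.latticeD2 N) (k : ℚ) 1 1 1
        (LatticeJacobi.phiD k N) ∧
      (LatticeJacobi.IsJacobiCuspForm (LatticeJacobi.latticeD2 N) (k : ℚ) 1 1 1
        (LatticeJacobi.phiD k N) ↔ N < 8)) ∧
    (∀ N k : ℕ, 1 ≤ N → N + 1 ≤ 8 → Even k → 24 ≤ k + 2 * N → k ≤ 22 →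
      LatticeJacobi.phiD k (N + 1) = LatticeJacobi.timesPhi01 (LatticeJacobi.phiD k N) ∧
      LatticeJacobi.PullsBackTo (LatticeJacobi.phiD k (N + 1)) (LatticeJacobi.phiD k N)) := by
  refine ⟨fun N _ => LatticeJacobi.isJacobiForm_thetaD N,
    fun N _ hN => ⟨LatticeJacobi.isJacobiForm_psi hN, fun h => ?_,
      LatticeJacobi.isJacobiCuspForm_psi⟩,
    LatticeJacobi.psi_eight, fun N _ => LatticeJacobi.hasDerivAt_psi N,
    fun N h1 hN => LatticeJacobi.phiD_of_eq h1 (by omega), fun N k _ hN hk hkN hk22 =>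
      ⟨LatticeJacobi.isJacobiForm_phiD hN hk hkN hk22, fun h => ?_,
        fun hN' => LatticeJacobi.isJacobiCuspForm_phiD hN' hk hkN hk22⟩, fun N k _ _ _ hkN _ => ?_⟩
  · refine lt_of_le_of_ne hN ?_
    rintro rfl
    exact LatticeJacobi.not_isJacobiCuspForm_psi_eight h
  · refine lt_of_le_of_ne hN ?_
    rintro rfl
    exact LatticeJacobi.not_isJacobiCuspForm_phiD_eight hk (by omega) hk22 h
  · have e := LatticeJacobi.phiD_succ (k := k) (N := N) (by omega)
    rw [e]
    exact ⟨rfl, LatticeJacobi.pullsBackTo_timesPhi01 _⟩
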